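/- **Definitions.** A hypergraph on $[n]$ is a set $H$ of subsets of $[n]$ (hyperedges); the arity of a hyperedge is its cardinality. For $\epsilon\in(0,1)$, a $(1\pm\epsilon)$-sparsifier of $H$ is an assignment of nonnegative weights $w_e$ to the hyperedges, with $w_e\neq 0$ only for $e\in H$, such that for every $T\subseteq[n]$ the total weight of the hyperedges meeting both $T$ and $[n]\setminus T$ is between $(1-\epsilon)$ and $(1+\epsilon)$ times the number of hyperedges of $H$ meeting both. A dynamic stream is a finite sequence of pairs $(e_i,u_i)$ with $e_i\subseteq[n]$ and $u_i\in\{+1,-1\}$ (insertion or deletion). It results in $H$ if for each $e\subseteq[n]$ the sum of the $u_i$ with $e_i=e$ is $1$ when $e\in H$ and $0$ otherwise; no condition is imposed on intermediate times. A linear sketch $\mathcal S$ consists of a modulus $q\ge1$, a number $k$ of measurements, a matrix over $\mathbb Z/q$ of size $k\times 2^n$ for every random seed $R$ (the sketch $\mathcal S(x,R)\in(\mathbb Z/q)^k$ of $x\in\mathbb Z^{2^{[n]}}$ being the product of this matrix with $x$), and a recovery map that sends $R$ and the measurements to a weighting of the hyperedges. Given $\mathcal S$ and a finite set $S$ of seeds,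 the streaming algorithm DynamicHypergraphSparsification draws $R\in S$ uniformly at random, stores the index of $R$ in $S$ together with the current sketch, starts from $\mathcal S(0,R)$, adds $u_i\cdot\mathcal S(e_i,R)$ for each stream element $(e_i,u_i)$, and at the end applies the recovery map. Its space is the number of bits needed to store its whole memory (index of the seed and sketch), i.e. $\lceil\log_2(|S|\,q^k)\rceil$. The algorithm is non-uniform: $\mathcal S$ and $S$ may depend on $n,r,m,\epsilon$ and are not counted in the space. **Theorem.** There are absolute constants $C,c$ such that for all integers $n\ge1$, $r\ge1$, $m\ge2$ and all $\epsilon\in(0,1)$ there are a linear sketch $\mathcal S$ and a set $S$ of exactly $2^{10n}$ seeds such that the algorithm DynamicHypergraphSparsification for $\mathcal S$ and $S$ 1. uses $\widetilde O(nr\log(m)/\epsilon^2)$ bits of space, that is, at most $C\,X\,\log^c(2+X)$ bits, where $X=nr\log(m)/\epsilon^2$; and 2. for every hypergraph $H$ on $[n]$ with at most $m$ hyperedges, each of arity at most $r$, and every dynamic stream that results in $H$, outputs a $(1\pm\epsilon)$-sparsifier of $H$ with probability at least $1-1/n^6$ over the choice of $R\in S$. -/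

import Mathlib

/-- A hyperedge on the vertex set `Fin n`: an arbitrary set of vertices. Its arity is its size. -/
abbrev Hyperedge (n : ℕ) := Finset (Fin n)

/-- An unweighted hypergraph on the vertex set `Fin n`: a set of hyperedges. -/
abbrev FinHypergraph (n : ℕ) := Finset (Hyperedge n)

/-- The hyperedge `e` is cut by the bipartition `(S, V \ S)`: it meets both sides. -/
def Crosses {n : ℕ} (S : Finset (Fin n)) (e : Hyperedge n) : Prop :=
  (∃ v ∈ e, v ∈ S) ∧ (∃ v ∈ e, v ∉ S)

open Classical in
/-- The weight of the cut `(S, V \ S)` when each hyperedge `e` has weight `w e`. -/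
noncomputable def cutWeight {n : ℕ} (w : Hyperedge n → ℝ) (S : Finset (Fin n)) : ℝ :=
  ∑ e : Hyperedge n, if Crosses S e then w e else 0

/-- The weight function of an unweighted hypergraph. -/
def FinHypergraph.weight {n : ℕ} (H : FinHypergraph n) (e : Hyperedge n) : ℝ :=
  if e ∈ H then 1 else 0

/-- `w` is a `(1 ± ε)`-sparsifier of `H`: a reweighted subhypergraph of `H` (nonnegative weights,
supported on hyperedges of `H`) that preserves the weight of every cut up to a factor `1 ± ε`. -/
structure IsSparsifier {n : ℕ} (ε : ℝ) (H : FinHypergraph n) (w : Hyperedge n → ℝ) : Prop where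
  nonneg : ∀ e, 0 ≤ w e
  subhypergraph : ∀ e, w e ≠ 0 → e ∈ H
  lower : ∀ S : Finset (Fin n), (1 - ε) * cutWeight H.weight S ≤ cutWeight w S
  upper : ∀ S : Finset (Fin n), cutWeight w S ≤ (1 + ε) * cutWeight H.weight S

/-- One element of a dynamic stream: a hyperedge with a sign, `1` for an insertion and `-1` for a
deletion (`ℤˣ` is the set `{1, -1}`). -/
abbrev StreamUpdate (n : ℕ) := Hyperedge n × ℤˣ

/-- The net multiplicity of `e` after the stream: number of insertions minus number of deletions. -/
def netMultiplicity {n : ℕ} (σ : List (StreamUpdate n)) (e : Hyperedge n) : ℤ :=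
  (σ.map fun x => if x.1 = e then (x.2 : ℤ) else 0).sum

/-- The stream `σ`, started from the empty hypergraph, results in the unweighted hypergraph `H`. -/
def ResultsIn {n : ℕ} (σ : List (StreamUpdate n)) (H : FinHypergraph n) : Prop :=
  ∀ e, netMultiplicity σ e = if e ∈ H then 1 else 0

/-- A (non-uniform) randomized one-pass dynamic streaming algorithm for hypergraphs on `n` vertices
which outputs a weight function on hyperedges. The seed is drawn uniformly at random before the
stream starts. Afterwards the algorithm sees nothing but its memory and the current stream element,
so that any random bits which it uses again have to be kept in the memory. -/
structure StreamingAlgorithm (n : ℕ) where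
  Seed : Type
  Memory : Type
  finite_seed : Finite Seed
  finite_memory : Finite Memory
  init : Seed → Memory
  update : Memory → StreamUpdate n → Memory
  output : Memory → Hyperedge n → ℝ

namespace StreamingAlgorithm

variable {n : ℕ} (A : StreamingAlgorithm n)

/-- The space of the algorithm: the number of bits needed to write down a memory configuration. -/
noncomputable def space : ℕ := Nat.clog 2 (Nat.card A.Memory)

/-- The output after the stream `σ`, for the seed `ω`. -/
def run (ω : A.Seed) (σ : List (StreamUpdate n)) : Hyperedge n → ℝ :=
  A.output (σ.foldl A.update (A.init ω))

/-- The probability, over a uniformly random seed, that after the stream `σ` the output is a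
`(1 ± ε)`-sparsifier of `H`. -/
noncomputable def successProb (ε : ℝ) (σ : List (StreamUpdate n)) (H : FinHypergraph n) : ℝ :=
  ({ω : A.Seed | IsSparsifier ε H (A.run ω σ)}.ncard : ℝ) / (Nat.card A.Seed : ℝ)

end StreamingAlgorithm

/-- A linear sketch with a public random seed: for every seed, `size` linear measurements modulo
`modulus` of vectors indexed by the `2 ^ n` possible hyperedges, together with a procedure
that, knowing the seed, recovers a weighted hypergraph from the measurements. -/
structure LinearSketch (n : ℕ) where
  Seed : Type
  modulus : ℕ
  modulus_ne_zero : NeZero modulus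
  size : ℕ
  matrix : Seed → Matrix (Fin size) (Hyperedge n) (ZMod modulus)
  recover : Seed → (Fin size → ZMod modulus) → Hyperedge n → ℝ

/-- The sketch of the vector `x` with seed `R`: the matrix of `R` times `x`. -/
def LinearSketch.sketch {n : ℕ} (L : LinearSketch n) (R : L.Seed) (x : Hyperedge n → ℤ) :
    Fin L.size → ZMod L.modulus :=
  (L.matrix R).mulVec fun e => (x e : ZMod L.modulus)

/-- The algorithm DynamicHypergraphSparsification for the linear sketch `L` and a hard-wired set `S`
of seeds: draw `R` uniformly from `S` and remember which element of `S` it is; start with the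
sketch of the empty hypergraph; on the stream element `(e, u)` add `u` times the sketch of `e`;
at the end recover a weighted hypergraph from the sketch. -/
abbrev dynamicHypergraphSparsification {n : ℕ} (L : LinearSketch n) (S : Finset L.Seed) :
    StreamingAlgorithm n where
  Seed := S
  Memory := S × (Fin L.size → ZMod L.modulus)
  finite_seed := inferInstance
  finite_memory := by
    have := L.modulus_ne_zero
    infer_instance
  init R := (R, L.sketch R 0)
  update M x := (M.1, M.2 + (x.2 : ℤ) • L.sketch M.1 (Pi.single x.1 1))
  output M := L.recover M.1 M.2

/-- The quantity `X * (log (2 + X)) ^ c`: a bound `O(X polylog X)` is a bound by a constant times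
this quantity for some fixed exponent `c`. -/
noncomputable def polylogTimes (c : ℕ) (X : ℝ) : ℝ := X * Real.log (2 + X) ^ c

namespace HypergraphSketch

open scoped Classical
open Finset

/-! The hyperedges are sampled at the rates `2 ^ d / 2 ^ L`, and every sample is measured modulo 2
at each vertex. The contributions of a hyperedge sum to zero over its vertices, so adding the
measurements over a class of a partition `Q` erases every hyperedge inside a class. What `Q` cuts
can be decoded when it is sparse, that is, when each coarsening absorbs only `O(k)` hyperedges per
lost class: two candidates with symmetric difference `z` are confused with probability `2 ^ (-B)`
per class lost by contracting `z`, and sparsity bounds the number of such `z` exponentially in the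
same quantity (`prob_ambiguous_le`).

At the lowest rate the discrete partition is sparse enough because `H` has at most `2 ^ L`
hyperedges. Before the rate doubles, dense groups of classes are merged: `step` minimises the number
of cut hyperedges minus a threshold times the number of classes. The minimiser depends on its
sample, so it need not be sparse for `H`. Repeating with fresh samples and slowly growing thresholds
at least halves the number of merges per round; once `n < 2 ^ T`, nothing would be merged after `T`
rounds, and sparsity passes to `H` (`sparse_rounds`). Conversely, semimodularity of the partition
lattice keeps the merging inside the strong components of `H` (`step_le`). Both facts need counts
that concentrate for all pairs of partitions at once: the Chernoff bound decays exponentially in the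
number of lost classes and beats the number of coarsenings (`prob_not_concentrated_le`).

The output takes each hyperedge from a last, independent round, at the last rate whose partition
still cuts it, weighted by the inverse rate. This rate is at least the one dictated by the strength
of the hyperedge. Scaled by the latter rate, the strong components have only cuts of weight at least
`k / 2` (`strength_le`), cut counting in the style of Karger pays for the union bound over cuts
(`sum_exp_cut_le`), and every cut of `H` is a combination of cuts of the levels
(`isSparsifier_of_levels`).

For a fixed `H` this fails with probability at most `1 / (8 * n ^ 6)`. An exponential moment over
all `2 ^ 2 ^ n` hypergraphs gives one list of `2 ^ (10 * n)` seeds good for all of them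
(`exists_seeds`), so that only an index is stored. By linearity only the net result of the stream
matters. -/

theorem sum_biUnion_le {ι κ : Type*} (s : Finset ι) (t : ι → Finset κ) {f : κ → ℝ}
    (hf : ∀ x, 0 ≤ f x) : ∑ x ∈ s.biUnion t, f x ≤ ∑ i ∈ s, ∑ x ∈ t i, f x := by
  induction s using Finset.induction_on with
  | empty => simp
  | insert i s hi ih =>
    rw [biUnion_insert, sum_insert hi]
    refine le_trans ?_ (add_le_add_right ih _)
    rw [← sum_union_inter]
    exact le_add_of_nonneg_right (sum_nonneg fun x _ => hf x)

/-! ### The lattice of vertex partitions: semimodularity and a weighted count of coarsenings. -/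

section Partitions

variable {V : Type*}

instance [Finite V] : Finite (Setoid V) :=
  Finite.of_injective (fun Q : Setoid V => (Q : V → V → Prop)) fun _ _ h =>
    Setoid.ext fun a b => iff_of_eq (congrFun (congrFun h a) b)

noncomputable instance [Finite V] : Fintype (Setoid V) := Fintype.ofFinite _

/-- The number of classes of a partition. -/
noncomputable def numClasses (Q : Setoid V) : ℕ := Nat.card (Quotient Q)

/-- The partition obtained by merging the classes of `u` and `v`. -/
noncomputable def merge (Q : Setoid V) (u v : V) : Setoid V :=
  Setoid.ker fun x => if Q x v then (Quotient.mk Q u) else Quotient.mk Q x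

theorem le_merge (Q : Setoid V) (u v : V) : Q ≤ merge Q u v := by
  intro x y h
  have hiff : Q x v ↔ Q y v := ⟨fun hx => Q.trans' (Q.symm' h) hx, fun hy => Q.trans' h hy⟩
  change (if Q x v then (Quotient.mk Q u) else Quotient.mk Q x) =
    if Q y v then (Quotient.mk Q u) else Quotient.mk Q y
  rw [if_congr hiff rfl rfl, Quotient.sound (s := Q) h]

theorem merge_rel (Q : Setoid V) (u v : V) : merge Q u v u v := by
  change (if Q u v then (Quotient.mk Q u) else Quotient.mk Q u) =
    if Q v v then (Quotient.mk Q u) else Quotient.mk Q v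
  rw [if_pos (Q.refl' v), ite_self]

theorem merge_le {Q R : Setoid V} {u v : V} (h : Q ≤ R) (huv : R u v) : merge Q u v ≤ R := by
  intro x y hxy
  change (if Q x v then (Quotient.mk Q u) else Quotient.mk Q x) =
    (if Q y v then (Quotient.mk Q u) else Quotient.mk Q y) at hxy
  have key : ∀ z w : V, (if Q z v then (Quotient.mk Q u) else Quotient.mk Q z) = Quotient.mk Q w →
      R z w := by
    intro z w hz
    split_ifs at hz with hzv
    · exact R.trans' (h hzv) (R.trans' (R.symm' huv) (h (Quotient.exact hz)))
    · exact h (Quotient.exact hz)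
  by_cases hy : Q y v
  · rw [if_pos hy] at hxy
    exact R.trans' (key x u hxy) (R.trans' huv (R.symm' (h hy)))
  · rw [if_neg hy] at hxy
    exact key x y hxy

variable [Finite V]

theorem numClasses_merge {Q : Setoid V} {u v : V} (h : ¬ Q u v) :
    numClasses (merge Q u v) + 1 = numClasses Q := by
  have := Fintype.ofFinite (Quotient Q)
  unfold numClasses merge
  rw [Nat.card_congr (Setoid.quotientKerEquivRange _)]
  have hr : Set.range (fun x => if Q x v then (Quotient.mk Q u) else Quotient.mk Q x) =
      {Quotient.mk Q v}ᶜ := by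
    ext c
    induction c using Quotient.inductionOn with | _ c => ?_
    simp only [Set.mem_range, Set.mem_compl_iff, Set.mem_singleton_iff]
    constructor
    · rintro ⟨x, hx⟩ hc
      split_ifs at hx with hxv
      · exact h (Quotient.exact (hx.trans hc))
      · exact hxv (Quotient.exact (hx.trans hc))
    · intro hc
      refine ⟨c, ?_⟩
      rw [if_neg]
      exact fun hcv => hc (Quotient.sound hcv)
  rw [hr, Nat.card_coe_set_eq, Set.ncard_compl, Set.ncard_singleton]
  have : 0 < Nat.card (Quotient Q) := Nat.card_pos_iff.2 ⟨⟨Quotient.mk Q v⟩, inferInstance⟩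
  omega

theorem exists_rel_not_rel {V : Type*} {Q R : Setoid V} (h : Q ≤ R) (hne : Q ≠ R) :
    ∃ u v, R u v ∧ ¬ Q u v := by
  by_contra! hc
  exact hne (le_antisymm h fun _ _ huv => hc _ _ huv)

theorem numClasses_mono {Q R : Setoid V} (h : Q ≤ R) : numClasses R ≤ numClasses Q :=
  Nat.card_le_card_of_surjective (Quotient.map' id h)
    fun c => Quotient.inductionOn c fun x => ⟨Quotient.mk Q x, rfl⟩

theorem numClasses_lt {Q R : Setoid V} (h : Q ≤ R) (hne : Q ≠ R) :
    numClasses R < numClasses Q := by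
  obtain ⟨u, v, hR, hQ⟩ := exists_rel_not_rel h hne
  have h1 := numClasses_merge hQ
  have h2 := numClasses_mono (merge_le h hR)
  omega

theorem eq_of_numClasses_le {Q R : Setoid V} (h : Q ≤ R) (hc : numClasses Q ≤ numClasses R) :
    Q = R := by
  by_contra hne
  exact absurd (numClasses_lt h hne) (not_lt.2 hc)

theorem numClasses_bot {V : Type*} : numClasses (⊥ : Setoid V) = Nat.card V := by
  refine (Nat.card_congr ⟨fun x => Quotient.mk _ x, fun c => Quotient.lift id (fun _ _ h => h) c,
    fun x => rfl, fun c => ?_⟩).symm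
  induction c using Quotient.inductionOn with | _ c => rfl

theorem numClasses_le (Q : Setoid V) : numClasses Q ≤ Nat.card V :=
  numClasses_bot (V := V) ▸ numClasses_mono bot_le

theorem numClasses_pos [Nonempty V] (Q : Setoid V) : 0 < numClasses Q :=
  Nat.card_pos_iff.2 ⟨⟨Quotient.mk Q (Classical.arbitrary V)⟩, inferInstance⟩

/-- Merging one pair of vertices loses at most one class. -/
theorem numClasses_le_merge (Q : Setoid V) (u v : V) :
    numClasses Q ≤ numClasses (merge Q u v) + 1 := by
  by_cases h : Q u v
  · rw [show merge Q u v = Q from le_antisymm (merge_le le_rfl h) (le_merge Q u v)]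
    omega
  · exact (numClasses_merge h).ge

/-- Semimodularity of the partition lattice. -/
theorem numClasses_add_le {M P : Setoid V} (hMP : M ≤ P) {Q : Setoid V} (hMQ : M ≤ Q) :
    numClasses Q + numClasses P ≤ numClasses (Q ⊔ P) + numClasses M := by
  induction hd : numClasses M - numClasses P generalizing M Q with
  | zero =>
    have := eq_of_numClasses_le hMP (by omega)
    subst this
    rw [sup_eq_left.2 hMQ]
  | succ b ih =>
    -- Merging one pair related by `P` costs `M` exactly one class and `Q` at most one, and leaves
    -- `Q ⊔ P` unchanged.
    obtain ⟨u, v, hP, hM⟩ := exists_rel_not_rel hMP (by rintro rfl; omega)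
    have h1 := numClasses_merge hM
    have h2 := numClasses_le_merge Q u v
    have h3 : merge M u v ≤ merge Q u v := merge_le (hMQ.trans (le_merge Q u v)) (merge_rel Q u v)
    have h4 := ih (merge_le hMP hP) h3 (by omega)
    have h5 : merge Q u v ⊔ P = Q ⊔ P :=
      le_antisymm (sup_le (merge_le le_sup_left (le_sup_right (a := Q) hP)) le_sup_right)
        (sup_le_sup_right (le_merge Q u v) P)
    rw [h5] at h4
    omega

/-- Every proper coarsening of `Q` lies above the merge of some pair. There are at most `|V| ^ 2`
pairs and each merge costs a factor `x`, so the sum obeys `s ≤ 1 + |V| ^ 2 * x * 2`. This pays for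
all union bounds over partitions. -/
theorem sum_pow_numClasses_le {x : ℝ} (hx : 0 ≤ x) (hx2 : (Nat.card V : ℝ) ^ 2 * x ≤ 1 / 2)
    (Q : Setoid V) :
    ∑ R ∈ univ.filter (fun R => Q ≤ R), x ^ (numClasses Q - numClasses R) ≤ 2 := by
  have := Fintype.ofFinite V
  induction hN : numClasses Q using Nat.strong_induction_on generalizing Q with | _ N ih => ?_
  subst hN
  have hsub : univ.filter (fun R => Q ≤ R) ⊆
      {Q} ∪ (univ.filter fun c : V × V => ¬ Q c.1 c.2).biUnion
        fun c => univ.filter fun R => merge Q c.1 c.2 ≤ R := by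
    intro R hR
    simp only [mem_filter, mem_univ, true_and] at hR
    by_cases h : Q = R
    · simp [h]
    · obtain ⟨u, v, h1, h2⟩ := exists_rel_not_rel hR h
      simp only [mem_union, mem_biUnion, mem_filter, mem_univ, true_and]
      exact Or.inr ⟨(u, v), h2, merge_le hR h1⟩
  have hnn : ∀ R : Setoid V, 0 ≤ x ^ (numClasses Q - numClasses R) := fun R => pow_nonneg hx _
  calc _ ≤ _ := sum_le_sum_of_subset_of_nonneg hsub fun R _ _ => hnn R
    _ ≤ ∑ R ∈ {Q}, x ^ (numClasses Q - numClasses R) +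
        ∑ R ∈ (univ.filter fun c : V × V => ¬ Q c.1 c.2).biUnion
          fun c => univ.filter fun R => merge Q c.1 c.2 ≤ R,
          x ^ (numClasses Q - numClasses R) := by
        rw [← sum_union_inter]
        exact le_add_of_nonneg_right (sum_nonneg fun R _ => hnn R)
    _ ≤ 1 + ∑ c ∈ univ.filter fun c : V × V => ¬ Q c.1 c.2,
          ∑ R ∈ univ.filter fun R => merge Q c.1 c.2 ≤ R,
            x ^ (numClasses Q - numClasses R) := by
        refine add_le_add (by simp) (sum_biUnion_le _ _ hnn)
    _ ≤ 1 + ∑ c ∈ univ.filter fun c : V × V => ¬ Q c.1 c.2, x * 2 := by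
        gcongr with c hc
        simp only [mem_filter, mem_univ, true_and] at hc
        have h1 := numClasses_merge hc
        have h2 := ih _ (by omega) (merge Q c.1 c.2) rfl
        refine le_trans (le_of_eq ?_) (mul_le_mul_of_nonneg_left h2 hx)
        rw [mul_sum]
        refine sum_congr rfl fun R hR => ?_
        simp only [mem_filter, mem_univ, true_and] at hR
        have h3 := numClasses_mono hR
        rw [← pow_succ']
        congr 1
        omega
    _ ≤ 1 + (Nat.card V : ℝ) ^ 2 * (x * 2) := by
        rw [sum_const, nsmul_eq_mul]
        gcongr
        have : (univ.filter fun c : V × V => ¬ Q c.1 c.2).card ≤ Nat.card V ^ 2 := by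
          refine (card_le_univ _).trans ?_
          simp [Fintype.card_prod, sq]
        exact_mod_cast this
    _ ≤ 2 := by linarith

end Partitions

/-! ### Finite uniform probability: union bounds, resampling, Chernoff. -/

section Probability

/-- The mean of a function on a finite type. -/
noncomputable def avg {Ω : Type*} [Fintype Ω] (f : Ω → ℝ) : ℝ := (∑ ω, f ω) / Fintype.card Ω

/-- The probability of an event under the uniform distribution on a finite type. -/
noncomputable def prob {Ω : Type*} [Fintype Ω] (p : Ω → Prop) : ℝ :=
  avg fun ω => if p ω then 1 else 0

variable {Ω : Type*} [Fintype Ω]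

theorem avg_mono {f g : Ω → ℝ} (h : ∀ ω, f ω ≤ g ω) : avg f ≤ avg g := by
  unfold avg
  gcongr with ω
  exact h ω

theorem avg_add (f g : Ω → ℝ) : avg (fun ω => f ω + g ω) = avg f + avg g := by
  simp only [avg, sum_add_distrib, add_div]

theorem avg_const_mul (c : ℝ) (f : Ω → ℝ) : avg (fun ω => c * f ω) = c * avg f := by
  simp only [avg, ← mul_sum, mul_div_assoc]

theorem avg_const [Nonempty Ω] (c : ℝ) : avg (fun _ : Ω => c) = c := by
  have : (Fintype.card Ω : ℝ) ≠ 0 := by exact_mod_cast Fintype.card_ne_zero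
  simp [avg, this]

theorem avg_sum {κ : Type*} (s : Finset κ) (f : κ → Ω → ℝ) :
    avg (fun ω => ∑ i ∈ s, f i ω) = ∑ i ∈ s, avg (f i) := by
  simp only [avg]
  rw [sum_comm, sum_div]

theorem avg_nonneg {f : Ω → ℝ} (h : ∀ ω, 0 ≤ f ω) : 0 ≤ avg f :=
  div_nonneg (sum_nonneg fun ω _ => h ω) (Nat.cast_nonneg _)

theorem prob_eq_card (p : Ω → Prop) :
    prob p = ((univ.filter p).card : ℝ) / Fintype.card Ω := by
  simp [prob, avg]

theorem prob_le_avg {p : Ω → Prop} {f : Ω → ℝ} (hf : ∀ ω, 0 ≤ f ω) (h : ∀ ω, p ω → 1 ≤ f ω) :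
    prob p ≤ avg f := by
  refine avg_mono fun ω => ?_
  split_ifs with hp
  · exact h ω hp
  · exact hf ω

theorem prob_mono {p q : Ω → Prop} (h : ∀ ω, p ω → q ω) : prob p ≤ prob q := by
  refine prob_le_avg (fun ω => by positivity) fun ω hp => ?_
  rw [if_pos (h ω hp)]

theorem prob_false : prob (fun _ : Ω => False) = 0 := by simp [prob, avg]

theorem prob_or_le (p q : Ω → Prop) : prob (fun ω => p ω ∨ q ω) ≤ prob p + prob q := by
  unfold prob
  rw [← avg_add]
  refine prob_le_avg (fun ω => by positivity) ?_
  rintro ω (h | h)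
  · rw [if_pos h]
    exact le_add_of_nonneg_right (by positivity)
  · rw [if_pos h]
    exact le_add_of_nonneg_left (by positivity)

theorem prob_exists_le {κ : Type*} (s : Finset κ) (p : κ → Ω → Prop) :
    prob (fun ω => ∃ i ∈ s, p i ω) ≤ ∑ i ∈ s, prob (p i) := by
  unfold prob
  rw [← avg_sum]
  refine prob_le_avg (fun ω => sum_nonneg fun i _ => by positivity) ?_
  rintro ω ⟨i, hi, h⟩
  calc (1 : ℝ) = if p i ω then 1 else 0 := by rw [if_pos h]
    _ ≤ _ := single_le_sum (f := fun i => if p i ω then (1 : ℝ) else 0)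
      (fun i _ => by positivity) hi

theorem prob_exists_le_card_mul {κ : Type*} (s : Finset κ) (p : κ → Ω → Prop) {δ : ℝ}
    (h : ∀ i ∈ s, prob (p i) ≤ δ) : prob (fun ω => ∃ i ∈ s, p i ω) ≤ s.card * δ := by
  refine (prob_exists_le s p).trans ?_
  rw [← nsmul_eq_mul]
  exact sum_le_card_nsmul s _ δ h

theorem avg_prod_type {Ω' : Type*} [Fintype Ω'] (f : Ω × Ω' → ℝ) :
    avg f = avg fun a => avg fun b => f (a, b) := by
  simp only [avg, Fintype.sum_prod_type, Fintype.card_prod, Nat.cast_mul, sum_div, div_div]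
  simp_rw [mul_comm (Fintype.card Ω' : ℝ)]

/-- An event whose conditional probabilities are at most `δ` has probability at most `δ`. -/
theorem prob_prod_le [Nonempty Ω] {Ω' : Type*} [Fintype Ω'] {p : Ω × Ω' → Prop} {δ : ℝ}
    (h : ∀ a, prob (fun b => p (a, b)) ≤ δ) : prob p ≤ δ := by
  unfold prob
  rw [avg_prod_type]
  exact (avg_mono h).trans_eq (avg_const δ)

theorem prob_fst [Nonempty Ω] {Ω' : Type*} [Fintype Ω'] [Nonempty Ω'] (p : Ω → Prop) :
    prob (fun ω : Ω × Ω' => p ω.1) = prob p := by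
  unfold prob
  rw [avg_prod_type]
  exact congrArg avg (funext fun a => avg_const (if p a then (1 : ℝ) else 0))

variable {ι X : Type*} [Fintype ι] [DecidableEq ι] [Fintype X]

/-- Resampling a set of coordinates does not change the distribution. -/
theorem prob_le_of_resample [Nonempty X] (A : Set ι) {p : (ι → X) → Prop} {δ : ℝ}
    (h : ∀ u, prob (fun u' => p (A.piecewise u' u)) ≤ δ) : prob p ≤ δ := by
  have h1 : avg (fun w : (ι → X) × (ι → X) => if p w.1 then (1 : ℝ) else 0) =
      avg fun w : (ι → X) × (ι → X) => if p (A.piecewise w.2 w.1) then (1 : ℝ) else 0 := by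
    unfold avg
    congr 1
    -- Two independent copies exchange their coordinates in `A`; this permutes the pairs, so the
    -- uniform law is kept.
    have hinv : Function.Involutive fun w : (ι → X) × (ι → X) =>
        (A.piecewise w.2 w.1, A.piecewise w.1 w.2) := by
      intro w
      refine Prod.ext ?_ ?_ <;> funext i <;> by_cases hi : i ∈ A <;> simp [hi]
    exact (Equiv.sum_comp hinv.toPerm
      fun w : (ι → X) × (ι → X) => if p w.1 then (1 : ℝ) else 0).symm
  rw [← prob_fst (Ω' := ι → X), prob, h1]
  exact prob_prod_le h

theorem avg_prod_pi (g : ι → X → ℝ) : avg (fun u : ι → X => ∏ i, g i (u i)) = ∏ i, avg (g i) := by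
  simp only [avg, prod_div_distrib, prod_const, card_univ, Fintype.card_pi, prod_univ_sum,
    Fintype.piFinset_univ, Nat.cast_pow]

theorem prob_eval [Nonempty X] (i : ι) (p : X → Prop) : prob (fun u : ι → X => p (u i)) = prob p := by
  have h := avg_prod_pi fun j (x : X) => if j = i then (if p x then (1 : ℝ) else 0) else 1
  have h1 : ∀ u : ι → X, (∏ j, if j = i then (if p (u j) then (1 : ℝ) else 0) else 1) =
      if p (u i) then 1 else 0 := fun u => by simp [prod_ite_eq']
  simp only [h1] at h
  rw [prob, h, prod_eq_single i]
  · simp [prob]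
  · intro j _ hj
    simp [hj, avg_const]
  · simp

section Chernoff

theorem exp_sub_one_le {θ : ℝ} (h : |θ| ≤ 1) : Real.exp θ - 1 ≤ θ + θ ^ 2 := by
  have := Real.abs_exp_sub_one_sub_id_le h
  have := (abs_le.1 this).2
  linarith

/-- Convexity of the exponential on `[0, 1]`. -/
theorem exp_mul_le {θ z : ℝ} (h0 : 0 ≤ z) (h1 : z ≤ 1) :
    Real.exp (θ * z) ≤ 1 + z * (Real.exp θ - 1) := by
  have := convexOn_exp.2 (Set.mem_univ 0) (Set.mem_univ θ) (sub_nonneg.2 h1) h0 (by ring)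
  simp only [smul_eq_mul, mul_zero, zero_add, Real.exp_zero, mul_one] at this
  rw [mul_comm θ z]
  linarith

/-- Injectivity of `f` gives each coordinate at most one summand, so the moment factors; convexity
then reduces each factor to a two-point variable. -/
theorem avg_exp_le [Nonempty X] {κ : Type*} (E : Finset κ) {f : κ → ι} (hf : Set.InjOn f E)
    {z : κ → X → ℝ} (h0 : ∀ e x, 0 ≤ z e x) (h1 : ∀ e x, z e x ≤ 1) {θ : ℝ} (hθ : |θ| ≤ 1) :
    avg (fun u : ι → X => Real.exp (θ * ∑ e ∈ E, z e (u (f e)))) ≤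
      Real.exp ((θ + θ ^ 2) * ∑ e ∈ E, avg (z e)) := by
  have hprod : ∀ u : ι → X, Real.exp (θ * ∑ e ∈ E, z e (u (f e))) =
      ∏ i, ∏ e ∈ E.filter (fun e => f e = i), Real.exp (θ * z e (u i)) := by
    intro u
    rw [mul_sum, Real.exp_sum, ← prod_fiberwise_of_maps_to (t := univ) (g := f) (by simp)]
    refine prod_congr rfl fun i _ => prod_congr rfl fun e he => ?_
    rw [(mem_filter.1 he).2]
  simp only [hprod]
  rw [avg_prod_pi (fun i x => ∏ e ∈ E.filter (fun e => f e = i), Real.exp (θ * z e x)), mul_sum,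
    Real.exp_sum, ← prod_fiberwise_of_maps_to (t := univ) (g := f) (by simp)]
  refine prod_le_prod (fun i _ => avg_nonneg fun x => by positivity) fun i _ => ?_
  rcases (E.filter fun e => f e = i).eq_empty_or_nonempty with h | ⟨e, he⟩
  · simp [h, avg_const]
  · have hs : (E.filter fun e => f e = i) = {e} := by
      refine eq_singleton_iff_unique_mem.2 ⟨he, fun e' he' => ?_⟩
      simp only [mem_filter] at he he'
      exact hf he'.1 he.1 (he'.2.trans he.2.symm)
    simp only [hs, prod_singleton]
    calc avg (fun x => Real.exp (θ * z e x)) ≤ avg fun x => 1 + (Real.exp θ - 1) * z e x :=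
          avg_mono fun x => (exp_mul_le (h0 e x) (h1 e x)).trans_eq (by ring)
      _ = (Real.exp θ - 1) * avg (z e) + 1 := by rw [avg_add, avg_const, avg_const_mul]; ring
      _ ≤ Real.exp ((Real.exp θ - 1) * avg (z e)) := Real.add_one_le_exp _
      _ ≤ _ := by
        refine Real.exp_le_exp.2 (mul_le_mul_of_nonneg_right (exp_sub_one_le hθ) ?_)
        exact avg_nonneg (h0 e)

/-- A Chernoff bound for independent variables in `[0, 1]` with relative and absolute error. -/
theorem chernoff [Nonempty X] {κ : Type*} (E : Finset κ) {f : κ → ι} (hf : Set.InjOn f E)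
    {z : κ → X → ℝ} (h0 : ∀ e x, 0 ≤ z e x) (h1 : ∀ e x, z e x ≤ 1) {δ K : ℝ} (hδ : 0 < δ)
    (hδ1 : δ ≤ 1) :
    prob (fun u : ι → X => δ * (∑ e ∈ E, avg (z e) + K) <
      |∑ e ∈ E, z e (u (f e)) - ∑ e ∈ E, avg (z e)|) ≤ 2 * Real.exp (-(δ ^ 2 * K / 2)) := by
  set μ := ∑ e ∈ E, avg (z e) with hμ
  have hμ0 : 0 ≤ μ := sum_nonneg fun e _ => avg_nonneg (h0 e)
  -- The sign `s` selects the tail, and the exponential moment is taken at `s * (δ / 2)`. The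
  -- second-order term `δ ^ 2 / 4 * μ` is absorbed by `δ ^ 2 / 2 * μ`, which leaves only `K` in the
  -- bound.
  have key : ∀ s : ℝ, s = 1 ∨ s = -1 →
      prob (fun u : ι → X => δ * (μ + K) < s * (∑ e ∈ E, z e (u (f e)) - μ)) ≤
        Real.exp (-(δ ^ 2 * K / 2)) := by
    intro s hs
    have hs2 : s ^ 2 = 1 := by rcases hs with rfl | rfl <;> norm_num
    have habs : |s| = 1 := by rcases hs with rfl | rfl <;> norm_num
    have hθ : |s * (δ / 2)| ≤ 1 := by
      rw [abs_mul, habs, abs_of_pos (by positivity)]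
      linarith
    calc _ ≤ avg fun u : ι → X => Real.exp (-(s * (δ / 2) * μ) - δ / 2 * (δ * (μ + K))) *
          Real.exp (s * (δ / 2) * ∑ e ∈ E, z e (u (f e))) := by
          refine prob_le_avg (fun u => by positivity) fun u hu => ?_
          rw [← Real.exp_add]
          refine Real.one_le_exp ?_
          nlinarith
      _ ≤ _ := by
          rw [avg_const_mul]
          refine (mul_le_mul_of_nonneg_left (avg_exp_le E hf h0 h1 hθ)
            (Real.exp_pos _).le).trans ?_
          rw [← Real.exp_add, ← hμ]
          refine Real.exp_le_exp.2 ?_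
          have : (s * (δ / 2)) ^ 2 = δ ^ 2 / 4 := by rw [mul_pow, hs2]; ring
          rw [this]
          nlinarith [mul_nonneg (sq_nonneg δ) hμ0]
  calc _ ≤ prob (fun u : ι → X => δ * (μ + K) < 1 * (∑ e ∈ E, z e (u (f e)) - μ) ∨
        δ * (μ + K) < -1 * (∑ e ∈ E, z e (u (f e)) - μ)) := by
        refine prob_mono fun u hu => ?_
        rcases lt_abs.1 hu with h | h
        · exact Or.inl (by linarith)
        · exact Or.inr (by linarith)
    _ ≤ _ := by
        refine (prob_or_le _ _).trans ?_
        linarith [key 1 (Or.inl rfl), key (-1) (Or.inr rfl)]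

end Chernoff

end Probability

/-! ### Merging dense classes of samples, and its comparison with the strong components. -/

section Levels

variable {n : ℕ}

/-- The hyperedge `e` is not contained in a class of the partition `Q`. -/
def Cuts (Q : Setoid (Fin n)) (e : Hyperedge n) : Prop := ∃ u ∈ e, ∃ v ∈ e, ¬ Q u v

theorem Cuts.mono {Q R : Setoid (Fin n)} (h : Q ≤ R) {e : Hyperedge n} : Cuts R e → Cuts Q e :=
  fun ⟨u, hu, v, hv, huv⟩ => ⟨u, hu, v, hv, fun hQ => huv (h hQ)⟩

/-- The hyperedges of `S` cut by `Q`. -/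
noncomputable def crossing (Q : Setoid (Fin n)) (S : FinHypergraph n) : FinHypergraph n :=
  S.filter (Cuts Q)

/-- The hyperedges of `S` cut by `Q` but not by `R`. -/
noncomputable def between (Q R : Setoid (Fin n)) (S : FinHypergraph n) : FinHypergraph n :=
  S.filter fun e => Cuts Q e ∧ ¬ Cuts R e

theorem mem_crossing {Q : Setoid (Fin n)} {S : FinHypergraph n} {e : Hyperedge n} :
    e ∈ crossing Q S ↔ e ∈ S ∧ Cuts Q e := mem_filter

theorem mem_between {Q R : Setoid (Fin n)} {S : FinHypergraph n} {e : Hyperedge n} :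
    e ∈ between Q R S ↔ e ∈ S ∧ Cuts Q e ∧ ¬ Cuts R e := mem_filter

theorem crossing_crossing {Q R : Setoid (Fin n)} (h : Q ≤ R) (S : FinHypergraph n) :
    crossing R (crossing Q S) = crossing R S := by
  ext e
  simp only [mem_crossing]
  exact ⟨fun ⟨⟨a, _⟩, c⟩ => ⟨a, c⟩, fun ⟨a, c⟩ => ⟨⟨a, c.mono h⟩, c⟩⟩

theorem card_crossing {Q R : Setoid (Fin n)} (h : Q ≤ R) (S : FinHypergraph n) :
    (crossing Q S).card = (crossing R S).card + (between Q R S).card := by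
  rw [← card_union_of_disjoint]
  · congr 1
    ext e
    simp only [mem_union, mem_crossing, mem_between]
    have := Cuts.mono h (e := e)
    tauto
  · rw [disjoint_left]
    intro e h1 h2
    exact (mem_between.1 h2).2.2 (mem_crossing.1 h1).2

theorem exists_argmin (Q : Setoid (Fin n)) (S : FinHypergraph n) (k : ℝ) :
    ∃ R, Q ≤ R ∧ ∀ R', Q ≤ R' →
      ((crossing R S).card : ℝ) - k * numClasses R ≤ (crossing R' S).card - k * numClasses R' := by
  obtain ⟨R, hR, h⟩ := exists_min_image (univ.filter fun R => Q ≤ R)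
    (fun R => ((crossing R S).card : ℝ) - k * numClasses R) ⟨Q, by simp⟩
  exact ⟨R, (mem_filter.1 hR).2, fun R' hR' => h R' (mem_filter.2 ⟨mem_univ _, hR'⟩)⟩

/-- A coarsening of `Q` whose classes are `k`-strong in `S`, modulo `Q`, and such that `S` is
`k`-sparse outside of them. -/
noncomputable def step (Q : Setoid (Fin n)) (S : FinHypergraph n) (k : ℝ) : Setoid (Fin n) :=
  Classical.choose (exists_argmin Q (crossing Q S) k)

theorem le_step (Q : Setoid (Fin n)) (S : FinHypergraph n) (k : ℝ) : Q ≤ step Q S k :=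
  (Classical.choose_spec (exists_argmin Q (crossing Q S) k)).1

theorem step_min {Q R : Setoid (Fin n)} (h : Q ≤ R) (S : FinHypergraph n) (k : ℝ) :
    ((crossing (step Q S k) S).card : ℝ) - k * numClasses (step Q S k) ≤
      (crossing R S).card - k * numClasses R := by
  have := (Classical.choose_spec (exists_argmin Q (crossing Q S) k)).2 R h
  change ((crossing (step Q S k) _).card : ℝ) - k * numClasses (step Q S k) ≤ _ at this
  rwa [crossing_crossing (le_step Q S k), crossing_crossing h] at this

/-- The reason why `step` minimises for `crossing Q S`: the choice among several minimisers then
depends only on hyperedges that the decoder can see. -/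
theorem step_crossing {Q₀ Q : Setoid (Fin n)} (h : Q₀ ≤ Q) (S : FinHypergraph n) (k : ℝ) :
    step Q (crossing Q₀ S) k = step Q S k := by
  unfold step
  simp only [crossing_crossing h]

/-- Undoing some of the merges cannot lower the minimised quantity. -/
theorem step_dense {Q R : Setoid (Fin n)} {S : FinHypergraph n} {k : ℝ} (h : Q ≤ R)
    (h' : R ≤ step Q S k) :
    k * ((numClasses R : ℝ) - numClasses (step Q S k)) ≤ (between R (step Q S k) S).card := by
  have h1 := step_min h S k
  rw [card_crossing h' S] at h1
  push_cast at h1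
  linarith

/-- Merging further cannot lower the minimised quantity. -/
theorem step_sparse {Q R : Setoid (Fin n)} {S : FinHypergraph n} {k : ℝ} (h : step Q S k ≤ R) :
    ((between (step Q S k) R S).card : ℝ) ≤ k * ((numClasses (step Q S k) : ℝ) - numClasses R) := by
  have h1 := step_min ((le_step Q S k).trans h) S k
  rw [card_crossing h S] at h1
  push_cast at h1
  linarith

/-- Every merging of classes of `Q` creates at most `c` hyperedges of `S` per lost class. -/
def Sparse (c : ℝ) (S : FinHypergraph n) (Q : Setoid (Fin n)) : Prop :=
  ∀ R, Q ≤ R → ((between Q R S).card : ℝ) ≤ c * ((numClasses Q : ℝ) - numClasses R)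

/-- `S` looks like a sample of `H` at rate `p` on all coarsenings of `Q₀`. -/
def Concentrated (δ k p : ℝ) (H S : FinHypergraph n) (Q₀ : Setoid (Fin n)) : Prop :=
  ∀ Q R, Q₀ ≤ Q → Q ≤ R →
    |((between Q R S).card : ℝ) - p * (between Q R H).card| ≤
      δ * (p * (between Q R H).card + k * ((numClasses Q₀ : ℝ) - numClasses R))

/-- Suppose that the second step merges `a` classes, more than half of what the first did. Then
fewer than `3 * a` classes are lost in total, so both samples have error at most `δ * (x + 3 * k *
a)` on the newly merged hyperedges. The first sample has at most `k₁ * a` of them, hence the second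
at most `(k₁ + 15 * δ * k) * a`, but its step needs at least `k₂ * a`. -/
theorem merges_halve {δ k p k₁ k₂ : ℝ} {H S S' : FinHypergraph n} {Q : Setoid (Fin n)}
    (hδ : 0 < δ) (hδ1 : δ ≤ 1 / 40) (hk : 0 < k) (hp : 0 ≤ p) (hk12 : k₁ ≤ 2 * k)
    (hk2 : k₁ + 20 * δ * k ≤ k₂) (h : Concentrated δ k p H S Q) (h' : Concentrated δ k p H S' Q) :
    2 * (numClasses (step Q S k₁) - numClasses (step (step Q S k₁) S' k₂)) ≤
      numClasses Q - numClasses (step Q S k₁) := by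
  set Q₁ := step Q S k₁ with hQ₁
  set Q₂ := step Q₁ S' k₂ with hQ₂
  have h01 : Q ≤ Q₁ := le_step _ _ _
  have h12 : Q₁ ≤ Q₂ := le_step _ _ _
  have c01 := numClasses_mono h01
  have c12 := numClasses_mono h12
  by_contra hc
  push Not at hc
  have d1 := step_sparse (Q := Q) (S := S) (k := k₁) h12
  have d2 := step_dense (Q := Q₁) (R := Q₁) (S := S') (k := k₂) le_rfl h12
  have e1 := (abs_le.1 (h Q₁ Q₂ h01 h12)).1
  have e2 := (abs_le.1 (h' Q₁ Q₂ h01 h12)).2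
  rw [← hQ₁] at d1
  rw [← hQ₂] at d2
  have hx : 0 ≤ p * (between Q₁ Q₂ H).card := by positivity
  set x := p * (between Q₁ Q₂ H).card
  have ha : (numClasses Q : ℝ) - numClasses Q₂ ≤
      3 * ((numClasses Q₁ : ℝ) - numClasses Q₂) := by
    have : numClasses Q + 2 * numClasses Q₂ ≤ 3 * numClasses Q₁ := by omega
    have : (numClasses Q : ℝ) + 2 * numClasses Q₂ ≤ 3 * numClasses Q₁ := by exact_mod_cast this
    linarith
  have ha0 : (0 : ℝ) < (numClasses Q₁ : ℝ) - numClasses Q₂ := by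
    have : numClasses Q₂ < numClasses Q₁ := by omega
    have : (numClasses Q₂ : ℝ) < numClasses Q₁ := by exact_mod_cast this
    linarith
  set a := (numClasses Q₁ : ℝ) - numClasses Q₂
  set b := (numClasses Q : ℝ) - numClasses Q₂
  have hb : δ * (k * b) ≤ 3 * δ * k * a := by
    calc δ * (k * b) ≤ δ * (k * (3 * a)) := by gcongr
      _ = _ := by ring
  have f1 : x * (1 - δ) ≤ (k₁ + 3 * δ * k) * a := by linarith
  have f2 : k₂ * a ≤ x * (1 + δ) + 3 * δ * k * a := by linarith
  have f3 : x * (1 + δ) ≤ (1 + 3 * δ) * (x * (1 - δ)) := by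
    nlinarith [mul_nonneg hx (show 0 ≤ δ * (1 - 3 * δ) by nlinarith)]
  have f4 : (1 + 3 * δ) * (x * (1 - δ)) ≤ (1 + 3 * δ) * ((k₁ + 3 * δ * k) * a) := by gcongr
  have f5 : (1 + 3 * δ) * (k₁ + 3 * δ * k) ≤ k₁ + 12 * δ * k := by
    nlinarith [mul_pos hδ hk, mul_nonneg hδ.le (sub_nonneg.2 hk12),
      mul_nonneg (mul_pos hδ hk).le (sub_nonneg.2 hδ1)]
  have f6 : (1 + 3 * δ) * ((k₁ + 3 * δ * k) * a) ≤ (k₁ + 12 * δ * k) * a := by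
    rw [← mul_assoc]
    gcongr
  have f7 : (k₁ + 20 * δ * k) * a ≤ k₂ * a := by gcongr
  nlinarith [mul_pos (mul_pos hδ hk) ha0]

/-- The thresholds increase from `k` to `2 * k`. -/
noncomputable def threshold (k : ℝ) (T τ : ℕ) : ℝ := k * (1 + τ / T)

/-- Successive merging with fresh samples. -/
noncomputable def rounds (k : ℝ) (T : ℕ) (Q : Setoid (Fin n)) (g : ℕ → FinHypergraph n) :
    ℕ → Setoid (Fin n)
  | 0 => Q
  | τ + 1 => step (rounds k T Q g τ) (g τ) (threshold k T τ)

theorem le_rounds (k : ℝ) (T : ℕ) (Q : Setoid (Fin n)) (g : ℕ → FinHypergraph n) (τ : ℕ) :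
    Q ≤ rounds k T Q g τ := by
  induction τ with
  | zero => exact le_rfl
  | succ τ ih => exact ih.trans (le_step _ _ _)

theorem rounds_congr (k : ℝ) (T : ℕ) (Q : Setoid (Fin n)) {g g' : ℕ → FinHypergraph n} {τ : ℕ}
    (h : ∀ t < τ, crossing Q (g t) = crossing Q (g' t)) :
    rounds k T Q g τ = rounds k T Q g' τ := by
  induction τ with
  | zero => rfl
  | succ τ ih =>
    have h1 := ih fun t ht => h t (by omega)
    change step _ _ _ = step _ _ _
    rw [← h1, ← step_crossing (le_rounds k T Q g τ) (g τ), h τ (by omega),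
      step_crossing (le_rounds k T Q g τ)]

theorem threshold_le {k : ℝ} (hk : 0 < k) {T τ : ℕ} (hT : 0 < T) (h : τ ≤ T) :
    threshold k T τ ≤ 2 * k := by
  have : (τ : ℝ) / T ≤ 1 := by
    rw [div_le_one (by exact_mod_cast hT)]
    exact_mod_cast h
  unfold threshold
  nlinarith

theorem le_threshold {k : ℝ} (hk : 0 < k) (T τ : ℕ) : k ≤ threshold k T τ := by
  have : (0 : ℝ) ≤ (τ : ℝ) / T := by positivity
  unfold threshold
  nlinarith

/-- The thresholds grow by `k / T`, which exceeds the gap `20 * δ * k = k / (2 * T)` required by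
`merges_halve`. The sample `g T` enters only the analysis: it certifies that one more round would
merge nothing. -/
theorem sparse_rounds {k p : ℝ} {T : ℕ} {Q : Setoid (Fin n)} {g : ℕ → FinHypergraph n}
    {H : FinHypergraph n} (hT : 0 < T) (hn : n < 2 ^ T) (hk : 0 < k) (hp : 0 < p)
    (hA : ∀ τ ≤ T, Concentrated (1 / (40 * T)) k p H (g τ) (rounds k T Q g τ))
    (hB : ∀ τ < T, Concentrated (1 / (40 * T)) k p H (g (τ + 1)) (rounds k T Q g τ)) :
    Sparse (3 * k / p) H (rounds k T Q g T) := by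
  have hT' : (1 : ℝ) ≤ T := by exact_mod_cast hT
  have hT0 : (0 : ℝ) < T := by linarith
  set δ : ℝ := 1 / (40 * T) with hδdef
  have hδ : 0 < δ := by positivity
  have hδ1 : δ ≤ 1 / 40 := by
    rw [hδdef]
    gcongr
    linarith
  set a : ℕ → ℕ := fun τ => numClasses (rounds k T Q g τ) - numClasses (rounds k T Q g (τ + 1))
    with ha
  have hhalf : ∀ τ < T, 2 * a (τ + 1) ≤ a τ := by
    intro τ hτ
    refine merges_halve (k₁ := threshold k T τ) (k₂ := threshold k T (τ + 1)) hδ hδ1 hk hp.le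
      (threshold_le hk hT hτ.le) ?_ (hA τ hτ.le) (hB τ hτ)
    unfold threshold
    push_cast
    have : 20 * δ * k ≤ k * (1 / T) := by
      have h20 : 20 * δ ≤ 1 / T := by
        rw [hδdef, mul_one_div, div_le_div_iff₀ (by positivity) hT0]
        linarith
      rw [mul_comm k]
      gcongr
    have h2 : k * (1 + ((τ : ℝ) + 1) / T) = k * (1 + (τ : ℝ) / T) + k * (1 / T) := by ring
    linarith
  have hpow : ∀ τ ≤ T, 2 ^ τ * a τ ≤ n := by
    intro τ
    induction τ with
    | zero =>
      intro _
      have := numClasses_le (rounds k T Q g 0)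
      rw [Nat.card_fin] at this
      simp only [pow_zero, one_mul, ha]
      omega
    | succ τ ih =>
      intro h
      calc 2 ^ (τ + 1) * a (τ + 1) = 2 ^ τ * (2 * a (τ + 1)) := by ring
        _ ≤ 2 ^ τ * a τ := Nat.mul_le_mul_left _ (hhalf τ (by omega))
        _ ≤ n := ih (by omega)
  have haT : a T = 0 := by
    by_contra h
    have := hpow T le_rfl
    have h2 : 2 ^ T * 1 ≤ 2 ^ T * a T := Nat.mul_le_mul_left _ (by omega)
    omega
  -- The partition is thus the result of a step on `g T`, a sample that is concentrated on this very
  -- partition. Sparsity at threshold `2 * k` can therefore be carried over to `H`, with `3 * k`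
  -- leaving room for the error.
  have hstab : rounds k T Q g T = rounds k T Q g (T + 1) :=
    eq_of_numClasses_le (le_step _ _ _) (by simp only [ha] at haT; omega)
  intro R hR
  have h1 := step_sparse (Q := rounds k T Q g T) (S := g T) (k := threshold k T T) (R := R)
    (by change rounds k T Q g (T + 1) ≤ R; rwa [← hstab])
  change ((between (rounds k T Q g (T + 1)) R _).card : ℝ) ≤
    _ * ((numClasses (rounds k T Q g (T + 1)) : ℝ) - _) at h1
  rw [← hstab] at h1
  have h2 := (abs_le.1 (hA T le_rfl _ R le_rfl hR)).1
  have hb : (0 : ℝ) ≤ (numClasses (rounds k T Q g T) : ℝ) - numClasses R :=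
    sub_nonneg.2 (by exact_mod_cast numClasses_mono hR)
  have hx : 0 ≤ p * (between (rounds k T Q g T) R H).card := by positivity
  rw [div_mul_eq_mul_div, le_div_iff₀ hp, mul_comm]
  set x := p * (between (rounds k T Q g T) R H).card
  set b := (numClasses (rounds k T Q g T) : ℝ) - numClasses R
  have h3 : threshold k T T * b ≤ 2 * k * b := by
    gcongr
    exact threshold_le hk hT le_rfl
  nlinarith [mul_nonneg hk.le hb, mul_nonneg hδ.le hx,
    mul_nonneg (mul_nonneg hk.le hb) (sub_nonneg.2 hδ1), mul_nonneg hx (sub_nonneg.2 hδ1)]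

/-- Steps on a sample never merge beyond a partition outside of which `H` is sparse. -/
theorem step_le {δ k p k₁ : ℝ} {H S : FinHypergraph n} {Q P : Setoid (Fin n)}
    (hδ1 : δ ≤ 1 / 40) (hk : 0 < k) (hp : 0 < p) (hk1 : k ≤ k₁) (h : Q ≤ P)
    (hconc : Concentrated δ k p H S P) (hsp : Sparse (k / 2 / p) H P) : step Q S k₁ ≤ P := by
  set R := step Q S k₁ with hR
  have hQR : Q ≤ R := le_step _ _ _
  have h1 := step_dense (Q := Q) (R := R ⊓ P) (S := S) (k := k₁) (le_inf hQR h) inf_le_left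
  rw [← hR] at h1
  -- Merges from `R ⊓ P` to `R` reappear from `P` to `R ⊔ P`, which loses no more classes than they
  -- do, by semimodularity. At least `k` hyperedges per class are needed below, but little more than
  -- `k / 2` are available above, so no class is lost between `R ⊓ P` and `R`.
  have hsub : between (R ⊓ P) R S ⊆ between P (R ⊔ P) S := by
    intro e he
    rw [mem_between] at he ⊢
    obtain ⟨heS, ⟨u, hu, v, hv, huv⟩, hnot⟩ := he
    refine ⟨heS, ⟨u, hu, v, hv, fun hP => huv ⟨?_, hP⟩⟩, fun hc => hnot (hc.mono le_sup_left)⟩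
    by_contra hRuv
    exact hnot ⟨u, hu, v, hv, hRuv⟩
  have h2 : ((between (R ⊓ P) R S).card : ℝ) ≤ (between P (R ⊔ P) S).card := by
    exact_mod_cast card_le_card hsub
  have h3 := (abs_le.1 (hconc P (R ⊔ P) le_rfl le_sup_right)).2
  have h4 := hsp (R ⊔ P) le_sup_right
  have h5 := numClasses_add_le (M := R ⊓ P) (P := P) (Q := R) inf_le_right inf_le_left
  have h6 := numClasses_mono (inf_le_left : R ⊓ P ≤ R)
  have h7 : (numClasses R : ℝ) + numClasses P ≤ numClasses (R ⊔ P) + numClasses (R ⊓ P) := by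
    exact_mod_cast h5
  have h8 : (numClasses R : ℝ) ≤ numClasses (R ⊓ P) := by exact_mod_cast h6
  have h9 : p * (between P (R ⊔ P) H).card ≤
      k / 2 * ((numClasses P : ℝ) - numClasses (R ⊔ P)) := by
    calc _ ≤ p * (k / 2 / p * ((numClasses P : ℝ) - numClasses (R ⊔ P))) := by gcongr
      _ = _ := by field_simp
  have h10 : (numClasses (R ⊔ P) : ℝ) ≤ numClasses P := by
    exact_mod_cast numClasses_mono (le_sup_right : P ≤ R ⊔ P)
  set x := p * (between P (R ⊔ P) H).card
  set b := (numClasses P : ℝ) - numClasses (R ⊔ P) with hb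
  set b' := (numClasses (R ⊓ P) : ℝ) - numClasses R with hb'
  have hbb : b ≤ b' := by linarith
  have hb0 : 0 ≤ b := by linarith
  have h11 : k * b' ≤ k₁ * b' := by
    gcongr
  have h12 : δ * (x + k * b) ≤ 1 / 40 * (k / 2 * b + k * b) := by gcongr
  have h13 : k * b ≤ k * b' := by gcongr
  have h14 : k * b' ≤ 0 := by nlinarith
  have h15 : b' ≤ 0 := by
    by_contra hc
    push Not at hc
    nlinarith [mul_pos hk hc]
  have h16 : numClasses (R ⊓ P) ≤ numClasses R := by
    have : (numClasses (R ⊓ P) : ℝ) ≤ numClasses R := by linarith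
    exact_mod_cast this
  rw [← eq_of_numClasses_le inf_le_left h16]
  exact inf_le_right

theorem rounds_le {δ k p : ℝ} {T : ℕ} {H : FinHypergraph n} {Q P : Setoid (Fin n)}
    {g : ℕ → FinHypergraph n} (hδ1 : δ ≤ 1 / 40) (hk : 0 < k) (hp : 0 < p) (h : Q ≤ P)
    (hsp : Sparse (k / 2 / p) H P) (τ : ℕ) (hconc : ∀ t < τ, Concentrated δ k p H (g t) P) :
    rounds k T Q g τ ≤ P := by
  induction τ with
  | zero => exact h
  | succ τ ih =>
    exact step_le hδ1 hk hp (le_threshold hk T τ) (ih fun t ht => hconc t (by omega))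
      (hconc τ (by omega)) hsp

/-- The partitions found from samples at increasing rates. The samples may depend on the
partition found before. -/
noncomputable def levels (k : ℝ) (T : ℕ) (G : ℕ → Setoid (Fin n) → ℕ → FinHypergraph n) :
    ℕ → Setoid (Fin n)
  | 0 => ⊥
  | d + 1 => rounds k T (levels k T G d) (G d (levels k T G d)) T

/-- Agreement is required only along the partitions of the first run, and only on cut hyperedges;
this is exactly what successful decoding provides. -/
theorem levels_congr (k : ℝ) (T : ℕ) {G G' : ℕ → Setoid (Fin n) → ℕ → FinHypergraph n} {d : ℕ}
    (h : ∀ i < d, ∀ t < T, crossing (levels k T G i) (G i (levels k T G i) t) =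
      crossing (levels k T G i) (G' i (levels k T G i) t)) :
    levels k T G d = levels k T G' d := by
  induction d with
  | zero => rfl
  | succ d ih =>
    have h1 := ih fun i hi => h i (by omega)
    change rounds _ _ _ _ _ = rounds _ _ _ _ _
    rw [← h1]
    exact rounds_congr k T _ (h d (by omega))

/-- The strong components of `H` at decreasing thresholds. -/
noncomputable def strongLevels (H : FinHypergraph n) (κ : ℕ → ℝ) : ℕ → Setoid (Fin n)
  | 0 => ⊥
  | d + 1 => step (strongLevels H κ d) H (κ d)

theorem strongLevels_mono (H : FinHypergraph n) (κ : ℕ → ℝ) : Monotone (strongLevels H κ) :=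
  monotone_nat_of_le_succ fun _ => le_step _ _ _

theorem sparse_strongLevels (H : FinHypergraph n) (κ : ℕ → ℝ) (d : ℕ) :
    Sparse (κ d) H (strongLevels H κ (d + 1)) := fun _ hR => step_sparse hR

/-- A sample of a sparse hypergraph is sparse. -/
theorem Concentrated.sparse {δ k p : ℝ} {H S : FinHypergraph n} {Q : Setoid (Fin n)}
    (hδ1 : δ ≤ 1 / 40) (hk : 0 < k) (hp : 0 < p) (h : Concentrated δ k p H S Q)
    (hs : Sparse (6 * k / p) H Q) : Sparse (8 * k) S Q := by
  intro R hR
  have h1 := (abs_le.1 (h Q R le_rfl hR)).2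
  have h2 : p * (between Q R H).card ≤ 6 * k * ((numClasses Q : ℝ) - numClasses R) := by
    calc _ ≤ p * (6 * k / p * ((numClasses Q : ℝ) - numClasses R)) := by
          gcongr
          exact hs R hR
      _ = _ := by field_simp
  have hb : (0 : ℝ) ≤ (numClasses Q : ℝ) - numClasses R :=
    sub_nonneg.2 (by exact_mod_cast numClasses_mono hR)
  set x := p * (between Q R H).card
  set b := (numClasses Q : ℝ) - numClasses R
  have h3 : δ * (x + k * b) ≤ 1 / 40 * (6 * k * b + k * b) := by gcongr
  nlinarith [mul_nonneg hk.le hb]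

end Levels

/-! ### Strength of hyperedges and the weight it guarantees. -/

section Strength

variable {n : ℕ}

/-- The partition obtained from `Q` by contracting the hyperedges in `z`. -/
def contract (Q : Setoid (Fin n)) (z : FinHypergraph n) : Setoid (Fin n) :=
  sInf {R | Q ≤ R ∧ ∀ e ∈ z, ¬ Cuts R e}

theorem le_contract (Q : Setoid (Fin n)) (z : FinHypergraph n) : Q ≤ contract Q z :=
  le_sInf fun _ hR => hR.1

theorem contract_le {Q R : Setoid (Fin n)} {z : FinHypergraph n} (h : Q ≤ R)
    (hz : ∀ e ∈ z, ¬ Cuts R e) : contract Q z ≤ R := sInf_le ⟨h, hz⟩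

theorem not_cuts_contract (Q : Setoid (Fin n)) {z : FinHypergraph n} {e : Hyperedge n}
    (he : e ∈ z) : ¬ Cuts (contract Q z) e := by
  rintro ⟨u, hu, v, hv, huv⟩
  refine huv fun R hR => ?_
  by_contra h
  exact hR.2 e he ⟨u, hu, v, hv, h⟩

/-- The sampling rate of step `d` out of `L`. -/
noncomputable def rate (L d : ℕ) : ℝ := 2 ^ d / 2 ^ L

theorem rate_pos (L d : ℕ) : 0 < rate L d := by unfold rate; positivity

theorem rate_mono {L d d' : ℕ} (h : d ≤ d') : rate L d ≤ rate L d' := by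
  unfold rate
  gcongr
  norm_num

theorem rate_succ (L d : ℕ) : rate L (d + 1) = 2 * rate L d := by
  unfold rate
  ring

/-- The last step at most `L` whose partition cuts `e`. -/
noncomputable def cutLevel (P : ℕ → Setoid (Fin n)) (L : ℕ) (e : Hyperedge n) : ℕ :=
  Nat.findGreatest (fun d => Cuts (P d) e) L

theorem cutLevel_le (P : ℕ → Setoid (Fin n)) (L : ℕ) (e : Hyperedge n) : cutLevel P L e ≤ L :=
  Nat.findGreatest_le L

theorem le_cutLevel {P : ℕ → Setoid (Fin n)} {L d : ℕ} {e : Hyperedge n} (hd : d ≤ L)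
    (h : Cuts (P d) e) : d ≤ cutLevel P L e :=
  Nat.le_findGreatest (P := fun d => Cuts (P d) e) hd h

theorem cuts_cutLevel {P : ℕ → Setoid (Fin n)} {L d : ℕ} {e : Hyperedge n} (hd : d ≤ L)
    (h : Cuts (P d) e) : Cuts (P (cutLevel P L e)) e :=
  Nat.findGreatest_spec (P := fun d => Cuts (P d) e) hd h

theorem cutLevel_lt {P : ℕ → Setoid (Fin n)} (hP : Monotone P) {L d : ℕ} {e : Hyperedge n}
    (h0 : Cuts (P 0) e) (h : ¬ Cuts (P d) e) : cutLevel P L e < d := by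
  by_contra hc
  exact h ((cuts_cutLevel (Nat.zero_le L) h0).mono (hP (not_lt.1 hc)))

/-- Hyperedges sampled inversely to their strength keep the components strong. -/
theorem strength_le {H : FinHypergraph n} {K : ℝ} (hK : 0 ≤ K) {L d₀ : ℕ} (hd₀ : d₀ ≤ L) {κ : ℕ → ℝ}
    (hκ : ∀ d, κ d = K / rate L d) {R : Setoid (Fin n)} (hR : R ≤ strongLevels H κ d₀) :
    K * ((numClasses R : ℝ) - numClasses (strongLevels H κ d₀)) ≤
      ∑ e ∈ between R (strongLevels H κ d₀) H, rate L (cutLevel (strongLevels H κ) L e) := by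
  set P := strongLevels H κ with hPdef
  have hmono : Monotone P := strongLevels_mono H κ
  -- Levels are peeled off from the finest: the merges of `R ⊓ P (d + 1)` into `P (d + 1)` are paid
  -- by hyperedges of level `d`, those of `R ⊔ P (d + 1)` into `P d₀` by induction. Semimodularity
  -- shows that together they cover all lost classes.
  suffices h : ∀ j d, d + j = d₀ → ∀ R, P d ≤ R → R ≤ P d₀ →
      K * ((numClasses R : ℝ) - numClasses (P d₀)) ≤
        ∑ e ∈ between R (P d₀) H, rate L (cutLevel P L e) from
    h d₀ 0 (by omega) R bot_le hR
  intro j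
  induction j with
  | zero =>
    intro d hd R h1 h2
    obtain rfl : d = d₀ := by omega
    rw [le_antisymm h2 h1, sub_self, mul_zero]
    exact sum_nonneg fun e _ => (rate_pos _ _).le
  | succ j ih =>
    intro d hd R h1 h2
    have hPd : P (d + 1) ≤ P d₀ := hmono (by omega)
    have h3 := ih (d + 1) (by omega) (R ⊔ P (d + 1)) le_sup_right (sup_le h2 hPd)
    have h4 : κ d * ((numClasses (R ⊓ P (d + 1)) : ℝ) - numClasses (P (d + 1))) ≤
        (between (R ⊓ P (d + 1)) (P (d + 1)) H).card :=
      step_dense (Q := P d) (S := H) (k := κ d) (le_inf h1 (hmono (by omega))) inf_le_right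
    have h5 : (numClasses R : ℝ) + numClasses (P (d + 1)) ≤
        numClasses (R ⊔ P (d + 1)) + numClasses (R ⊓ P (d + 1)) := by
      exact_mod_cast numClasses_add_le (M := R ⊓ P (d + 1)) inf_le_right inf_le_left
    have hdisj : Disjoint (between (R ⊔ P (d + 1)) (P d₀) H)
        (between (R ⊓ P (d + 1)) (P (d + 1)) H) := by
      rw [disjoint_left]
      intro e he he'
      exact (mem_between.1 he').2.2 ((mem_between.1 he).2.1.mono le_sup_right)
    have hsub : between (R ⊔ P (d + 1)) (P d₀) H ∪ between (R ⊓ P (d + 1)) (P (d + 1)) H ⊆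
        between R (P d₀) H := by
      intro e he
      rcases mem_union.1 he with he | he <;> rw [mem_between] at he ⊢
      · exact ⟨he.1, he.2.1.mono le_sup_left, he.2.2⟩
      · obtain ⟨he1, ⟨u, hu, v, hv, huv⟩, he3⟩ := he
        refine ⟨he1, ⟨u, hu, v, hv, fun hRuv => huv ⟨hRuv, ?_⟩⟩, fun hc => he3 (hc.mono hPd)⟩
        by_contra hc
        exact he3 ⟨u, hu, v, hv, hc⟩
    -- These hyperedges are cut by `P d` and not by `P (d + 1)`, so their level is exactly `d`.
    have h6 : ∑ e ∈ between (R ⊓ P (d + 1)) (P (d + 1)) H, rate L (cutLevel P L e) =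
        (between (R ⊓ P (d + 1)) (P (d + 1)) H).card * rate L d := by
      rw [← nsmul_eq_mul, ← sum_const]
      refine sum_congr rfl fun e he => ?_
      rw [mem_between] at he
      have hc : Cuts (P d) e := he.2.1.mono (le_inf h1 (hmono (by omega)))
      have := le_cutLevel (P := P) (L := L) (d := d) (by omega) hc
      have := cutLevel_lt (L := L) hmono (hc.mono (hmono (Nat.zero_le d))) he.2.2
      congr 1
      omega
    have h7 : K * ((numClasses (R ⊓ P (d + 1)) : ℝ) - numClasses (P (d + 1))) ≤
        (between (R ⊓ P (d + 1)) (P (d + 1)) H).card * rate L d := by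
      refine le_trans (le_of_eq ?_) (mul_le_mul_of_nonneg_right h4 (rate_pos L d).le)
      rw [hκ]
      have := (rate_pos L d).ne'
      field_simp
    have h8 := sum_le_sum_of_subset_of_nonneg (f := fun e => rate L (cutLevel P L e)) hsub
      fun e _ _ => (rate_pos _ _).le
    rw [sum_union hdisj, h6] at h8
    nlinarith [mul_le_mul_of_nonneg_left h5 hK]

end Strength

/-! ### Counting cuts by contraction. -/

section CutCounting

variable {n : ℕ}

/-- The set `S` is a union of classes of `Q`. -/
def Saturated (Q : Setoid (Fin n)) (S : Finset (Fin n)) : Prop := ∀ u v, Q u v → (u ∈ S ↔ v ∈ S)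

theorem Saturated.cuts {Q : Setoid (Fin n)} {S : Finset (Fin n)} (h : Saturated Q S)
    {e : Hyperedge n} (he : Crosses S e) : Cuts Q e := by
  obtain ⟨⟨u, hu, hu'⟩, v, hv, hv'⟩ := he
  exact ⟨u, hu, v, hv, fun hQ => hv' ((h u v hQ).1 hu')⟩

/-- A hyperedge that does not cross `S` lies on one side, so contracting it joins only vertices of
the same side: the cut survives. -/
theorem Saturated.contract {Q : Setoid (Fin n)} {S : Finset (Fin n)} (h : Saturated Q S)
    {e : Hyperedge n} (he : ¬ Crosses S e) : Saturated (contract Q {e}) S := by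
  have hle : HypergraphSketch.contract Q {e} ≤ Setoid.ker (fun x => x ∈ S) := by
    refine contract_le (fun u v huv => propext (h u v huv)) ?_
    rintro e' he' ⟨u, hu, v, hv, huv⟩
    obtain rfl := mem_singleton.1 he'
    refine huv (propext ⟨fun h1 => ?_, fun h1 => ?_⟩)
    · by_contra h2
      exact he ⟨⟨u, hu, h1⟩, v, hv, h2⟩
    · by_contra h2
      exact he ⟨⟨v, hv, h1⟩, u, hu, h2⟩
  exact fun u v huv => iff_of_eq (hle huv)

/-- The vertex `v` is the chosen representative of its class. -/
def IsRep (P : Setoid (Fin n)) (v : Fin n) : Prop := (Quotient.mk P v).out = v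

/-- The unions of classes of `R` without representatives of classes of `P`. -/
noncomputable def reducedSets (P R : Setoid (Fin n)) : Finset (Finset (Fin n)) :=
  univ.filter fun S => Saturated R S ∧ ∀ v ∈ S, ¬ IsRep P v

theorem mem_reducedSets {P R : Setoid (Fin n)} {S : Finset (Fin n)} :
    S ∈ reducedSets P R ↔ Saturated R S ∧ ∀ v ∈ S, ¬ IsRep P v := by simp [reducedSets]

/-- A reduced set is determined by the classes of `R` in it, and the class of `R` containing a
representative of `P` is never one of them. -/
theorem card_reducedSets_le {P R : Setoid (Fin n)} (h : R ≤ P) :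
    (reducedSets P R).card ≤ 2 ^ (numClasses R - numClasses P) := by
  let rep : Quotient P → Quotient R := fun c => Quotient.mk R c.out
  have hrep : Function.Injective rep := fun c c' hc => by
    have := h (Quotient.exact hc)
    rw [← Quotient.out_eq c, ← Quotient.out_eq c']
    exact Quotient.sound this
  have hcard : ((univ.image rep)ᶜ : Finset (Quotient R)).card = numClasses R - numClasses P := by
    rw [card_compl, card_image_of_injective _ hrep]
    simp [numClasses]
  rw [← hcard, ← card_powerset]
  refine card_le_card_of_injOn (fun S => S.image (Quotient.mk R)) ?_ ?_
  · intro S hS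
    obtain ⟨h1, h2⟩ := mem_reducedSets.1 hS
    simp only [coe_powerset, Set.mem_preimage, Set.mem_powerset_iff, coe_subset]
    intro c hc
    obtain ⟨v, hv, rfl⟩ := mem_image.1 hc
    simp only [mem_compl, mem_image, mem_univ, true_and, not_exists]
    intro c hcv
    have hout : c.out ∈ S := (h1 _ _ (Quotient.exact hcv)).2 hv
    refine h2 _ hout ?_
    rw [IsRep, Quotient.out_eq]
  · intro S hS S' hS' heq
    have key : ∀ {A B : Finset (Fin n)}, Saturated R B →
        A.image (Quotient.mk R) = B.image (Quotient.mk R) → A ⊆ B := by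
      intro A B hB hAB v hv
      have : Quotient.mk R v ∈ B.image (Quotient.mk R) := hAB ▸ mem_image_of_mem _ hv
      obtain ⟨w, hw, hwv⟩ := mem_image.1 this
      exact (hB _ _ (Quotient.exact hwv)).1 hw
    exact Subset.antisymm (key (mem_reducedSets.1 hS').1 heq) (key (mem_reducedSets.1 hS).1 heq.symm)

/-- Flipping the classes whose representative lies in `S` gives a reduced set with the same cut. -/
theorem exists_reduced (P : Setoid (Fin n)) (S : Finset (Fin n)) :
    ∃ S' ∈ reducedSets P ⊥, ∀ e, ¬ Cuts P e → (Crosses S' e ↔ Crosses S e) := by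
  refine ⟨univ.filter fun v => ¬ (v ∈ S ↔ (Quotient.mk P v).out ∈ S), ?_, ?_⟩
  · refine mem_reducedSets.2 ⟨fun u v huv => by rw [show u = v from huv], fun v hv hrep => ?_⟩
    rw [IsRep] at hrep
    simp [hrep] at hv
  · intro e he
    have hout : ∀ u ∈ e, ∀ v ∈ e, (Quotient.mk P u).out = (Quotient.mk P v).out := by
      intro u hu v hv
      rw [Quotient.sound (s := P) (a := u) (b := v)]
      by_contra h
      exact he ⟨u, hu, v, hv, h⟩
    simp only [Crosses, mem_filter, mem_univ, true_and]
    constructor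
    · rintro ⟨⟨u, hu, hu'⟩, v, hv, hv'⟩
      rw [hout u hu v hv] at hu'
      by_cases hv2 : v ∈ S
      · exact ⟨⟨v, hv, hv2⟩, u, hu, by tauto⟩
      · exact ⟨⟨u, hu, by tauto⟩, v, hv, hv2⟩
    · rintro ⟨⟨u, hu, hu'⟩, v, hv, hv'⟩
      by_cases hr : (Quotient.mk P v).out ∈ S
      · exact ⟨⟨v, hv, by tauto⟩, u, hu, by rw [hout u hu v hv]; tauto⟩
      · exact ⟨⟨u, hu, by rw [hout u hu v hv]; tauto⟩, v, hv, by tauto⟩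

/-- The total weight of the hyperedges of `E` crossing `S`. -/
noncomputable def crossWeight (E : FinHypergraph n) (y : Hyperedge n → ℝ) (S : Finset (Fin n)) :
    ℝ := ∑ e ∈ E.filter (Crosses S), y e

theorem one_sub_ge_exp {x : ℝ} (h0 : 0 ≤ x) (h1 : x ≤ 1 / 2) : Real.exp (-(2 * x)) ≤ 1 - x := by
  rw [Real.exp_neg, inv_le_comm₀ (Real.exp_pos _) (by linarith)]
  have := Real.add_one_le_exp (2 * x)
  refine le_trans ?_ this
  rw [inv_le_comm₀ (by linarith) (by linarith), inv_le_iff_one_le_mul₀ (by linarith)]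
  nlinarith

/-- Contracting one class changes the weight `(ρ + 1) ^ (-4 α)` of a cut by at most its chance of
survival. -/
theorem exp_log_step {ρ : ℕ} (hρ : 1 ≤ ρ) {α : ℝ} (h0 : 0 ≤ α) (h1 : α ≤ ρ / 2) :
    Real.exp (-(4 * α * Real.log (ρ + 1))) ≤
      (1 - α / ρ) * Real.exp (-(4 * α * Real.log ρ)) := by
  have hρ' : (1 : ℝ) ≤ ρ := by exact_mod_cast hρ
  have hρ0 : (0 : ℝ) < ρ := by linarith
  have hx := one_sub_ge_exp (x := α / ρ) (by positivity) (by rw [div_le_iff₀ hρ0]; linarith)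
  refine le_trans ?_ (mul_le_mul_of_nonneg_right hx (Real.exp_pos _).le)
  rw [← Real.exp_add]
  refine Real.exp_le_exp.2 ?_
  -- One contraction gains `1 / (2 * ρ)` in the logarithm while survival costs `2 * α / ρ`; this is
  -- the source of the factor 4.
  have hlog : 1 / (2 * ρ) ≤ Real.log (ρ + 1) - Real.log ρ := by
    rw [← Real.log_div (by positivity) (by positivity)]
    have := Real.one_sub_inv_le_log_of_pos (x := ((ρ : ℝ) + 1) / ρ) (by positivity)
    refine le_trans ?_ this
    rw [inv_div, one_sub_div (by positivity), add_sub_cancel_left,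
      div_le_div_iff₀ (by positivity) (by positivity)]
    linarith
  have h2 : 4 * α * (1 / (2 * ρ)) ≤ 4 * α * (Real.log (ρ + 1) - Real.log ρ) := by gcongr
  have h3 : 4 * α * (1 / (2 * ρ)) = 2 * (α / ρ) := by field_simp; ring
  linarith

/-- A cut counting bound in the style of Karger. -/
theorem sum_exp_cut_le {E : FinHypergraph n} {y : Hyperedge n → ℝ} (hy : ∀ e, 0 ≤ y e) {K : ℝ}
    (hK : 0 < K) {P : Setoid (Fin n)} (hE : ∀ e ∈ E, ¬ Cuts P e)
    (hstr : ∀ R, R ≤ P → K * ((numClasses R : ℝ) - numClasses P) ≤ ∑ e ∈ crossing R E, y e)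
    {R : Setoid (Fin n)} (hR : R ≤ P) {ρ : ℕ} (hρ : numClasses R = numClasses P + ρ) :
    ∑ S ∈ reducedSets P R, Real.exp (-(4 * (crossWeight E y S / K) * Real.log (ρ + 1))) ≤ ρ + 1 := by
  have hw : ∀ S, 0 ≤ crossWeight E y S := fun S => sum_nonneg fun e _ => hy e
  induction ρ using Nat.strong_induction_on generalizing R with | _ ρ ih => ?_
  rcases Nat.eq_zero_or_pos ρ with rfl | hpos
  · have := card_reducedSets_le hR
    rw [hρ] at this
    simp only [add_zero, tsub_self, pow_zero] at this
    simpa using this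
  have hρ1 : (1 : ℝ) ≤ ρ := by exact_mod_cast hpos
  set Y := ∑ e ∈ crossing R E, y e with hY
  have hYK : K * ρ ≤ Y := by
    have := hstr R hR
    rw [hρ] at this
    push_cast at this
    linarith
  have hYpos : 0 < Y := lt_of_lt_of_le (by positivity) hYK
  set F : Finset (Fin n) → ℝ := fun S => Real.exp (-(4 * (crossWeight E y S / K) * Real.log ρ))
  have hsplit : ∀ S ∈ reducedSets P R,
      Real.exp (-(4 * (crossWeight E y S / K) * Real.log (ρ + 1))) ≤
        (1 - crossWeight E y S / Y) * F S + (1 / 2) ^ ρ := by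
    intro S hS
    have hle : crossWeight E y S ≤ Y := by
      refine sum_le_sum_of_subset_of_nonneg ?_ fun e _ _ => hy e
      intro e he
      rw [mem_filter] at he
      exact mem_crossing.2 ⟨he.1, (mem_reducedSets.1 hS).1.cuts he.2⟩
    have hnn : 0 ≤ (1 - crossWeight E y S / Y) * F S := by
      refine mul_nonneg (sub_nonneg.2 ((div_le_one hYpos).2 hle)) (Real.exp_pos _).le
    -- Light cuts survive a contraction often enough. A heavy cut contributes at most `2 ^ (-ρ)`,
    -- and as there are at most `2 ^ ρ` reduced sets, heavy cuts add at most 1.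
    by_cases hα : crossWeight E y S / K ≤ ρ / 2
    · refine (exp_log_step hpos (div_nonneg (hw S) hK.le) hα).trans ?_
      refine le_trans ?_ (le_add_of_nonneg_right (by positivity))
      refine mul_le_mul_of_nonneg_right ?_ (Real.exp_pos _).le
      rw [div_div]
      have := div_le_div_of_nonneg_left (hw S) (by positivity) hYK
      linarith
    · refine le_trans ?_ (le_add_of_nonneg_left hnn)
      push Not at hα
      have hlog : Real.log 2 ≤ Real.log (ρ + 1) := Real.log_le_log (by norm_num) (by linarith)
      have hlog2 : 0 < Real.log 2 := Real.log_pos (by norm_num)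
      have h1 : (ρ : ℝ) * Real.log 2 ≤ 4 * (crossWeight E y S / K) * Real.log (ρ + 1) := by
        refine mul_le_mul (by linarith) hlog hlog2.le (by linarith)
      calc _ ≤ Real.exp (-(ρ * Real.log 2)) := Real.exp_le_exp.2 (by linarith)
        _ = (1 / 2) ^ ρ := by
          rw [Real.exp_neg, mul_comm, Real.exp_mul, Real.exp_log (by norm_num), Real.rpow_natCast,
            one_div, inv_pow]
  have hmain : ∑ S ∈ reducedSets P R, (1 - crossWeight E y S / Y) * F S ≤ ρ := by
    -- The factor `1 - crossWeight E y S / Y` is the chance that a hyperedge drawn proportionally to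
    -- `y` misses the cut. Exchanging the sums conditions on the drawn hyperedge; after its
    -- contraction at most `ρ - 1` surplus classes remain.
    have hswap : ∑ S ∈ reducedSets P R, (Y - crossWeight E y S) * F S =
        ∑ e ∈ crossing R E, y e * ∑ S ∈ (reducedSets P R).filter (fun S => ¬ Crosses S e), F S := by
      simp only [mul_sum, sum_filter]
      rw [sum_comm]
      refine sum_congr rfl fun S hS => ?_
      have hsub : Y - crossWeight E y S = ∑ e ∈ crossing R E, if ¬ Crosses S e then y e else 0 := by
        have hfil : E.filter (Crosses S) = (crossing R E).filter (Crosses S) := by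
          ext e
          simp only [mem_filter, mem_crossing]
          have := fun he => (mem_reducedSets.1 hS).1.cuts (e := e) he
          tauto
        rw [crossWeight, hfil, hY, ← sum_filter_add_sum_filter_not (crossing R E) (Crosses S) y,
          add_sub_cancel_left, sum_filter]
      rw [hsub, sum_mul]
      refine sum_congr rfl fun e _ => ?_
      split_ifs <;> simp
    have hbound : ∀ e ∈ crossing R E,
        ∑ S ∈ (reducedSets P R).filter (fun S => ¬ Crosses S e), F S ≤ ρ := by
      intro e he
      rw [mem_crossing] at he
      have hRe : contract R {e} ≤ P := contract_le hR fun e' he' => by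
        rw [mem_singleton.1 he']
        exact hE e he.1
      have hlt : numClasses (contract R {e}) < numClasses R := by
        refine numClasses_lt (le_contract R {e}) fun heq => ?_
        have := not_cuts_contract R (mem_singleton_self e)
        rw [← heq] at this
        exact this he.2
      have hge := numClasses_mono hRe
      obtain ⟨ρ', hρ'⟩ : ∃ ρ', numClasses (contract R {e}) = numClasses P + ρ' :=
        ⟨_, (Nat.add_sub_cancel' hge).symm⟩
      have hρρ : ρ' + 1 ≤ ρ := by omega
      have hρρ' : (ρ' : ℝ) + 1 ≤ ρ := by exact_mod_cast hρρ
      refine le_trans ?_ ((ih ρ' (by omega) hRe hρ').trans hρρ')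
      refine (sum_le_sum_of_subset_of_nonneg (t := reducedSets P (contract R {e})) ?_
        fun S _ _ => (Real.exp_pos _).le).trans (sum_le_sum fun S _ => ?_)
      · intro S hS
        rw [mem_filter, mem_reducedSets] at hS
        exact mem_reducedSets.2 ⟨hS.1.1.contract hS.2, hS.1.2⟩
      · refine Real.exp_le_exp.2 (neg_le_neg ?_)
        have := hw S
        gcongr
    have h1 : ∑ S ∈ reducedSets P R, (1 - crossWeight E y S / Y) * F S =
        (∑ S ∈ reducedSets P R, (Y - crossWeight E y S) * F S) / Y := by
      rw [sum_div]
      refine sum_congr rfl fun S _ => ?_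
      field_simp
    rw [h1, hswap, div_le_iff₀ hYpos, hY, mul_sum]
    refine sum_le_sum fun e he => ?_
    rw [mul_comm (ρ : ℝ)]
    exact mul_le_mul_of_nonneg_left (hbound e he) (hy e)
  calc _ ≤ ∑ S ∈ reducedSets P R, ((1 - crossWeight E y S / Y) * F S + (1 / 2) ^ ρ) :=
        sum_le_sum hsplit
    _ = ∑ S ∈ reducedSets P R, (1 - crossWeight E y S / Y) * F S +
        (reducedSets P R).card * (1 / 2 : ℝ) ^ ρ := by
        rw [sum_add_distrib, sum_const, nsmul_eq_mul]
    _ ≤ ρ + 1 := by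
        refine add_le_add hmain ?_
        have := card_reducedSets_le hR
        rw [hρ, Nat.add_sub_cancel_left] at this
        calc _ ≤ (2 : ℝ) ^ ρ * (1 / 2) ^ ρ := by
              gcongr
              exact_mod_cast this
          _ = 1 := by rw [← mul_pow]; norm_num

end CutCounting

/-! ### Decoding a sparse hypergraph from class sums of measurements. -/

section SketchDecoding

variable {n B : ℕ}

/-- The number of small subsets of a finite set. -/
theorem card_powerset_filter_le {α : Type*} (A : Finset α) (q : ℕ) :
    (A.powerset.filter fun s => s.card ≤ q).card ≤ (A.card + 1) ^ q := by
  induction q with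
  | zero =>
    rw [pow_zero, card_le_one]
    intro s hs t ht
    simp only [mem_filter, Nat.le_zero, card_eq_zero] at hs ht
    rw [hs.2, ht.2]
  | succ q ih =>
    have hsub : (A.powerset.filter fun s => s.card ≤ q + 1) ⊆
        ((A.powerset.filter fun s => s.card ≤ q) ×ˢ insertNone A).image
          fun c => c.2.elim c.1 fun x => insert x c.1 := by
      intro s hs
      simp only [mem_filter, mem_powerset] at hs
      simp only [mem_image, mem_product, mem_filter, mem_powerset, Prod.exists]
      rcases s.eq_empty_or_nonempty with rfl | ⟨x, hx⟩
      · exact ⟨∅, none, ⟨⟨empty_subset _, by simp⟩, by simp⟩, rfl⟩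
      · refine ⟨s.erase x, some x, ⟨⟨(erase_subset _ _).trans hs.1, ?_⟩, ?_⟩, insert_erase hx⟩
        · rw [card_erase_of_mem hx]
          omega
        · simpa using hs.1 hx
    refine (card_le_card hsub).trans (card_image_le.trans ?_)
    rw [card_product, card_insertNone, pow_succ]
    exact Nat.mul_le_mul_right _ ih

/-- Without `Q` itself every exponent is positive, so writing `x = η * (x / η)` splits off one
factor `η`. -/
theorem sum_pow_numClasses_ne_le {V : Type*} [Finite V] {x η : ℝ} (hx : 0 ≤ x) (hη : 0 < η)
    (hη1 : η ≤ 1) (h : (Nat.card V : ℝ) ^ 2 * x ≤ η / 2) (Q : Setoid V) :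
    ∑ R ∈ univ.filter (fun R => Q ≤ R ∧ Q ≠ R), x ^ (numClasses Q - numClasses R) ≤ 2 * η := by
  have h1 := sum_pow_numClasses_le (x := x / η) (by positivity)
    (by rw [← mul_div_assoc, div_le_iff₀ hη]; linarith) Q
  calc _ ≤ ∑ R ∈ univ.filter (fun R => Q ≤ R ∧ Q ≠ R),
        η * (x / η) ^ (numClasses Q - numClasses R) := by
        refine sum_le_sum fun R hR => ?_
        simp only [mem_filter, mem_univ, true_and] at hR
        have hlt := numClasses_lt hR.1 hR.2
        obtain ⟨b, hb⟩ : ∃ b, numClasses Q - numClasses R = b + 1 :=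
          ⟨numClasses Q - numClasses R - 1, by omega⟩
        rw [hb, pow_succ, pow_succ, mul_left_comm, mul_div_cancel₀ _ hη.ne', div_pow]
        refine mul_le_mul_of_nonneg_right ?_ hx
        rw [le_div_iff₀ (by positivity)]
        exact mul_le_of_le_one_right (by positivity) (pow_le_one₀ hη.le hη1)
    _ ≤ ∑ R ∈ univ.filter (fun R => Q ≤ R), η * (x / η) ^ (numClasses Q - numClasses R) := by
        refine sum_le_sum_of_subset_of_nonneg (fun R hR => ?_) fun R _ _ => by positivity
        simp only [mem_filter, mem_univ, true_and] at hR ⊢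
        exact hR.1
    _ ≤ _ := by
        rw [← mul_sum, mul_comm]
        gcongr

/-- The labels of the incidences of hyperedges and vertices. -/
abbrev Labels (n B : ℕ) := Hyperedge n → Fin n → Fin B → ZMod 2

/-- The vertex `v` is the first vertex of `e`. -/
def IsBase (e : Hyperedge n) (v : Fin n) : Prop := v ∈ e ∧ ∀ u ∈ e, v ≤ u

theorem IsBase.unique {e : Hyperedge n} {v w : Fin n} (hv : IsBase e v) (hw : IsBase e w) : v = w :=
  le_antisymm (hv.2 w hw.1) (hw.2 v hv.1)

theorem exists_isBase {e : Hyperedge n} (h : e.Nonempty) : ∃ v, IsBase e v :=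
  ⟨e.min' h, min'_mem e h, fun u hu => min'_le e u hu⟩

/-- The contribution of `e` to the measurements at `v`. These contributions add up to zero over the
vertices of `e`. -/
noncomputable def incidence (a : Labels n B) (e : Hyperedge n) (v : Fin n) : Fin B → ZMod 2 :=
  (if v ∈ e then a e v else 0) - if IsBase e v then ∑ u ∈ e, a e u else 0

/-- The measurements of the hypergraph `F`. -/
noncomputable def measurement (a : Labels n B) (F : FinHypergraph n) (v : Fin n) :
    Fin B → ZMod 2 := ∑ e ∈ F, incidence a e v

/-- The sum of `y` over the class of `w`. -/
noncomputable def classSum (Q : Setoid (Fin n)) (y : Fin n → Fin B → ZMod 2) (w : Fin n) :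
    Fin B → ZMod 2 := ∑ v ∈ univ.filter (fun v => Q v w), y v

/-- If `e` lies in the class of `w`, its labels cancel against their total, which is subtracted at
the first vertex; if `e` lies in another class, it contributes nothing. -/
theorem classSum_incidence {Q : Setoid (Fin n)} (a : Labels n B) {e : Hyperedge n}
    (h : ¬ Cuts Q e) (w : Fin n) : classSum Q (incidence a e) w = 0 := by
  by_cases hw : ∃ u ∈ e, Q u w
  · obtain ⟨u, hu, huw⟩ := hw
    have hall : ∀ v ∈ e, Q v w := by
      intro v hv
      by_contra hc
      exact h ⟨v, hv, u, hu, fun hvu => hc (Q.trans' hvu huw)⟩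
    obtain ⟨b, hb⟩ := exists_isBase ⟨u, hu⟩
    have hbase : ∀ v, IsBase e v ↔ v = b := fun v => ⟨fun hv => hv.unique hb, fun hv => hv ▸ hb⟩
    simp only [classSum, incidence, sum_sub_distrib, hbase]
    rw [sum_ite_eq' _ b, if_pos (by simpa using hall b hb.1), ← sum_filter, filter_filter]
    rw [sub_eq_zero]
    refine sum_congr ?_ fun _ _ => rfl
    ext v
    simpa using fun hv => hall v hv
  · push Not at hw
    refine sum_eq_zero fun v hv => ?_
    have hv' : v ∉ e := fun hve => hw v hve (mem_filter.1 hv).2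
    rw [incidence, if_neg hv', if_neg fun hb => hv' hb.1, sub_zero]

theorem classSum_measurement (Q : Setoid (Fin n)) (a : Labels n B) (F : FinHypergraph n)
    (w : Fin n) : classSum Q (measurement a F) w = ∑ e ∈ F, classSum Q (incidence a e) w := by
  simp only [classSum, measurement]
  exact sum_comm

theorem classSum_measurement_crossing (Q : Setoid (Fin n)) (a : Labels n B) (S : FinHypergraph n)
    (w : Fin n) :
    classSum Q (measurement a (crossing Q S)) w = classSum Q (measurement a S) w := by
  rw [classSum_measurement, classSum_measurement]
  refine sum_subset (filter_subset _ _) fun e he hne => classSum_incidence a ?_ w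
  exact fun hc => hne (mem_crossing.2 ⟨he, hc⟩)

theorem classSum_eq_zero_of_le {Q R : Setoid (Fin n)} (h : Q ≤ R) {y : Fin n → Fin B → ZMod 2}
    (hy : ∀ w, classSum Q y w = 0) (w : Fin n) : classSum R y w = 0 := by
  rw [classSum, ← sum_fiberwise_of_maps_to (t := univ) (g := Quotient.mk Q) (by simp)]
  refine sum_eq_zero fun c _ => ?_
  induction c using Quotient.inductionOn with | _ c => ?_
  by_cases hc : R c w
  · rw [← hy c, classSum]
    refine sum_congr ?_ fun _ _ => rfl
    ext v
    simp only [mem_filter, mem_univ, true_and]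
    exact ⟨fun hv => Quotient.exact hv.2, fun hv => ⟨R.trans' (h hv) hc, Quotient.sound hv⟩⟩
  · refine sum_eq_zero fun v hv => absurd ?_ hc
    simp only [mem_filter, mem_univ, true_and] at hv
    exact R.trans' (R.symm' (h (Quotient.exact hv.2))) hv.1

theorem measurement_symmDiff (a : Labels n B) (F F' : FinHypergraph n) (v : Fin n) :
    measurement a (symmDiff F F') v = measurement a F v - measurement a F' v := by
  have h1 := sum_sdiff_sub_sum_sdiff (s₁ := F') (s₂ := F) (f := fun e => incidence a e v)
  rw [symmDiff_def, sup_eq_union, measurement, sum_union disjoint_sdiff_sdiff]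
  rw [measurement, measurement, ← h1, sub_eq_add_neg]
  congr 1
  funext i
  exact (ZMod.neg_eq_self_mod_two _).symm

/-- Add `g` to the label of the incidence of `e` and `u`. -/
noncomputable def addLabel (a : Labels n B) (e : Hyperedge n) (u : Fin n) (g : Fin B → ZMod 2) :
    Labels n B := fun e' v => if e' = e ∧ v = u then a e' v + g else a e' v

/-- Changing the label of one incidence changes the measurements at two vertices. -/
theorem classSum_measurement_addLabel (Q : Setoid (Fin n)) (a : Labels n B)
    {z : FinHypergraph n} {e : Hyperedge n} (he : e ∈ z) {u b : Fin n} (hu : u ∈ e)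
    (hb : IsBase e b) (g : Fin B → ZMod 2) (w : Fin n) :
    classSum Q (measurement (addLabel a e u g) z) w =
      classSum Q (measurement a z) w + ((if Q u w then g else 0) - if Q b w then g else 0) := by
  have hbase : ∀ v, IsBase e v ↔ v = b := fun v => ⟨fun hv => hv.unique hb, fun hv => hv ▸ hb⟩
  have h1 : ∀ v, measurement (addLabel a e u g) z v =
      measurement a z v + ((if v = u then g else 0) - if v = b then g else 0) := by
    intro v
    rw [measurement, measurement, ← add_sum_erase z _ he, ← add_sum_erase z _ he]
    have h2 : ∀ e' ∈ z.erase e, incidence (addLabel a e u g) e' v = incidence a e' v := by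
      intro e' he'
      have hne : e' ≠ e := (mem_erase.1 he').1
      simp [incidence, addLabel, hne]
    have h3 : incidence (addLabel a e u g) e v =
        incidence a e v + ((if v = u then g else 0) - if v = b then g else 0) := by
      have h4 : ∑ u' ∈ e, addLabel a e u g e u' = ∑ u' ∈ e, a e u' + g := by
        rw [← add_sum_erase e _ hu, ← add_sum_erase e _ hu]
        have h5 : ∀ u' ∈ e.erase u, addLabel a e u g e u' = a e u' := fun u' hu' => by
          simp [addLabel, (mem_erase.1 hu').1]
        rw [sum_congr rfl h5]
        simp only [addLabel, and_self, if_true]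
        abel
      rw [incidence, incidence, h4, addLabel]
      simp only [hbase, true_and]
      by_cases hv : v = u
      · subst hv
        simp only [hu, if_true]
        split_ifs <;> abel
      · simp only [hv, if_false]
        split_ifs <;> abel
    rw [sum_congr rfl h2, h3]
    abel
  simp only [classSum, h1, sum_add_distrib, sum_sub_distrib, sum_ite_eq', mem_filter, mem_univ,
    true_and]

theorem addLabel_injective {a a' : Labels n B} {e : Hyperedge n} {u : Fin n}
    {g : Fin B → ZMod 2} (h : addLabel a e u g = addLabel a' e u g) : a = a' := by
  funext e' v
  have := congrFun (congrFun h e') v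
  simp only [addLabel] at this
  split_ifs at this
  · exact add_right_cancel this
  · exact this

/-- Disjoint translates of one event inside another bound its probability. -/
theorem prob_mul_card_le {Ω G : Type*} [Fintype Ω] [Fintype G] {p q : Ω → Prop} (f : Ω → G → Ω)
    (h : ∀ a g, p a → q (f a g))
    (hinj : ∀ a g a' g', p a → p a' → f a g = f a' g' → a = a' ∧ g = g') :
    prob p * Fintype.card G ≤ prob q := by
  rw [prob_eq_card, prob_eq_card, div_mul_eq_mul_div]
  gcongr
  rw [← card_univ (α := G), ← Nat.cast_mul, ← card_product, Nat.cast_le]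
  refine card_le_card_of_injOn (fun c => f c.1 c.2) ?_ ?_
  · rintro ⟨a, g⟩ hag
    have h1 := (mem_filter.1 (mem_product.1 hag).1).2
    exact mem_filter.2 ⟨mem_univ _, h a g h1⟩
  · rintro ⟨a, g⟩ hag ⟨a', g'⟩ hag' heq
    have h1 := (mem_filter.1 (mem_product.1 hag).1).2
    have h2 := (mem_filter.1 (mem_product.1 hag').1).2
    obtain ⟨rfl, rfl⟩ := hinj a g a' g' h1 h2 heq
    rfl

/-- The measurements separate a hypergraph from zero. -/
theorem prob_classSum_eq_zero_le (Q : Setoid (Fin n)) (z : FinHypergraph n) :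
    prob (fun a : Labels n B => ∀ w, classSum Q (measurement a z) w = 0) ≤
      ((1 / 2 : ℝ) ^ B) ^ (numClasses Q - numClasses (contract Q z)) := by
  induction hN : numClasses Q using Nat.strong_induction_on generalizing Q with | _ N ih => ?_
  subst hN
  by_cases hz : ∀ e ∈ z, ¬ Cuts Q e
  · rw [le_antisymm (contract_le le_rfl hz) (le_contract Q z), Nat.sub_self, pow_zero]
    exact (avg_mono (g := fun _ => 1) fun a => by split_ifs <;> norm_num).trans_eq (avg_const 1)
  push Not at hz
  obtain ⟨e, he, hc⟩ := hz
  obtain ⟨b, hb⟩ := exists_isBase (e := e) (by obtain ⟨u, hu, -⟩ := hc; exact ⟨u, hu⟩)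
  obtain ⟨u, hu, hub⟩ : ∃ u ∈ e, ¬ Q b u := by
    by_contra! h
    obtain ⟨u, hu, v, hv, huv⟩ := hc
    exact huv (Q.trans' (Q.symm' (h u hu)) (h v hv))
  -- Contracting `e` joins `b` and `u` anyway, so merging them first changes nothing and the
  -- induction can proceed by single merges.
  have hcon : contract (merge Q b u) z = contract Q z := by
    refine le_antisymm (contract_le (merge_le (le_contract Q z) ?_)
      fun e' he' => not_cuts_contract Q he') (contract_le ((le_merge Q b u).trans (le_contract _ z))
      fun e' he' => not_cuts_contract _ he')
    by_contra h
    exact not_cuts_contract Q he ⟨b, hb.1, u, hu, h⟩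
  have hm := numClasses_merge hub
  have h1 := ih _ (by omega) (merge Q b u) rfl
  have h2 := numClasses_mono (le_contract (merge Q b u) z)
  rw [hcon] at h1 h2
  have hexp : numClasses Q - numClasses (contract Q z) =
      numClasses (merge Q b u) - numClasses (contract Q z) + 1 := by omega
  rw [hexp, pow_succ]
  -- Adding `g` to one label leaves the class sums of the merged partition zero, whereas the class
  -- sum of `Q` at `u` reveals `g`. The `2 ^ B` translates are therefore disjoint, and each merge
  -- costs a factor `2 ^ (-B)`.
  have h3 := prob_mul_card_le
    (p := fun a : Labels n B => ∀ w, classSum Q (measurement a z) w = 0)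
    (q := fun a : Labels n B => ∀ w, classSum (merge Q b u) (measurement a z) w = 0)
    (fun a g => addLabel a e u g) (fun a g ha w => by
      rw [classSum_measurement_addLabel _ _ he hu hb, classSum_eq_zero_of_le (le_merge Q b u) ha]
      have hr := merge_rel Q b u
      have : merge Q b u u w ↔ merge Q b u b w :=
        ⟨fun h => Setoid.trans' _ hr h, fun h => Setoid.trans' _ (Setoid.symm' _ hr) h⟩
      simp [this]) (fun a g a' g' ha ha' heq => by
      have hval := congrArg (fun x => classSum Q (measurement x z) u) heq
      simp only [classSum_measurement_addLabel _ _ he hu hb, ha u, ha' u, Q.refl' u, hub,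
        if_true, if_false, zero_add, sub_zero] at hval
      subst hval
      exact ⟨addLabel_injective heq, rfl⟩)
  have hcardG : (Fintype.card (Fin B → ZMod 2) : ℝ) = 2 ^ B := by simp [ZMod.card]
  rw [hcardG] at h3
  refine le_trans ?_ (mul_le_mul_of_nonneg_right h1 (by positivity))
  rw [one_div, inv_pow, ← div_eq_mul_inv, le_div_iff₀ (by positivity)]
  exact h3

/-- The hypergraphs among which the decoder searches. -/
structure IsCandidate (r : ℕ) (c : ℝ) (Q : Setoid (Fin n)) (F : FinHypergraph n) : Prop where
  cuts : ∀ e ∈ F, Cuts Q e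
  arity : ∀ e ∈ F, e.card ≤ r
  sparse : Sparse c F Q

/-- With high probability the measurements determine a sparse hypergraph. -/
theorem prob_ambiguous_le {r q : ℕ} {c η : ℝ} (hc : c ≤ q) (hη : 0 < η) (hη1 : η ≤ 1)
    (hB : (n : ℝ) ^ 2 * ((((n + 1) ^ r + 1) ^ q : ℕ) * (1 / 2) ^ B) ≤ η / 2)
    {Q : Setoid (Fin n)} {F : FinHypergraph n} (hF : IsCandidate r c Q F) :
    prob (fun a : Labels n B => ∃ F', IsCandidate r c Q F' ∧ F' ≠ F ∧
      ∀ w, classSum Q (measurement a F') w = classSum Q (measurement a F) w) ≤ 2 * η := by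
  set A : FinHypergraph n := univ.filter fun e => e.card ≤ r with hA
  have hAcard : A.card + 1 ≤ (n + 1) ^ r + 1 := by
    have := card_powerset_filter_le (univ : Finset (Fin n)) r
    simpa [hA] using this
  let small : Setoid (Fin n) → Finset (FinHypergraph n) := fun R =>
    A.powerset.filter fun G => G.card ≤ q * (numClasses Q - numClasses R)
  let z : Setoid (Fin n) → FinHypergraph n → FinHypergraph n := fun R G =>
    symmDiff F (crossing R F ∪ G)
  have hsmall : ∀ R, ((small R).card : ℝ) ≤
      ((((n + 1) ^ r + 1) ^ q : ℕ) : ℝ) ^ (numClasses Q - numClasses R) := by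
    intro R
    rw [← Nat.cast_pow, ← pow_mul]
    refine Nat.cast_le.2 ((card_powerset_filter_le A _).trans ?_)
    exact Nat.pow_le_pow_left hAcard _
  calc _ ≤ prob (fun a : Labels n B => ∃ R ∈ univ.filter (fun R => Q ≤ R ∧ Q ≠ R),
        ∃ G ∈ small R, contract Q (z R G) = R ∧ ∀ w, classSum Q (measurement a (z R G)) w = 0) := by
        refine prob_mono fun a ⟨F', hF', hne, hsum⟩ => ?_
        have hcut : ∀ e ∈ symmDiff F F', Cuts Q e := by
          intro e he
          rcases mem_symmDiff.1 he with h | h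
          · exact hF.cuts e h.1
          · exact hF'.cuts e h.1
        set R := contract Q (symmDiff F F') with hR
        have hQR : Q ≤ R := le_contract _ _
        -- Outside the contracted classes `F` and `F'` agree, so `F'` is determined by `R` and by
        -- its part between `Q` and `R`. Sparsity of `F'` bounds that part by `q` hyperedges per
        -- lost class, which keeps the union bound affordable.
        have hF'eq : crossing R F ∪ between Q R F' = F' := by
          ext e
          by_cases he : e ∈ symmDiff F F'
          · have h1 : ¬ Cuts R e := not_cuts_contract Q he
            have h2 := hcut e he
            simp only [mem_union, mem_crossing, mem_between]
            tauto
          · have h1 : e ∈ F ↔ e ∈ F' := by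
              rw [mem_symmDiff] at he
              tauto
            have h2 : e ∈ F' → Cuts Q e := hF'.cuts e
            simp only [mem_union, mem_crossing, mem_between]
            tauto
        have hz : z R (between Q R F') = symmDiff F F' := by
          simp only [z, hF'eq]
        refine ⟨R, ?_, between Q R F', ?_, ?_, ?_⟩
        · simp only [mem_filter, mem_univ, true_and]
          refine ⟨hQR, fun heq => ?_⟩
          obtain ⟨e, he⟩ : (symmDiff F F').Nonempty := by
            rw [nonempty_iff_ne_empty, ne_eq, ← bot_eq_empty, symmDiff_eq_bot]
            exact fun h => hne h.symm
          exact not_cuts_contract Q he (by rw [← hR, ← heq]; exact hcut e he)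
        · simp only [small, mem_filter, mem_powerset]
          refine ⟨fun e he => ?_, ?_⟩
          · simp only [hA, mem_filter, mem_univ, true_and]
            exact hF'.arity e (mem_between.1 he).1
          · have h1 := hF'.sparse R hQR
            have h2 := numClasses_mono hQR
            have h3 : (0 : ℝ) ≤ (numClasses Q : ℝ) - numClasses R :=
              sub_nonneg.2 (by exact_mod_cast h2)
            have h4 := h1.trans (mul_le_mul_of_nonneg_right hc h3)
            rw [← Nat.cast_sub h2] at h4
            exact_mod_cast h4
        · rw [hz]
        · intro w
          rw [hz]
          have : classSum Q (measurement a (symmDiff F F')) w =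
              classSum Q (measurement a F) w - classSum Q (measurement a F') w := by
            simp only [classSum, measurement_symmDiff, sum_sub_distrib]
          rw [this, hsum, sub_self]
    _ ≤ ∑ R ∈ univ.filter (fun R => Q ≤ R ∧ Q ≠ R),
        ((((n + 1) ^ r + 1) ^ q : ℕ) * (1 / 2 : ℝ) ^ B) ^ (numClasses Q - numClasses R) := by
        refine (prob_exists_le _ _).trans (sum_le_sum fun R _ => ?_)
        rw [mul_pow]
        refine (prob_exists_le_card_mul (δ := ((1 / 2 : ℝ) ^ B) ^ (numClasses Q - numClasses R))
          _ _ fun G _ => ?_).trans ?_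
        · by_cases h : contract Q (z R G) = R
          · refine (prob_mono fun a ha => ha.2).trans ?_
            have := prob_classSum_eq_zero_le (B := B) Q (z R G)
            rwa [h] at this
          · refine (prob_mono (q := fun _ => False) fun a ha => h ha.1).trans ?_
            rw [prob_false]
            positivity
        · gcongr
          exact hsmall R
    _ ≤ 2 * η := sum_pow_numClasses_ne_le (by positivity) hη hη1 (by rwa [Nat.card_fin]) Q

/-- The decoder: a candidate with the given sums of measurements. -/
noncomputable def decode (r : ℕ) (c : ℝ) (Q : Setoid (Fin n)) (a : Labels n B)
    (y : Fin n → Fin B → ZMod 2) : FinHypergraph n :=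
  if h : ∃ F, IsCandidate r c Q F ∧ ∀ w, classSum Q (measurement a F) w = classSum Q y w then
    Classical.choose h else ∅

theorem decode_eq {r : ℕ} {c : ℝ} {Q : Setoid (Fin n)} {a : Labels n B} {S : FinHypergraph n}
    (hS : IsCandidate r c Q (crossing Q S))
    (h : ¬ ∃ F', IsCandidate r c Q F' ∧ F' ≠ crossing Q S ∧
      ∀ w, classSum Q (measurement a F') w = classSum Q (measurement a (crossing Q S)) w) :
    decode r c Q a (measurement a S) = crossing Q S := by
  have hex : ∃ F, IsCandidate r c Q F ∧
      ∀ w, classSum Q (measurement a F) w = classSum Q (measurement a S) w :=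
    ⟨_, hS, classSum_measurement_crossing Q a S⟩
  rw [decode, dif_pos hex]
  by_contra hne
  obtain ⟨h1, h2⟩ := Classical.choose_spec hex
  exact h ⟨_, h1, hne, fun w => (h2 w).trans (classSum_measurement_crossing Q a S w).symm⟩

end SketchDecoding

/-! ### Concentration of samples for all partitions simultaneously. -/

section Sampling

variable {n L T : ℕ}

/-- The independent random numbers used for sampling: one for each step, round and hyperedge. -/
abbrev Coins (n L T : ℕ) := Fin (L + 1) × Fin (T + 2) × Hyperedge n → Fin (2 ^ L)

/-- The position of a random number. -/
def coin (L T d τ : ℕ) (e : Hyperedge n) : Fin (L + 1) × Fin (T + 2) × Hyperedge n :=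
  (Fin.ofNat (L + 1) d, Fin.ofNat (T + 2) τ, e)

/-- The sample of `H` at rate `2 ^ d / 2 ^ L` in round `τ`. -/
noncomputable def sample (H : FinHypergraph n) (u : Coins n L T) (d τ : ℕ) : FinHypergraph n :=
  H.filter fun e => (u (coin L T d τ e)).val < 2 ^ d

theorem avg_indicator_lt {L d : ℕ} (h : d ≤ L) :
    avg (fun x : Fin (2 ^ L) => if x.val < 2 ^ d then (1 : ℝ) else 0) = rate L d := by
  have h1 : (univ.filter fun x : Fin (2 ^ L) => x.val < 2 ^ d).card = 2 ^ d := by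
    have : (univ.filter fun x : Fin (2 ^ L) => x.val < 2 ^ d).map Fin.valEmbedding = range (2 ^ d) := by
      ext i
      simp only [mem_map, mem_filter, mem_univ, true_and, Fin.valEmbedding_apply, mem_range]
      constructor
      · rintro ⟨x, hx, rfl⟩
        exact hx
      · intro hi
        exact ⟨⟨i, hi.trans_le (Nat.pow_le_pow_right (by norm_num) h)⟩, hi, rfl⟩
    rw [← card_map Fin.valEmbedding, this, card_range]
  rw [avg, sum_boole, h1, rate]
  simp

theorem coin_injective (L T d τ : ℕ) : Function.Injective (coin (n := n) L T d τ) :=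
  fun _ _ h => (Prod.ext_iff.1 (Prod.ext_iff.1 h).2).2

theorem between_sample (Q R : Setoid (Fin n)) (H : FinHypergraph n) (u : Coins n L T) (d τ : ℕ) :
    ((between Q R (sample H u d τ)).card : ℝ) =
      ∑ e ∈ between Q R H, if (u (coin L T d τ e)).val < 2 ^ d then (1 : ℝ) else 0 := by
  rw [sum_boole]
  congr 2
  ext e
  simp only [mem_between, sample, mem_filter]
  tauto

/-- Chernoff is used with absolute error `k` times the number of classes lost since `Q₀`, so the
failure probability of a pair is a power with that exponent. It splits into a factor for `Q₀ ≤ Q`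
and one for `Q ≤ R`, each summed by `sum_pow_numClasses_le`; one `η` is left over because pairs with
`R = Q₀` cannot fail. -/
theorem prob_not_concentrated_le {δ k η y : ℝ} (hδ : 0 < δ) (hδ1 : δ ≤ 1) (hη : 0 < η)
    (hη1 : η ≤ 1) (hy : 0 ≤ y) (hny : (n : ℝ) ^ 2 * y ≤ 1 / 2)
    (hx : Real.exp (-(δ ^ 2 * k / 2)) ≤ η * y) {d : ℕ} (hd : d ≤ L) (τ : ℕ)
    (H : FinHypergraph n) (Q₀ : Setoid (Fin n)) :
    prob (fun u : Coins n L T => ¬ Concentrated δ k (rate L d) H (sample H u d τ) Q₀) ≤ 8 * η := by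
  let bad : Setoid (Fin n) → Setoid (Fin n) → Coins n L T → Prop := fun Q R u =>
    δ * (rate L d * (between Q R H).card + k * ((numClasses Q₀ : ℝ) - numClasses R)) <
      |((between Q R (sample H u d τ)).card : ℝ) - rate L d * (between Q R H).card|
  have hcard : Nat.card (Fin n) = n := Nat.card_fin n
  have hbad : ∀ Q R, Q₀ ≤ Q → Q ≤ R → prob (bad Q R) ≤
      2 * η * (y ^ (numClasses Q₀ - numClasses Q) * y ^ (numClasses Q - numClasses R)) := by
    intro Q R hQ hR
    by_cases h0 : Q₀ = R
    · subst h0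
      obtain rfl := le_antisymm hQ hR
      refine (prob_mono (q := fun _ => False) fun u hu => ?_).trans ?_
      · have hempty : ∀ S : FinHypergraph n, between Q₀ Q₀ S = ∅ := fun S => by
          ext e
          simp [mem_between]
        simp [bad, hempty] at hu
      · rw [prob_false]
        positivity
    · have hlt := numClasses_lt (hQ.trans hR) h0
      have h1 := numClasses_mono hQ
      have h2 := numClasses_mono hR
      have hsum : ∑ e ∈ between Q R H,
          avg (fun x : Fin (2 ^ L) => if x.val < 2 ^ d then (1 : ℝ) else 0) =
            rate L d * (between Q R H).card := by
        rw [sum_const, avg_indicator_lt hd, nsmul_eq_mul, mul_comm]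
      have h3 := chernoff (between Q R H) (f := coin L T d τ) ((coin_injective L T d τ).injOn)
        (z := fun _ (x : Fin (2 ^ L)) => if x.val < 2 ^ d then (1 : ℝ) else 0)
        (fun _ _ => by positivity) (fun _ _ => by split_ifs <;> norm_num) (δ := δ)
        (K := k * ((numClasses Q₀ : ℝ) - numClasses R)) hδ hδ1
      rw [hsum] at h3
      simp only [bad, between_sample]
      refine h3.trans ?_
      rw [mul_assoc]
      refine mul_le_mul_of_nonneg_left ?_ (by norm_num)
      rw [← pow_add]
      obtain ⟨b, hb⟩ : ∃ b, numClasses Q₀ = numClasses R + (b + 1) :=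
        ⟨numClasses Q₀ - numClasses R - 1, by omega⟩
      have he : numClasses Q₀ - numClasses Q + (numClasses Q - numClasses R) = b + 1 := by omega
      rw [he, hb]
      calc _ = Real.exp (-(δ ^ 2 * k / 2)) ^ (b + 1) := by
            rw [← Real.exp_nat_mul]
            congr 1
            push_cast
            ring
        _ ≤ (η * y) ^ (b + 1) := by gcongr
        _ = η * y ^ (b + 1) * η ^ b := by ring
        _ ≤ _ := mul_le_of_le_one_right (by positivity) (pow_le_one₀ hη.le hη1)
  calc _ ≤ prob (fun u : Coins n L T => ∃ Q ∈ univ.filter (fun Q => Q₀ ≤ Q),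
        ∃ R ∈ univ.filter (fun R => Q ≤ R), bad Q R u) := by
        refine prob_mono fun u hu => ?_
        simp only [Concentrated, not_forall, not_le] at hu
        obtain ⟨Q, R, h1, h2, h3⟩ := hu
        exact ⟨Q, by simpa using h1, R, by simpa using h2, h3⟩
    _ ≤ ∑ Q ∈ univ.filter (fun Q => Q₀ ≤ Q), ∑ R ∈ univ.filter (fun R => Q ≤ R),
        2 * η * (y ^ (numClasses Q₀ - numClasses Q) * y ^ (numClasses Q - numClasses R)) := by
        refine (prob_exists_le _ _).trans (sum_le_sum fun Q hQ => ?_)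
        refine (prob_exists_le _ _).trans (sum_le_sum fun R hR => ?_)
        exact hbad Q R (mem_filter.1 hQ).2 (mem_filter.1 hR).2
    _ = ∑ Q ∈ univ.filter (fun Q => Q₀ ≤ Q), 2 * η * y ^ (numClasses Q₀ - numClasses Q) *
        ∑ R ∈ univ.filter (fun R => Q ≤ R), y ^ (numClasses Q - numClasses R) := by
        simp only [mul_sum, mul_assoc]
    _ ≤ ∑ Q ∈ univ.filter (fun Q => Q₀ ≤ Q), 2 * η * y ^ (numClasses Q₀ - numClasses Q) * 2 := by
        gcongr with Q hQ
        exact sum_pow_numClasses_le hy (by rwa [hcard]) Q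
    _ = 4 * η * ∑ Q ∈ univ.filter (fun Q => Q₀ ≤ Q), y ^ (numClasses Q₀ - numClasses Q) := by
        rw [mul_sum]
        exact sum_congr rfl fun Q _ => by ring
    _ ≤ 4 * η * 2 := by
        gcongr
        exact sum_pow_numClasses_le hy (by rwa [hcard]) Q₀
    _ = 8 * η := by ring

/-- The random numbers of one round of one step. -/
def roundCoins (n L T d τ : ℕ) : Set (Fin (L + 1) × Fin (T + 2) × Hyperedge n) :=
  {c | c.1 = Fin.ofNat (L + 1) d ∧ c.2.1 = Fin.ofNat (T + 2) τ}

theorem sample_piecewise (H : FinHypergraph n) (u u' : Coins n L T) (d τ : ℕ) :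
    sample H ((roundCoins n L T d τ).piecewise u' u) d τ = sample H u' d τ := by
  unfold sample
  congr 1
  funext e
  rw [Set.piecewise_eq_of_mem]
  exact ⟨rfl, rfl⟩

theorem ofNat_ne {N a b : ℕ} (ha : a ≤ N) (hb : b ≤ N) (h : a ≠ b) :
    Fin.ofNat (N + 1) a ≠ Fin.ofNat (N + 1) b := by
  intro heq
  have := congrArg Fin.val heq
  simp only [Fin.val_ofNat] at this
  rw [Nat.mod_eq_of_lt (by omega), Nat.mod_eq_of_lt (by omega)] at this
  exact h this

theorem sample_piecewise_of_ne (H : FinHypergraph n) (u u' : Coins n L T) {d τ d' τ' : ℕ}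
    (hd : d ≤ L) (hd' : d' ≤ L) (hτ : τ ≤ T + 1) (hτ' : τ' ≤ T + 1) (h : d ≠ d' ∨ τ ≠ τ') :
    sample H ((roundCoins n L T d τ).piecewise u' u) d' τ' = sample H u d' τ' := by
  unfold sample
  congr 1
  funext e
  rw [Set.piecewise_eq_of_notMem]
  rintro ⟨h1, h2⟩
  rcases h with h | h
  · exact ofNat_ne hd' hd h.symm h1
  · exact ofNat_ne hτ' hτ h.symm h2

/-- The concentration also holds for partitions which are found from other samples. -/
theorem prob_not_concentrated_le_of_indep {δ k η y : ℝ} (hδ : 0 < δ) (hδ1 : δ ≤ 1) (hη : 0 < η)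
    (hη1 : η ≤ 1) (hy : 0 ≤ y) (hny : (n : ℝ) ^ 2 * y ≤ 1 / 2)
    (hx : Real.exp (-(δ ^ 2 * k / 2)) ≤ η * y) {d : ℕ} (hd : d ≤ L) (τ : ℕ)
    (H : FinHypergraph n) (Q₀ : Coins n L T → Setoid (Fin n))
    (hQ₀ : ∀ u u', Q₀ ((roundCoins n L T d τ).piecewise u' u) = Q₀ u) :
    prob (fun u : Coins n L T => ¬ Concentrated δ k (rate L d) H (sample H u d τ) (Q₀ u)) ≤
      8 * η := by
  refine prob_le_of_resample (roundCoins n L T d τ) fun u => ?_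
  simp only [sample_piecewise, hQ₀]
  exact prob_not_concentrated_le hδ hδ1 hη hη1 hy hny hx hd τ H (Q₀ u)

end Sampling

/-! ### Sampling errors of the cuts of a strong hypergraph. -/

section CutErrors

variable {n : ℕ}

theorem crossing_bot_of_crosses {S : Finset (Fin n)} {e : Hyperedge n} (h : Crosses S e) :
    Cuts ⊥ e := by
  obtain ⟨⟨u, hu, hu'⟩, v, hv, hv'⟩ := h
  exact ⟨u, hu, v, hv, fun huv => hv' (by rwa [← show u = v from huv])⟩

/-- All cuts of a strong weighted hypergraph are preserved by sampling. -/
theorem prob_cut_error_le {ι X : Type*} [Fintype ι] [DecidableEq ι] [Fintype X] [Nonempty X] (hn : 1 ≤ n)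
    {E : FinHypergraph n} {y : Hyperedge n → ℝ} (hy : ∀ e, 0 < y e) {K : ℝ} (hK : 0 < K)
    {P : Setoid (Fin n)} (hE : ∀ e ∈ E, ¬ Cuts P e)
    (hstr : ∀ R, R ≤ P → K * ((numClasses R : ℝ) - numClasses P) ≤ ∑ e ∈ crossing R E, y e)
    {f : Hyperedge n → ι} (hf : Set.InjOn f E) {z : Hyperedge n → X → ℝ} (h0 : ∀ e x, 0 ≤ z e x)
    (h1 : ∀ e x, z e x ≤ 1) (hz : ∀ e ∈ E, avg (z e) = y e) {ε Λ : ℝ} (hε : 0 < ε) (hε1 : ε ≤ 1)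
    (hΛ : 0 ≤ Λ) (hεK : 4 * Real.log n + Λ ≤ ε ^ 2 * K / 8) :
    prob (fun u : ι → X => ∃ S, ε * crossWeight E y S <
      |∑ e ∈ E.filter (Crosses S), z e (u (f e)) - crossWeight E y S|) ≤
        2 * n * Real.exp (-Λ) := by
  let bad : Finset (Fin n) → (ι → X) → Prop := fun S u => ε * crossWeight E y S <
    |∑ e ∈ E.filter (Crosses S), z e (u (f e)) - crossWeight E y S|
  obtain ⟨ρ, hρ⟩ : ∃ ρ, numClasses (⊥ : Setoid (Fin n)) = numClasses P + ρ :=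
    ⟨_, (Nat.add_sub_cancel' (numClasses_mono bot_le)).symm⟩
  have hρn : ρ + 1 ≤ n := by
    have : Nonempty (Fin n) := ⟨⟨0, hn⟩⟩
    have := numClasses_pos P
    rw [numClasses_bot, Nat.card_fin] at hρ
    omega
  have hρn' : (ρ : ℝ) + 1 ≤ n := by exact_mod_cast hρn
  have hlog : Real.log (ρ + 1) ≤ Real.log n := Real.log_le_log (by positivity) hρn'
  have hlog0 : 0 ≤ Real.log (ρ + 1) := Real.log_nonneg (by linarith [Nat.cast_nonneg (α := ℝ) ρ])
  have hbad : ∀ S, prob (bad S) ≤ 2 * Real.exp (-Λ) *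
      Real.exp (-(4 * (crossWeight E y S / K) * Real.log (ρ + 1))) := by
    intro S
    rcases (E.filter (Crosses S)).eq_empty_or_nonempty with hemp | ⟨e, he⟩
    · refine (prob_mono (q := fun _ => False) fun u hu => ?_).trans ?_
      · simp [bad, crossWeight, hemp] at hu
      · rw [prob_false]
        positivity
    · rw [mem_filter] at he
      have hle : P ⊓ Setoid.ker (fun x => x ∈ S) ≤ P := inf_le_left
      have hfil : crossing (P ⊓ Setoid.ker (fun x => x ∈ S)) E ⊆ E.filter (Crosses S) := by
        intro e' he'
        obtain ⟨h2, u, hu, v, hv, huv⟩ := mem_crossing.1 he'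
        have hP : P u v := by
          by_contra h
          exact hE e' h2 ⟨u, hu, v, hv, h⟩
        have hne : ¬ ((u ∈ S) = (v ∈ S)) := fun h => huv ⟨hP, h⟩
        refine mem_filter.2 ⟨h2, ?_⟩
        by_cases huS : u ∈ S
        · exact ⟨⟨u, hu, huS⟩, v, hv, fun hvS => hne (propext ⟨fun _ => hvS, fun _ => huS⟩)⟩
        · refine ⟨⟨v, hv, ?_⟩, u, hu, huS⟩
          by_contra hvS
          exact hne (propext ⟨fun h => absurd h huS, fun h => absurd h hvS⟩)
      have hlt : numClasses P < numClasses (P ⊓ Setoid.ker (fun x => x ∈ S)) := by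
        refine numClasses_lt hle fun heq => hE e he.1 ?_
        rw [← heq]
        obtain ⟨⟨u, hu, hu'⟩, v, hv, hv'⟩ := he.2
        refine ⟨u, hu, v, hv, fun h => hv' ?_⟩
        have : (u ∈ S) = (v ∈ S) := h.2
        rwa [← this]
      -- Splitting the classes of `P` along `S` creates at least one new class, so strength bounds
      -- every nonempty cut from below.
      have hw : K ≤ crossWeight E y S := by
        have h2 : (1 : ℝ) ≤ (numClasses (P ⊓ Setoid.ker (fun x => x ∈ S)) : ℝ) - numClasses P := by
          have : (numClasses P : ℝ) + 1 ≤ numClasses (P ⊓ Setoid.ker (fun x => x ∈ S)) := by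
            exact_mod_cast hlt
          linarith
        calc K = K * 1 := (mul_one K).symm
          _ ≤ _ := mul_le_mul_of_nonneg_left h2 hK.le
          _ ≤ _ := hstr _ hle
          _ ≤ _ := sum_le_sum_of_subset_of_nonneg hfil fun e _ _ => (hy e).le
      have hmean : ∑ e ∈ E.filter (Crosses S), avg (z e) = crossWeight E y S :=
        sum_congr rfl fun e he => hz e (mem_filter.1 he).1
      -- With half the accuracy and the cut weight itself as absolute error, the total error is `ε`
      -- times the weight and the exponent is `ε ^ 2 / 8` times the weight. This covers both the
      -- factor needed for cut counting and `Λ`.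
      have h3 := chernoff (E.filter (Crosses S)) (f := f)
        (hf.mono fun e he => (mem_filter.1 he).1) h0 h1 (δ := ε / 2) (K := crossWeight E y S)
        (by linarith) (by linarith)
      rw [hmean] at h3
      have h4 : ε / 2 * (crossWeight E y S + crossWeight E y S) = ε * crossWeight E y S := by ring
      rw [h4] at h3
      refine h3.trans ?_
      rw [mul_assoc, ← Real.exp_add]
      refine mul_le_mul_of_nonneg_left (Real.exp_le_exp.2 ?_) (by norm_num)
      have hα : 1 ≤ crossWeight E y S / K := by rwa [le_div_iff₀ hK, one_mul]
      have h5 : crossWeight E y S = crossWeight E y S / K * K := by field_simp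
      set α := crossWeight E y S / K
      rw [h5]
      have h6 : α * (4 * Real.log (ρ + 1) + Λ) ≤ α * (ε ^ 2 * K / 8) := by
        refine mul_le_mul_of_nonneg_left ?_ (by linarith)
        linarith
      have h7 : Λ ≤ α * Λ := by nlinarith
      nlinarith
  calc _ ≤ prob (fun u : ι → X => ∃ S ∈ reducedSets P ⊥, bad S u) := by
        refine prob_mono fun u ⟨S, hS⟩ => ?_
        obtain ⟨S', hS', h2⟩ := exists_reduced P S
        refine ⟨S', hS', ?_⟩
        have h3 : E.filter (Crosses S') = E.filter (Crosses S) :=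
          filter_congr fun e he => h2 e (hE e he)
        simpa only [bad, crossWeight, h3] using hS
    _ ≤ ∑ S ∈ reducedSets P ⊥, 2 * Real.exp (-Λ) *
        Real.exp (-(4 * (crossWeight E y S / K) * Real.log (ρ + 1))) :=
        (prob_exists_le _ _).trans (sum_le_sum fun S _ => hbad S)
    _ ≤ 2 * Real.exp (-Λ) * (ρ + 1) := by
        rw [← mul_sum]
        gcongr
        exact sum_exp_cut_le (fun e => (hy e).le) hK hE hstr bot_le hρ
    _ ≤ 2 * Real.exp (-Λ) * n := by gcongr
    _ = _ := by ring

end CutErrors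

/-! ### From accuracy on every level to a sparsifier. -/

section Sparsifier

variable {n : ℕ}

theorem cutWeight_weight (H : FinHypergraph n) (S : Finset (Fin n)) :
    cutWeight H.weight S = ∑ _e ∈ H.filter (Crosses S), (1 : ℝ) := by
  rw [cutWeight, sum_filter, ← sum_filter_add_sum_filter_not univ (· ∈ H)]
  rw [filter_mem_eq_inter, univ_inter, sum_eq_zero (s := univ.filter (· ∉ H)), add_zero]
  · refine sum_congr rfl fun e he => ?_
    simp [FinHypergraph.weight, he]
  · intro e he
    simp [FinHypergraph.weight, (mem_filter.1 he).2]

theorem cutWeight_of_support {H : FinHypergraph n} {w : Hyperedge n → ℝ}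
    (hw : ∀ e, w e ≠ 0 → e ∈ H) (S : Finset (Fin n)) :
    cutWeight w S = ∑ e ∈ H.filter (Crosses S), w e := by
  rw [cutWeight, ← sum_filter]
  symm
  refine sum_subset (filter_subset_filter _ (subset_univ _)) fun e he hne => ?_
  by_contra h
  exact hne (mem_filter.2 ⟨hw e h, (mem_filter.1 he).2⟩)

theorem sum_Ioc_pow (L s : ℕ) (hs : s < L) :
    ∑ d ∈ Ioc (L - 1 - s) L, (if d = L then (2 : ℝ) else 2 ^ (L - d)) = 2 ^ (s + 1) := by
  induction s with
  | zero =>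
    have : Ioc (L - 1 - 0) L = {L} := by
      ext d
      simp only [mem_Ioc, mem_singleton]
      omega
    rw [this]
    simp
  | succ s ih =>
    have : Ioc (L - 1 - (s + 1)) L = insert (L - 1 - s) (Ioc (L - 1 - s) L) := by
      ext d
      simp only [mem_Ioc, mem_insert]
      omega
    rw [this, sum_insert (by simp), ih (by omega), if_neg (by omega),
      show L - (L - 1 - s) = s + 1 by omega]
    ring

/-- Benczúr–Karger decomposition: if the sampled weights are accurate on the strong components of
all levels, they form a sparsifier. -/
theorem isSparsifier_of_levels {H : FinHypergraph n} {P : ℕ → Setoid (Fin n)} (hP : Monotone P)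
    (hP0 : P 0 = ⊥) {L : ℕ} {ε : ℝ} {w : Hyperedge n → ℝ} (hε : 0 ≤ ε) (hw0 : ∀ e, 0 ≤ w e)
    (hwH : ∀ e, w e ≠ 0 → e ∈ H)
    (hw1 : ∀ e ∈ H, Cuts ⊥ e → cutLevel P L e = L → w e = 1)
    (h : ∀ d, 1 ≤ d → d ≤ L → ∀ S,
      |∑ e ∈ (H.filter fun e => ¬ Cuts (P d) e).filter (Crosses S), rate L (cutLevel P L e) * w e -
        crossWeight (H.filter fun e => ¬ Cuts (P d) e) (fun e => rate L (cutLevel P L e)) S| ≤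
      ε * crossWeight (H.filter fun e => ¬ Cuts (P d) e) (fun e => rate L (cutLevel P L e)) S) :
    IsSparsifier ε H w := by
  set y : Hyperedge n → ℝ := fun e => rate L (cutLevel P L e) with hy
  have hy0 : ∀ e, 0 < y e := fun e => rate_pos _ _
  -- The top coefficient is 2 instead of 1, so that the coefficients above level `j < L` add up to
  -- exactly `2 ^ (L - j)`, the inverse rate. Hyperedges of level `L` occur in no sum and must have
  -- exact weight 1.
  set c : ℕ → ℝ := fun d => if d = L then (2 : ℝ) else 2 ^ (L - d) with hc
  have hc0 : ∀ d, 0 ≤ c d := fun d => by simp only [hc]; positivity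
  have hsum : ∀ e, cutLevel P L e < L → y e * ∑ d ∈ Ioc (cutLevel P L e) L, c d = 1 := by
    intro e he
    have h1 := sum_Ioc_pow L (L - 1 - cutLevel P L e) (by omega)
    rw [show L - 1 - (L - 1 - cutLevel P L e) = cutLevel P L e by omega,
      show L - 1 - cutLevel P L e + 1 = L - cutLevel P L e by omega] at h1
    rw [h1]
    simp only [hy, rate]
    rw [div_mul_eq_mul_div, ← pow_add, Nat.add_sub_cancel' he.le]
    exact div_self (by positivity)
  have hmem : ∀ S e, e ∈ H → Crosses S e → ∀ d, ¬ Cuts (P d) e → cutLevel P L e < d :=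
    fun S e _ heS d hd => cutLevel_lt hP (hP0 ▸ crossing_bot_of_crosses heS) hd
  have hfil : ∀ S d, 1 ≤ d → d ≤ L → (H.filter fun e => ¬ Cuts (P d) e).filter (Crosses S) =
      (H.filter (Crosses S)).filter fun e => d ∈ Ioc (cutLevel P L e) L := by
    intro S d h1 h2
    ext e
    simp only [mem_filter, mem_Ioc]
    constructor
    · rintro ⟨⟨he, hd⟩, hS⟩
      exact ⟨⟨he, hS⟩, hmem S e he hS d hd, h2⟩
    · rintro ⟨⟨he, hS⟩, hd, -⟩
      exact ⟨⟨he, fun hc => absurd (le_cutLevel h2 hc) (not_le.2 hd)⟩, hS⟩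
  have hex : ∀ S (g : Hyperedge n → ℝ), ∑ e ∈ H.filter (Crosses S),
      g e * ∑ d ∈ Ioc (cutLevel P L e) L, c d =
        ∑ d ∈ Icc 1 L, c d * ∑ e ∈ (H.filter fun e => ¬ Cuts (P d) e).filter (Crosses S), g e := by
    intro S g
    have h1 : ∀ e, ∑ d ∈ Ioc (cutLevel P L e) L, c d =
        ∑ d ∈ Icc 1 L, if d ∈ Ioc (cutLevel P L e) L then c d else 0 := by
      intro e
      rw [← sum_filter]
      refine sum_congr ?_ fun _ _ => rfl
      ext d
      simp only [mem_filter, mem_Icc, mem_Ioc]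
      omega
    simp only [h1, mul_sum]
    rw [sum_comm]
    refine sum_congr rfl fun d hd => ?_
    rw [mem_Icc] at hd
    rw [hfil S d hd.1 hd.2]
    generalize H.filter (Crosses S) = F
    rw [sum_filter]
    refine sum_congr rfl fun e _ => ?_
    split_ifs <;> ring
  have herr : ∀ S, |cutWeight w S - cutWeight H.weight S| ≤ ε * cutWeight H.weight S := by
    intro S
    rw [cutWeight_weight, cutWeight_of_support hwH, ← sum_sub_distrib]
    have h1 : ∑ e ∈ H.filter (Crosses S), (w e - 1) = ∑ e ∈ H.filter (Crosses S),
        (y e * w e - y e) * ∑ d ∈ Ioc (cutLevel P L e) L, c d := by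
      refine sum_congr rfl fun e he => ?_
      rw [mem_filter] at he
      rcases (cutLevel_le P L e).lt_or_eq with hlt | heq
      · calc w e - 1 = (w e - 1) * (y e * ∑ d ∈ Ioc (cutLevel P L e) L, c d) := by
              rw [hsum e hlt, mul_one]
          _ = _ := by ring
      · rw [hw1 e he.1 (crossing_bot_of_crosses he.2) heq]
        ring
    rw [h1, hex S fun e => y e * w e - y e]
    calc _ ≤ ∑ d ∈ Icc 1 L, c d * (ε * crossWeight (H.filter fun e => ¬ Cuts (P d) e) y S) := by
          refine (abs_sum_le_sum_abs _ _).trans (sum_le_sum fun d hd => ?_)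
          rw [mem_Icc] at hd
          rw [abs_mul, abs_of_nonneg (hc0 d), sum_sub_distrib]
          exact mul_le_mul_of_nonneg_left (h d hd.1 hd.2 S) (hc0 d)
      _ = ε * ∑ e ∈ H.filter (Crosses S), y e * ∑ d ∈ Ioc (cutLevel P L e) L, c d := by
          rw [hex S y, mul_sum]
          refine sum_congr rfl fun d _ => ?_
          rw [crossWeight]
          ring
      _ ≤ _ := by
          refine mul_le_mul_of_nonneg_left (sum_le_sum fun e _ => ?_) hε
          rcases (cutLevel_le P L e).lt_or_eq with hlt | heq
          · exact (hsum e hlt).le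
          · rw [heq]
            simp
  refine ⟨hw0, hwH, fun S => ?_, fun S => ?_⟩
  · linarith [(abs_le.1 (herr S)).1]
  · linarith [(abs_le.1 (herr S)).2]

end Sparsifier

/-! ### Typical samples and what they imply. -/

section GoodSamples

variable {n L T : ℕ}

/-- The partitions found from exact samples. -/
noncomputable def sampleLevels (k : ℝ) (H : FinHypergraph n) (u : Coins n L T) (d : ℕ) :
    Setoid (Fin n) := levels k T (fun d _ τ => sample H u d τ) d

/-- The partitions during one step. -/
noncomputable def sampleRounds (k : ℝ) (H : FinHypergraph n) (u : Coins n L T) (d τ : ℕ) :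
    Setoid (Fin n) := rounds k T (sampleLevels k H u d) (fun τ => sample H u d τ) τ

/-- The strong components at the thresholds which belong to the sampling rates. -/
noncomputable def trueLevels (k : ℝ) (L : ℕ) (H : FinHypergraph n) : ℕ → Setoid (Fin n) :=
  strongLevels H fun d => k / 2 / rate L d

/-- The weight of `e`, if its sampling rate is determined by the partitions `Q`. -/
noncomputable def sampleWeight (H : FinHypergraph n) (u : Coins n L T) (Q : ℕ → Setoid (Fin n))
    (e : Hyperedge n) : ℝ :=
  if e ∈ sample H u (cutLevel Q L e) (T + 1) ∧ Cuts ⊥ e then 1 / rate L (cutLevel Q L e) else 0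

/-- Some cut is not preserved on the strong components of step `d`. -/
def CutError (ε k : ℝ) (H : FinHypergraph n) (u : Coins n L T) (d : ℕ) : Prop :=
  (∀ i ≤ L, sampleLevels k H u i ≤ trueLevels k L H i) ∧ ∃ S,
    ε * crossWeight (H.filter fun e => ¬ Cuts (trueLevels k L H d) e)
        (fun e => rate L (cutLevel (trueLevels k L H) L e)) S <
      |∑ e ∈ (H.filter fun e => ¬ Cuts (trueLevels k L H d) e).filter (Crosses S),
          rate L (cutLevel (trueLevels k L H) L e) * sampleWeight H u (sampleLevels k H u) e -
        crossWeight (H.filter fun e => ¬ Cuts (trueLevels k L H d) e)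
          (fun e => rate L (cutLevel (trueLevels k L H) L e)) S|

/-- The samples are typical. -/
structure GoodSamples (ε k : ℝ) (H : FinHypergraph n) (u : Coins n L T) : Prop where
  rounds : ∀ d ≤ L, ∀ τ ≤ T, Concentrated (1 / (40 * T)) k (rate L d) H (sample H u d τ)
    (sampleRounds k H u d τ)
  next : ∀ d ≤ L, ∀ τ ≤ T, Concentrated (1 / (40 * T)) k (rate L d) H (sample H u d (τ + 1))
    (sampleRounds k H u d τ)
  base : ∀ d ≤ L, ∀ τ ≤ T + 1, Concentrated (1 / (40 * T)) k (rate L d) H (sample H u d τ)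
    (sampleLevels k H u d)
  strong : ∀ d ≤ L, ∀ τ ≤ T + 1, Concentrated (1 / (40 * T)) k (rate L d) H (sample H u d τ)
    (trueLevels k L H (d + 1))
  cuts : ∀ d ≤ L, ¬ CutError ε k H u d

theorem sampleLevels_congr {k : ℝ} {H : FinHypergraph n} {u u' : Coins n L T} {d : ℕ}
    (h : ∀ i < d, ∀ t < T, sample H u i t = sample H u' i t) :
    sampleLevels k H u d = sampleLevels k H u' d :=
  levels_congr k T fun i hi t ht => by rw [h i hi t ht]

theorem sampleLevels_piecewise (k : ℝ) (H : FinHypergraph n) (u u' : Coins n L T) {d τ : ℕ}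
    (hd : d ≤ L) (hτ : τ ≤ T + 1) :
    sampleLevels k H ((roundCoins n L T d τ).piecewise u' u) d = sampleLevels k H u d :=
  sampleLevels_congr fun i hi t ht =>
    sample_piecewise_of_ne H u u' hd (by omega) hτ (by omega) (Or.inl (by omega))

/-- The partition before round `τ` uses only earlier coins, so sample `τ` is fresh for it. Allowing
`t < τ` serves the comparison of two consecutive samples on the same partition. -/
theorem sampleRounds_piecewise (k : ℝ) (H : FinHypergraph n) (u u' : Coins n L T) {d τ t : ℕ}
    (hd : d ≤ L) (hτ : τ ≤ T + 1) (ht : t ≤ τ) :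
    sampleRounds k H ((roundCoins n L T d τ).piecewise u' u) d t = sampleRounds k H u d t := by
  unfold sampleRounds
  rw [sampleLevels_piecewise k H u u' hd hτ]
  refine rounds_congr k T _ fun s hs => ?_
  rw [sample_piecewise_of_ne H u u' hd hd hτ (by omega) (Or.inr (by omega))]

/-- The random numbers of the last round. -/
def lastCoins (n L T : ℕ) : Set (Fin (L + 1) × Fin (T + 2) × Hyperedge n) :=
  {c | c.2.1 = Fin.ofNat (T + 2) (T + 1)}

theorem sampleLevels_piecewise_last (k : ℝ) (H : FinHypergraph n) (u u' : Coins n L T) :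
    sampleLevels k H ((lastCoins n L T).piecewise u' u) = sampleLevels k H u := by
  funext d
  refine sampleLevels_congr fun i _ t ht => ?_
  unfold sample
  congr 1
  funext e
  rw [Set.piecewise_eq_of_notMem]
  exact fun h => ofNat_ne (N := T + 1) (by omega) le_rfl (by omega) h

theorem sample_piecewise_last (H : FinHypergraph n) (u u' : Coins n L T) (d : ℕ) :
    sample H ((lastCoins n L T).piecewise u' u) d (T + 1) = sample H u' d (T + 1) := by
  unfold sample
  congr 1
  funext e
  rw [Set.piecewise_eq_of_mem]
  exact rfl

theorem trueLevels_mono (k : ℝ) (L : ℕ) (H : FinHypergraph n) : Monotone (trueLevels k L H) :=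
  strongLevels_mono _ _

/-- Finer partitions cut a hyperedge for longer, so merging too little only raises the sampling
rate. -/
theorem cutLevel_mono {P Q : ℕ → Setoid (Fin n)} (h : ∀ i ≤ L, Q i ≤ P i) {e : Hyperedge n}
    (h0 : Cuts (P 0) e) : cutLevel P L e ≤ cutLevel Q L e :=
  le_cutLevel (cutLevel_le _ _ _)
    ((cuts_cutLevel (Nat.zero_le L) h0).mono (h _ (cutLevel_le _ _ _)))

/-- Given all coins but those of the last round, the partitions are fixed and the weights
independent. If the found levels do not refine the true ones, `CutError` is false by its first
clause. -/
theorem prob_cutError_le (hn : 1 ≤ n) {ε k Λ : ℝ} (hε : 0 < ε) (hε1 : ε ≤ 1) (hk : 0 < k)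
    (hΛ : 0 ≤ Λ) (hεk : 4 * Real.log n + Λ ≤ ε ^ 2 * (k / 2) / 8) (H : FinHypergraph n) {d : ℕ}
    (hd : d ≤ L) :
    prob (fun u : Coins n L T => CutError ε k H u d) ≤ 2 * n * Real.exp (-Λ) := by
  refine prob_le_of_resample (lastCoins n L T) fun u => ?_
  set P := trueLevels k L H with hP
  set Q := sampleLevels k H u with hQ
  by_cases hle : ∀ i ≤ L, Q i ≤ P i
  · set z : Hyperedge n → Fin (2 ^ L) → ℝ := fun e x =>
      if x.val < 2 ^ cutLevel Q L e ∧ Cuts ⊥ e then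
        rate L (cutLevel P L e) / rate L (cutLevel Q L e) else 0 with hz
    -- Hyperedges with fewer than two vertices are removed: they cross no cut, and their `cutLevel`
    -- is only the default value 0.
    set E := H.filter fun e => ¬ Cuts (P d) e ∧ Cuts ⊥ e with hE
    have hEf : ∀ S, (H.filter fun e => ¬ Cuts (P d) e).filter (Crosses S) =
        E.filter (Crosses S) := by
      intro S
      ext e
      simp only [hE, mem_filter]
      have := fun h => crossing_bot_of_crosses (S := S) (e := e) h
      tauto
    have hz0 : ∀ e x, 0 ≤ z e x := fun e x => by
      have := (rate_pos L (cutLevel P L e)).le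
      have := (rate_pos L (cutLevel Q L e)).le
      simp only [hz]
      positivity
    have hz1 : ∀ e x, z e x ≤ 1 := fun e x => by
      simp only [hz]
      split_ifs with h
      · rw [div_le_one (rate_pos _ _)]
        exact rate_mono (cutLevel_mono hle h.2)
      · exact zero_le_one
    have hmean : ∀ e ∈ E, avg (z e) = rate L (cutLevel P L e) := by
      intro e he
      have hc : Cuts ⊥ e := (mem_filter.1 he).2.2
      have h1 : z e = fun x => rate L (cutLevel P L e) / rate L (cutLevel Q L e) *
          if x.val < 2 ^ cutLevel Q L e then 1 else 0 := by
        funext x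
        simp only [hz, hc, and_true, mul_ite, mul_one, mul_zero]
      rw [h1, avg_const_mul, avg_indicator_lt (cutLevel_le _ _ _)]
      exact div_mul_cancel₀ _ (rate_pos _ _).ne'
    have hstr : ∀ R, R ≤ P d → k / 2 * ((numClasses R : ℝ) - numClasses (P d)) ≤
        ∑ e ∈ crossing R E, rate L (cutLevel P L e) := by
      intro R hR
      refine (strength_le (H := H) (K := k / 2) (by positivity) hd (fun _ => rfl) hR).trans
        (le_of_eq ?_)
      refine sum_congr ?_ fun _ _ => rfl
      ext e
      simp only [mem_between, mem_crossing, hE, mem_filter]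
      have h1 : Cuts R e → Cuts ⊥ e := Cuts.mono bot_le
      change _ ∧ _ ∧ ¬ Cuts (P d) e ↔ _
      tauto
    have hinj : Function.Injective fun e => coin L T (cutLevel Q L e) (T + 1) e := fun _ _ h =>
      (Prod.ext_iff.1 (Prod.ext_iff.1 h).2).2
    have hmain := prob_cut_error_le hn (E := E) (y := fun e => rate L (cutLevel P L e))
      (fun e => rate_pos _ _) (K := k / 2) (by positivity) (P := P d)
      (fun e he => (mem_filter.1 he).2.1) hstr hinj.injOn hz0 hz1 hmean hε hε1 hΛ hεk
    refine le_trans (prob_mono fun u' hu' => ?_) hmain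
    obtain ⟨-, S, hS⟩ := hu'
    refine ⟨S, ?_⟩
    have hcw : crossWeight (H.filter fun e => ¬ Cuts (P d) e)
        (fun e => rate L (cutLevel P L e)) S =
          crossWeight E (fun e => rate L (cutLevel P L e)) S := by
      unfold crossWeight
      rw [hEf]
    rw [hcw, hEf, sampleLevels_piecewise_last] at hS
    refine hS.trans_le (le_of_eq ?_)
    congr 2
    refine sum_congr rfl fun e he => ?_
    have heH : e ∈ H := (mem_filter.1 (mem_filter.1 he).1).1
    simp only [sampleWeight, sample_piecewise_last]
    simp only [sample, mem_filter, heH, true_and, hz, ← hQ]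
    split_ifs <;> ring
  · refine (prob_mono (q := fun _ => False) fun u' hu' => hle ?_).trans ?_
    · have := hu'.1
      rwa [sampleLevels_piecewise_last] at this
    · rw [prob_false]
      positivity

theorem prob_not_goodSamples_le (hn : 1 ≤ n) (hT : 1 ≤ T) {ε k Λ η y : ℝ} (hε : 0 < ε)
    (hε1 : ε ≤ 1) (hk : 0 < k) (hΛ : 0 ≤ Λ)
    (hεk : 4 * Real.log n + Λ ≤ ε ^ 2 * (k / 2) / 8) (hη : 0 < η) (hη1 : η ≤ 1) (hy : 0 ≤ y)
    (hny : (n : ℝ) ^ 2 * y ≤ 1 / 2)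
    (hx : Real.exp (-((1 / (40 * T)) ^ 2 * k / 2)) ≤ η * y) (H : FinHypergraph n) :
    prob (fun u : Coins n L T => ¬ GoodSamples ε k H u) ≤
      (L + 1) * (T + 2) * (32 * η) + (L + 1) * (2 * n * Real.exp (-Λ)) := by
  have hT' : (1 : ℝ) ≤ T := by exact_mod_cast hT
  have hδ : (0 : ℝ) < 1 / (40 * T) := by positivity
  have hδ1 : (1 : ℝ) / (40 * T) ≤ 1 := by
    rw [div_le_one (by positivity)]
    linarith
  set δ : ℝ := 1 / (40 * T) with hδdef
  -- In the second family `c.2 - 1` truncates at `c.2 = 0`; that event is harmless, as `next` is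
  -- read off at `τ + 1`. Four families of probability `8 * η` give the constant 32.
  let ev : ℕ → ℕ × ℕ → Coins n L T → Prop := fun i c u =>
    if i = 0 then ¬ Concentrated δ k (rate L c.1) H (sample H u c.1 c.2) (sampleRounds k H u c.1 c.2)
    else if i = 1 then
      ¬ Concentrated δ k (rate L c.1) H (sample H u c.1 c.2) (sampleRounds k H u c.1 (c.2 - 1))
    else if i = 2 then
      ¬ Concentrated δ k (rate L c.1) H (sample H u c.1 c.2) (sampleLevels k H u c.1)
    else ¬ Concentrated δ k (rate L c.1) H (sample H u c.1 c.2) (trueLevels k L H (c.1 + 1))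
  have hev : ∀ i ∈ range 4, ∀ c ∈ range (L + 1) ×ˢ range (T + 2), prob (ev i c) ≤ 8 * η := by
    rintro i - ⟨d, τ⟩ hc
    simp only [mem_product, mem_range] at hc
    have hd : d ≤ L := by omega
    have hτ : τ ≤ T + 1 := by omega
    have main := fun Q₀ hQ₀ => prob_not_concentrated_le_of_indep (T := T) hδ hδ1 hη hη1 hy hny hx
      hd τ H Q₀ hQ₀
    simp only [ev]
    split_ifs
    · exact main _ fun u u' => sampleRounds_piecewise k H u u' hd hτ le_rfl
    · exact main _ fun u u' => sampleRounds_piecewise k H u u' hd hτ (by omega)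
    · exact main _ fun u u' => sampleLevels_piecewise k H u u' hd hτ
    · exact main _ fun _ _ => rfl
  calc _ ≤ prob (fun u : Coins n L T =>
        (∃ i ∈ range 4, ∃ c ∈ range (L + 1) ×ˢ range (T + 2), ev i c u) ∨
          ∃ d ∈ range (L + 1), CutError ε k H u d) := by
        refine prob_mono fun u hu => ?_
        by_contra hcon
        push Not at hcon
        obtain ⟨h1, h2⟩ := hcon
        have h3 : ∀ i < 4, ∀ d ≤ L, ∀ τ ≤ T + 1, ¬ ev i (d, τ) u := fun i hi d hd τ hτ =>
          h1 i (mem_range.2 hi) (d, τ) (by simp only [mem_product, mem_range]; omega)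
        refine hu ⟨fun d hd τ hτ => ?_, fun d hd τ hτ => ?_, fun d hd τ hτ => ?_,
          fun d hd τ hτ => ?_, fun d hd => h2 d (mem_range.2 (by omega))⟩
        · exact not_not.1 (h3 0 (by norm_num) d hd τ (by omega))
        · exact not_not.1 (h3 1 (by norm_num) d hd (τ + 1) (by omega))
        · exact not_not.1 (h3 2 (by norm_num) d hd τ hτ)
        · exact not_not.1 (h3 3 (by norm_num) d hd τ hτ)
    _ ≤ _ := by
        refine (prob_or_le _ _).trans (add_le_add ?_ ?_)
        · refine (prob_exists_le_card_mul _ _ fun i hi =>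
            prob_exists_le_card_mul _ _ (hev i hi)).trans (le_of_eq ?_)
          rw [card_product, card_range, card_range, card_range]
          push_cast
          ring
        · refine (prob_exists_le_card_mul _ _ fun d hd =>
            prob_cutError_le hn hε hε1 hk hΛ hεk H ?_).trans (le_of_eq ?_)
          · have := mem_range.1 hd
            omega
          · rw [card_range]
            push_cast
            ring

namespace GoodSamples

variable {ε k : ℝ} {H : FinHypergraph n} {u : Coins n L T}

/-- The true level `d + 1` is sparse at `k / 2 / rate L d`, half of the smallest threshold used at
that rate, so no round merges beyond it. -/
theorem le_trueLevels (h : GoodSamples ε k H u) (hT : 1 ≤ T) (hk : 0 < k) {d : ℕ} (hd : d ≤ L) :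
    sampleLevels k H u d ≤ trueLevels k L H d := by
  have hT' : (1 : ℝ) ≤ T := by exact_mod_cast hT
  have hδ1 : (1 : ℝ) / (40 * T) ≤ 1 / 40 := by
    gcongr
    linarith
  induction d with
  | zero => exact le_rfl
  | succ d ih =>
    refine rounds_le hδ1 hk (rate_pos L d) ?_ (sparse_strongLevels H _ d) T fun t ht =>
      h.strong d (by omega) t (by omega)
    exact (ih (by omega)).trans (trueLevels_mono k L H (Nat.le_succ d))

/-- For `d = 0` any proper coarsening loses a class and `H` has at most `1 / rate L 0` hyperedges.
Afterwards the bound `3 * k / p` of `sparse_rounds` reads `6 * k / (2 * p)` at the doubled rate. -/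
theorem sparse (h : GoodSamples ε k H u) (hT : 1 ≤ T) (hnT : n < 2 ^ T) (hk : 1 ≤ k)
    (hH : H.card ≤ 2 ^ L) {d : ℕ} (hd : d ≤ L) :
    Sparse (6 * k / rate L d) H (sampleLevels k H u d) := by
  rcases d with _ | d
  · intro R hR
    change ((between ⊥ R H).card : ℝ) ≤ _ * ((numClasses ⊥ : ℝ) - numClasses R)
    by_cases hbot : ⊥ = R
    · subst hbot
      have : between ⊥ ⊥ H = ∅ := by
        ext e
        simp [mem_between]
      simp [this]
    · have h1 : (1 : ℝ) ≤ (numClasses (⊥ : Setoid (Fin n)) : ℝ) - numClasses R := by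
        have : (numClasses R : ℝ) + 1 ≤ numClasses (⊥ : Setoid (Fin n)) := by
          exact_mod_cast numClasses_lt bot_le hbot
        linarith
      have h2 : ((between ⊥ R H).card : ℝ) ≤ 2 ^ L := by
        exact_mod_cast (card_le_card (filter_subset _ _)).trans hH
      have h3 : 6 * k / rate L 0 = 6 * k * 2 ^ L := by
        rw [rate, pow_zero, div_div_eq_mul_div, div_one]
      rw [h3]
      have h4 : (0 : ℝ) < 2 ^ L := by positivity
      calc _ ≤ (2 : ℝ) ^ L := h2
        _ ≤ 6 * k * 2 ^ L := by nlinarith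
        _ ≤ _ := le_mul_of_one_le_right (by positivity) h1
  · have h1 := sparse_rounds (g := fun τ => sample H u d τ) (Q := sampleLevels k H u d) hT hnT
      (by linarith) (rate_pos L d) (fun τ hτ => h.rounds d (by omega) τ hτ)
      (fun τ hτ => h.next d (by omega) τ hτ.le)
    have h2 : 6 * k / rate L (d + 1) = 3 * k / rate L d := by
      rw [rate_succ]
      have := (rate_pos L d).ne'
      field_simp
      norm_num
    rw [h2]
    exact h1

theorem isCandidate (h : GoodSamples ε k H u) (hT : 1 ≤ T) (hnT : n < 2 ^ T) (hk : 1 ≤ k)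
    (hH : H.card ≤ 2 ^ L) {r : ℕ} (hr : ∀ e ∈ H, e.card ≤ r) {d τ : ℕ} (hd : d ≤ L)
    (hτ : τ ≤ T + 1) :
    IsCandidate r (8 * k) (sampleLevels k H u d)
      (crossing (sampleLevels k H u d) (sample H u d τ)) := by
  have hT' : (1 : ℝ) ≤ T := by exact_mod_cast hT
  have hδ : (0 : ℝ) < 1 / (40 * T) := by positivity
  have hδ1 : (1 : ℝ) / (40 * T) ≤ 1 / 40 := by
    gcongr
    linarith
  refine ⟨fun e he => (mem_crossing.1 he).2, fun e he => ?_, fun R hR => ?_⟩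
  · exact hr e (mem_filter.1 (mem_crossing.1 he).1).1
  · have h1 := (h.base d hd τ hτ).sparse hδ1 (by linarith) (rate_pos L d)
      (h.sparse hT hnT hk hH hd) R hR
    refine le_trans (le_of_eq ?_) h1
    congr 2
    ext e
    simp only [mem_between, mem_crossing]
    tauto

theorem isSparsifier (h : GoodSamples ε k H u) (hT : 1 ≤ T) (hk : 0 < k) (hε : 0 ≤ ε) :
    IsSparsifier ε H (sampleWeight H u (sampleLevels k H u)) := by
  refine isSparsifier_of_levels (P := trueLevels k L H) (trueLevels_mono k L H) rfl (L := L) hε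
    (fun e => ?_) (fun e he => ?_) (fun e he hc hL => ?_) (fun d _ hd S => ?_)
  · unfold sampleWeight
    have := (rate_pos L (cutLevel (sampleLevels k H u) L e)).le
    positivity
  · unfold sampleWeight at he
    have := (ite_ne_right_iff.1 he).1.1
    exact (mem_filter.1 this).1
  · have h1 : L ≤ cutLevel (sampleLevels k H u) L e :=
      hL.ge.trans (cutLevel_mono (fun i hi => h.le_trueLevels hT hk hi) hc)
    have h2 := le_antisymm (cutLevel_le (sampleLevels k H u) L e) h1
    -- At level `L` the rate is 1: every coin lies below `2 ^ L`.
    rw [sampleWeight, h2, if_pos ⟨mem_filter.2 ⟨he, Fin.isLt _⟩, hc⟩, rate]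
    field_simp
  · by_contra hc
    exact h.cuts d hd ⟨fun i hi => h.le_trueLevels hT hk hi, S, not_le.1 hc⟩

end GoodSamples

end GoodSamples

/-! ### A fixed list of seeds for all hypergraphs. -/

section Derandomization

/-- If every test fails with small probability, there are seeds among which every test fails
rarely. -/
theorem exists_seeds {Ω I : Type*} [Fintype Ω] [Nonempty Ω] [Fintype I] (bad : I → Ω → Prop)
    {N t : ℕ} {δ : ℝ} (hbad : ∀ i, prob (bad i) ≤ δ)
    (ht : (Fintype.card I : ℝ) * (1 + δ) ^ N < 2 ^ t) :
    ∃ ω : Fin N → Ω, ∀ i, (univ.filter fun R => bad i (ω R)).card < t := by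
  by_contra! hcon
  have h1 : ∀ i (ω : Fin N → Ω), ∏ R, (if bad i (ω R) then (2 : ℝ) else 1) =
      2 ^ (univ.filter fun R => bad i (ω R)).card := by
    intro i ω
    rw [prod_ite, prod_const, prod_const_one, mul_one]
  have h2 : ∀ i, avg (fun x => if bad i x then (2 : ℝ) else 1) ≤ 1 + δ := by
    intro i
    have : ∀ x, (if bad i x then (2 : ℝ) else 1) = 1 + if bad i x then 1 else 0 := by
      intro x
      split_ifs <;> norm_num
    simp only [this]
    rw [avg_add, avg_const]
    exact add_le_add_right (hbad i) 1
  -- Each bad seed doubles the weight of its test. If every list had a test with `t` bad seeds, the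
  -- mean total weight would be at least `2 ^ t`, but independence bounds it by `card I * (1 + δ) ^
  -- N`.
  have h3 : (2 : ℝ) ^ t ≤ avg fun ω : Fin N → Ω => ∑ i, ∏ R, if bad i (ω R) then (2 : ℝ) else 1 := by
    rw [← avg_const (Ω := Fin N → Ω) ((2 : ℝ) ^ t)]
    refine avg_mono fun ω => ?_
    obtain ⟨i, hi⟩ := hcon ω
    calc (2 : ℝ) ^ t ≤ 2 ^ (univ.filter fun R => bad i (ω R)).card :=
          pow_le_pow_right₀ (by norm_num) hi
      _ = ∏ R, (if bad i (ω R) then (2 : ℝ) else 1) := (h1 i ω).symm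
      _ ≤ _ := single_le_sum (f := fun i => ∏ R, if bad i (ω R) then (2 : ℝ) else 1)
        (fun i _ => prod_nonneg fun R _ => by positivity) (mem_univ i)
  rw [avg_sum] at h3
  have h4 : ∑ i, avg (fun ω : Fin N → Ω => ∏ R, if bad i (ω R) then (2 : ℝ) else 1) ≤
      Fintype.card I * (1 + δ) ^ N := by
    rw [← nsmul_eq_mul, ← card_univ]
    refine sum_le_card_nsmul _ _ _ fun i _ => ?_
    rw [avg_prod_pi fun _ x => if bad i x then (2 : ℝ) else 1, prod_const, card_univ,
      Fintype.card_fin]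
    exact pow_le_pow_left₀ (avg_nonneg fun x => by positivity) (h2 i) N
  linarith

end Derandomization

/-! ### The sketch and its recovery map. -/

section Algorithm

variable {n L T B : ℕ}

/-- The random labels of all measurements. -/
abbrev AllLabels (n L T B : ℕ) := Fin (L + 1) × Fin (T + 2) → Labels n B

/-- The measurements of all samples. -/
abbrev Measurements (n L T B : ℕ) := Fin (L + 1) × Fin (T + 2) → Fin n → Fin B → ZMod 2

/-- The index of a sample. -/
def sampleIndex (L T d τ : ℕ) : Fin (L + 1) × Fin (T + 2) :=
  (Fin.ofNat (L + 1) d, Fin.ofNat (T + 2) τ)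

/-- The sample recovered from its measurements and a partition outside of which it is sparse. -/
noncomputable def decodedSample (r : ℕ) (k : ℝ) (a : AllLabels n L T B) (Y : Measurements n L T B)
    (d : ℕ) (Q : Setoid (Fin n)) (τ : ℕ) : FinHypergraph n :=
  decode r (8 * k) Q (a (sampleIndex L T d τ)) (Y (sampleIndex L T d τ))

/-- The partitions found from the measurements. -/
noncomputable def decodedLevels (r : ℕ) (k : ℝ) (a : AllLabels n L T B)
    (Y : Measurements n L T B) : ℕ → Setoid (Fin n) := levels k T (decodedSample r k a Y)

/-- The recovered weights. -/
noncomputable def recoverWeight (r : ℕ) (k : ℝ) (a : AllLabels n L T B)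
    (Y : Measurements n L T B) (e : Hyperedge n) : ℝ :=
  if e ∈ decodedSample r k a Y (cutLevel (decodedLevels r k a Y) L e)
    (decodedLevels r k a Y (cutLevel (decodedLevels r k a Y) L e)) (T + 1) then
    1 / rate L (cutLevel (decodedLevels r k a Y) L e) else 0

/-- The measurements `Y` are those of the samples of `H`. -/
def IsMeasurement (H : FinHypergraph n) (u : Coins n L T) (a : AllLabels n L T B)
    (Y : Measurements n L T B) : Prop :=
  ∀ d ≤ L, ∀ τ ≤ T + 1,
    Y (sampleIndex L T d τ) = measurement (a (sampleIndex L T d τ)) (sample H u d τ)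

/-- Some sample is not determined by its measurements. -/
def Ambiguous (r : ℕ) (k : ℝ) (H : FinHypergraph n) (u : Coins n L T) (a : AllLabels n L T B)
    (d τ : ℕ) : Prop :=
  IsCandidate r (8 * k) (sampleLevels k H u d)
      (crossing (sampleLevels k H u d) (sample H u d τ)) ∧
    ∃ F', IsCandidate r (8 * k) (sampleLevels k H u d) F' ∧
      F' ≠ crossing (sampleLevels k H u d) (sample H u d τ) ∧
      ∀ w, classSum (sampleLevels k H u d) (measurement (a (sampleIndex L T d τ)) F') w =
        classSum (sampleLevels k H u d) (measurement (a (sampleIndex L T d τ))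
          (crossing (sampleLevels k H u d) (sample H u d τ))) w

theorem cutLevel_congr {P Q : ℕ → Setoid (Fin n)} {L : ℕ} (h : ∀ d ≤ L, P d = Q d)
    (e : Hyperedge n) : cutLevel P L e = cutLevel Q L e := by
  unfold cutLevel
  induction L with
  | zero => rfl
  | succ L ih =>
    rw [Nat.findGreatest_succ, Nat.findGreatest_succ, h (L + 1) le_rfl,
      ih fun d hd => h d (by omega)]

/-- As long as the partition is the one found from exact samples, decoding returns exactly the cut
part of each sample, and the next partition depends on nothing else. -/
theorem recoverWeight_eq {r : ℕ} {k ε : ℝ} {H : FinHypergraph n} {u : Coins n L T}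
    {a : AllLabels n L T B} {Y : Measurements n L T B} (hgood : GoodSamples ε k H u) (hT : 1 ≤ T)
    (hnT : n < 2 ^ T) (hk : 1 ≤ k) (hH : H.card ≤ 2 ^ L) (hr : ∀ e ∈ H, e.card ≤ r)
    (hamb : ∀ d ≤ L, ∀ τ ≤ T + 1, ¬ Ambiguous r k H u a d τ) (hY : IsMeasurement H u a Y) :
    recoverWeight r k a Y = sampleWeight H u (sampleLevels k H u) := by
  have hdec : ∀ d ≤ L, ∀ τ ≤ T + 1, decodedSample r k a Y d (sampleLevels k H u d) τ =
      crossing (sampleLevels k H u d) (sample H u d τ) := by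
    intro d hd τ hτ
    have hc := hgood.isCandidate hT hnT hk hH hr hd hτ
    rw [decodedSample, hY d hd τ hτ]
    exact decode_eq hc fun h => hamb d hd τ hτ ⟨hc, h⟩
  have hlev : ∀ d ≤ L, decodedLevels r k a Y d = sampleLevels k H u d := by
    intro d hd
    refine (levels_congr k T fun i hi t ht => ?_).symm
    have h1 := hdec i (by omega) t (by omega)
    unfold sampleLevels at h1
    rw [h1, crossing_crossing le_rfl]
  funext e
  rw [recoverWeight, cutLevel_congr hlev e, hlev _ (cutLevel_le _ _ _),
    hdec _ (cutLevel_le _ _ _) _ le_rfl, sampleWeight]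
  refine if_congr ?_ rfl rfl
  rw [mem_crossing]
  refine and_congr_right fun _ => ⟨fun h => h.mono bot_le, fun h => ?_⟩
  exact cuts_cutLevel (P := sampleLevels k H u) (Nat.zero_le L) h

/-- `Ambiguous` refers to the partitions of the exact samples, which do not involve the labels. For
fixed coins the labels are therefore fresh, although the decoder is adaptive. -/
theorem prob_ambiguous_exists_le {r q : ℕ} {k η : ℝ} (hq : 8 * k ≤ q) (hη : 0 < η) (hη1 : η ≤ 1)
    (hB : (n : ℝ) ^ 2 * ((((n + 1) ^ r + 1) ^ q : ℕ) * (1 / 2) ^ B) ≤ η / 2)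
    (H : FinHypergraph n) (u : Coins n L T) :
    prob (fun a : AllLabels n L T B =>
      ∃ c ∈ range (L + 1) ×ˢ range (T + 2), Ambiguous r k H u a c.1 c.2) ≤
        (L + 1) * (T + 2) * (2 * η) := by
  refine (prob_exists_le_card_mul _ _ (δ := 2 * η) fun c _ => ?_).trans (le_of_eq ?_)
  · by_cases hc : IsCandidate r (8 * k) (sampleLevels k H u c.1)
      (crossing (sampleLevels k H u c.1) (sample H u c.1 c.2))
    · refine le_trans (le_trans (prob_mono fun a ha => ha.2) (prob_eval (sampleIndex L T c.1 c.2)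
        fun a : Labels n B => ∃ F', IsCandidate r (8 * k) (sampleLevels k H u c.1) F' ∧
          F' ≠ crossing (sampleLevels k H u c.1) (sample H u c.1 c.2) ∧
          ∀ w, classSum (sampleLevels k H u c.1) (measurement a F') w =
            classSum (sampleLevels k H u c.1) (measurement a
              (crossing (sampleLevels k H u c.1) (sample H u c.1 c.2))) w).le) ?_
      exact prob_ambiguous_le hq hη hη1 hB hc
    · refine (prob_mono (q := fun _ => False) fun a ha => hc ha.1).trans ?_
      rw [prob_false]
      positivity
  · rw [card_product, card_range, card_range]
    push_cast
    ring

/-- The rows of the sketching matrix. -/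
abbrev Row (n L T B : ℕ) := (Fin (L + 1) × Fin (T + 2)) × Fin n × Fin B

/-- The linear sketch whose seeds are indices of a list of random choices. -/
noncomputable def hypergraphSketch (r : ℕ) (k : ℝ) {N : ℕ}
    (ω : Fin N → Coins n L T × AllLabels n L T B) : LinearSketch n where
  Seed := Fin N
  modulus := 2
  modulus_ne_zero := inferInstance
  size := Fintype.card (Row n L T B)
  matrix R := Matrix.of fun i e =>
    let c := (Fintype.equivFin (Row n L T B)).symm i
    if ((ω R).1 (c.1.1, c.1.2, e)).val < 2 ^ c.1.1.val then
      incidence ((ω R).2 c.1) e c.2.1 c.2.2 else 0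
  recover R y := recoverWeight r k (ω R).2 fun c v b => y (Fintype.equivFin _ (c, v, b))

theorem isMeasurement_sketch (r : ℕ) (k : ℝ) {N : ℕ}
    (ω : Fin N → Coins n L T × AllLabels n L T B) (R : Fin N) (H : FinHypergraph n) :
    IsMeasurement H (ω R).1 (ω R).2 fun c v b =>
      (hypergraphSketch r k ω).sketch R (fun e => if e ∈ H then 1 else 0)
        (Fintype.equivFin _ (c, v, b)) := by
  intro d hd τ hτ
  funext v b
  have hval : (Fin.ofNat (L + 1) d).val = d := by
    rw [Fin.val_ofNat, Nat.mod_eq_of_lt (by omega)]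
  have h1 : (hypergraphSketch r k ω).sketch R (fun e => if e ∈ H then 1 else 0)
      (Fintype.equivFin (Row n L T B) (sampleIndex L T d τ, v, b)) =
      ∑ e, (if ((ω R).1 (coin L T d τ e)).val < 2 ^ (Fin.ofNat (L + 1) d).val then
        incidence ((ω R).2 (sampleIndex L T d τ)) e v b else 0) *
          (((if e ∈ H then 1 else 0 : ℤ)) : ZMod 2) := by
    change ∑ e, (if ((ω R).1 _).val < 2 ^ _ then incidence _ e _ _ else 0) *
      (((if e ∈ H then 1 else 0 : ℤ)) : ZMod 2) = _
    simp only [Equiv.symm_apply_apply]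
    rfl
  change (hypergraphSketch r k ω).sketch R (fun e => if e ∈ H then 1 else 0)
    (Fintype.equivFin (Row n L T B) (sampleIndex L T d τ, v, b)) = _
  rw [h1, hval, measurement, Finset.sum_apply]
  have h2 : sample H (ω R).1 d τ = univ.filter fun e =>
      ((ω R).1 (coin L T d τ e)).val < 2 ^ d ∧ e ∈ H := by
    ext e
    simp [sample, and_comm]
  rw [h2, sum_filter]
  refine sum_congr rfl fun e _ => ?_
  by_cases h3 : ((ω R).1 (coin L T d τ e)).val < 2 ^ d <;> by_cases h4 : e ∈ H <;>
    (simp [h3, h4]; try rfl)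

end Algorithm

/-! ### Linearity over the stream. -/

section Streaming

variable {n : ℕ}

theorem sketch_add (S : LinearSketch n) (R : S.Seed) (x y : Hyperedge n → ℤ) :
    S.sketch R (x + y) = S.sketch R x + S.sketch R y := by
  rw [LinearSketch.sketch, LinearSketch.sketch, LinearSketch.sketch, ← Matrix.mulVec_add]
  congr 1
  funext e
  simp

theorem sketch_zsmul (S : LinearSketch n) (R : S.Seed) (c : ℤ)
    (x : Hyperedge n → ℤ) : c • S.sketch R x = S.sketch R (c • x) := by
  induction c using Int.induction_on with
  | zero =>
    have := sketch_add S R 0 0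
    rw [add_zero, left_eq_add] at this
    rw [zero_smul, zero_smul, this]
  | succ i ih => rw [add_smul, add_smul, one_smul, one_smul, sketch_add, ih]
  | pred i ih =>
    rw [sub_smul, one_smul, ih, sub_eq_iff_eq_add, ← sketch_add]
    congr 1
    rw [sub_smul, one_smul, sub_add_cancel]

theorem foldl_update (S : LinearSketch n) (A : Finset S.Seed) (R : A) (σ : List (StreamUpdate n))
    (y : Fin S.size → ZMod S.modulus) :
    σ.foldl (dynamicHypergraphSparsification S A).update (R, y) =
      (R, y + S.sketch R (netMultiplicity σ)) := by
  induction σ generalizing y with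
  | nil =>
    have h := sketch_add S R.1 0 0
    have h0 : netMultiplicity ([] : List (StreamUpdate n)) = 0 := rfl
    simp only [add_zero, left_eq_add] at h
    rw [h0, h, add_zero]
    rfl
  | cons x σ ih =>
    rw [List.foldl_cons]
    refine (ih _).trans (Prod.ext rfl ?_)
    change y + (x.2 : ℤ) • S.sketch R.1 (Pi.single x.1 1) + _ = _
    rw [sketch_zsmul, add_assoc, ← sketch_add]
    congr 2
    funext e
    simp only [netMultiplicity, Pi.add_apply, Pi.smul_apply, smul_eq_mul, List.map_cons,
      List.sum_cons, Pi.single_apply, mul_ite, mul_one, mul_zero, eq_comm]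

theorem run_eq (S : LinearSketch n) (A : Finset S.Seed) (R : A) {σ : List (StreamUpdate n)}
    {H : FinHypergraph n} (hσ : ResultsIn σ H) :
    (dynamicHypergraphSparsification S A).run R σ =
      S.recover R (S.sketch R fun e => if e ∈ H then 1 else 0) := by
  unfold StreamingAlgorithm.run
  change S.recover (σ.foldl (dynamicHypergraphSparsification S A).update (R, S.sketch R 0)).1
    (σ.foldl (dynamicHypergraphSparsification S A).update (R, S.sketch R 0)).2 = _
  rw [foldl_update]
  change S.recover R (S.sketch R 0 + _) = _
  rw [← sketch_add, zero_add, show netMultiplicity σ = _ from funext hσ]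

theorem successProb_ge (S : LinearSketch n) [Fintype S.Seed] [Nonempty S.Seed] {ε δ : ℝ}
    {σ : List (StreamUpdate n)} {H : FinHypergraph n} (hσ : ResultsIn σ H)
    (hbad : ((univ.filter fun R : S.Seed => ¬ IsSparsifier ε H
      (S.recover R (S.sketch R fun e => if e ∈ H then 1 else 0))).card : ℝ) ≤
        δ * Fintype.card S.Seed) :
    1 - δ ≤ (dynamicHypergraphSparsification S univ).successProb ε σ H := by
  let good : Set (univ : Finset S.Seed) :=
    {R | IsSparsifier ε H ((dynamicHypergraphSparsification S univ).run R σ)}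
  have hcard : Nat.card (univ : Finset S.Seed) = Fintype.card S.Seed := by simp
  have h1 := Set.ncard_add_ncard_compl good
  have h2 : goodᶜ.ncard ≤ (univ.filter fun R : S.Seed => ¬ IsSparsifier ε H
      (S.recover R (S.sketch R fun e => if e ∈ H then 1 else 0))).card := by
    rw [← Set.ncard_coe_finset]
    refine Set.ncard_le_ncard_of_injOn (fun R => R.1) (fun R hR => ?_)
      (fun R _ R' _ h => Subtype.ext h)
    have hR' : ¬ IsSparsifier ε H ((dynamicHypergraphSparsification S univ).run R σ) := hR
    rw [run_eq S univ R hσ] at hR'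
    simpa using hR'
  have hpos : (0 : ℝ) < Fintype.card S.Seed := by exact_mod_cast Fintype.card_pos
  change 1 - δ ≤ (good.ncard : ℝ) / (Nat.card (univ : Finset S.Seed) : ℝ)
  rw [hcard] at h1 ⊢
  rw [le_div_iff₀ hpos, sub_mul, one_mul]
  have h3 : (good.ncard : ℝ) + goodᶜ.ncard = Fintype.card S.Seed := by exact_mod_cast h1
  have h4 : (goodᶜ.ncard : ℝ) ≤ (univ.filter fun R : S.Seed => ¬ IsSparsifier ε H
      (S.recover R (S.sketch R fun e => if e ∈ H then 1 else 0))).card := by exact_mod_cast h2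
  linarith

end Streaming

/-! ### Choice of parameters, failure probability and space. -/

section Parameters

variable {n L B : ℕ}

theorem exp_neg_natCast_le (a : ℕ) : Real.exp (-(a : ℝ)) ≤ (1 / 2) ^ a := by
  have h : Real.exp (-1) ≤ 1 / 2 := by
    rw [Real.exp_neg, ← one_div]
    refine one_div_le_one_div_of_le (by norm_num) ?_
    linarith [Real.add_one_le_exp (1 : ℝ)]
  calc Real.exp (-(a : ℝ)) = Real.exp (-1) ^ a := by
        rw [← Real.exp_nat_mul, mul_neg, mul_one]
    _ ≤ _ := pow_le_pow_left₀ (Real.exp_pos _).le h a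

theorem add_two_le_two_pow {l : ℕ} (hl : 2 ≤ l) : l + 2 ≤ 2 ^ l := by
  induction l, hl using Nat.le_induction with
  | base => norm_num
  | succ l hl ih =>
    rw [pow_succ]
    omega

/-- With polylogarithmically many samples and measurements the algorithm fails on a given
hypergraph with probability at most `1 / (8 * n ^ 6)`. -/
theorem prob_failure_le {l r q : ℕ} {ε k : ℝ} (hn : 1 ≤ n) (hl : 2 ≤ l)
    (hnl : n * (L + 1) < 2 ^ l) (hε : 0 < ε) (hε1 : ε ≤ 1) (hk : k = 64000 * (l : ℝ) ^ 3 / ε ^ 2)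
    (hq : 8 * k ≤ q) (hB : B = l * (r + 1) * q + 19 * l) (H : FinHypergraph n) :
    prob (fun ω : Coins n L l × AllLabels n L l B => ¬ GoodSamples ε k H ω.1 ∨
      ∃ c ∈ range (L + 1) ×ˢ range (l + 2), Ambiguous r k H ω.1 ω.2 c.1 c.2) ≤
        1 / (8 * (n : ℝ) ^ 6) := by
  have hl' : (2 : ℝ) ≤ l := by exact_mod_cast hl
  have hε2 : ε ^ 2 ≤ 1 := pow_le_one₀ hε.le hε1
  have hk0 : 0 < k := by rw [hk]; positivity
  have hkε : ε ^ 2 * k = 64000 * (l : ℝ) ^ 3 := by rw [hk]; field_simp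
  have hn' : (1 : ℝ) ≤ n := by exact_mod_cast hn
  obtain ⟨X, hX⟩ : ∃ X : ℝ, X = 2 ^ l := ⟨_, rfl⟩
  have hZ : ∀ a, (1 / 2 : ℝ) ^ (a * l) = (1 / X) ^ a := by
    intro a
    rw [mul_comm, pow_mul, hX, div_pow, one_pow]
  have hX4 : (4 : ℝ) ≤ X := by
    rw [hX]
    calc (4 : ℝ) = 2 ^ 2 := by norm_num
      _ ≤ 2 ^ l := pow_le_pow_right₀ (by norm_num) hl
  have hX0 : 0 < X := by linarith
  have hnX : (n : ℝ) + 1 ≤ X := by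
    rw [hX]
    have : n + 1 ≤ 2 ^ l := (Nat.le_mul_of_pos_right n (Nat.succ_pos L)).trans_lt hnl
    exact_mod_cast this
  have hLX : (L : ℝ) + 1 ≤ X := by
    rw [hX]
    have : L + 1 ≤ 2 ^ l := (Nat.le_mul_of_pos_left (L + 1) hn).trans hnl.le
    exact_mod_cast this
  have hlX : (l : ℝ) + 2 ≤ X := by
    rw [hX]
    exact_mod_cast add_two_le_two_pow hl
  have hη : (0 : ℝ) < (1 / X) ^ 16 := by positivity
  have hη1 : (1 / X) ^ 16 ≤ (1 : ℝ) := by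
    refine pow_le_one₀ (by positivity) ?_
    rw [div_le_one hX0]
    linarith
  -- Failures are measured in powers of `X = 2 ^ l`, which dominates `n`, `L` and `l`. Accuracy `1 /
  -- (40 * l)` uses up two of the three factors `l` in `k` and leaves the exponent `20 * l / ε ^ 2`,
  -- enough for `η * y`.
  have hgood := prob_not_goodSamples_le (L := L) (T := l) (n := n) hn (by omega) hε hε1 hk0
    (Λ := ((16 * l : ℕ) : ℝ)) (η := (1 / X) ^ 16) (y := 1 / (2 * X ^ 2)) (by positivity)
    (by
      have h1 : Real.log n ≤ l := by
        calc Real.log n ≤ Real.log X := Real.log_le_log (by linarith) (by linarith)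
          _ = l * Real.log 2 := by rw [hX, Real.log_pow]
          _ ≤ l * 1 := by
            gcongr
            linarith [Real.log_two_lt_d9]
          _ = l := mul_one _
      have h2 : (l : ℝ) ≤ (l : ℝ) ^ 3 := le_self_pow₀ (by linarith) (by norm_num)
      push_cast
      linarith) hη hη1 (by positivity)
    (by
      have : (n : ℝ) ^ 2 ≤ X ^ 2 := by gcongr; linarith
      rw [mul_one_div, div_le_div_iff₀ (by positivity) (by norm_num)]
      linarith)
    (by
      have h1 : ((20 * l : ℕ) : ℝ) ≤ (1 / (40 * (l : ℝ))) ^ 2 * k / 2 := by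
        have : (1 / (40 * (l : ℝ))) ^ 2 * k / 2 = 20 * l / ε ^ 2 := by
          rw [hk]
          field_simp
          norm_num
        rw [this, le_div_iff₀ (by positivity)]
        push_cast
        exact mul_le_of_le_one_right (by positivity) hε2
      calc Real.exp (-((1 / (40 * (l : ℝ))) ^ 2 * k / 2))
          ≤ Real.exp (-((20 * l : ℕ) : ℝ)) := Real.exp_le_exp.2 (neg_le_neg h1)
        _ ≤ (1 / 2) ^ (20 * l) := exp_neg_natCast_le _
        _ = (1 / X) ^ 18 * (1 / X ^ 2) := by rw [hZ]; ring
        _ ≤ (1 / X) ^ 18 * (1 / 2) := by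
          gcongr
          nlinarith
        _ = _ := by ring) H
  have hamb : ∀ u : Coins n L l, prob (fun a : AllLabels n L l B =>
      ∃ c ∈ range (L + 1) ×ˢ range (l + 2), Ambiguous r k H u a c.1 c.2) ≤
        (L + 1) * (l + 2) * (2 * (1 / X) ^ 16) := by
    refine prob_ambiguous_exists_le hq hη hη1 ?_ H
    have h1 : ((n : ℝ) + 1) ^ r + 1 ≤ X ^ (r + 1) := by
      have h2 : ((n : ℝ) + 1) ^ r ≤ X ^ r := by gcongr
      have h3 : 1 ≤ X ^ r := one_le_pow₀ (by linarith)
      rw [pow_succ]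
      nlinarith
    -- The first part of `B` cancels the number of candidates; of the 19 extra powers, two cancel `n
    -- ^ 2`, sixteen give `η`, and one exceeds the factor 2.
    have h4 : (1 / 2 : ℝ) ^ B = (1 / X) ^ ((r + 1) * q + 19) := by
      rw [← hZ, hB]
      congr 1
      ring
    push_cast
    calc (n : ℝ) ^ 2 * ((((n : ℝ) + 1) ^ r + 1) ^ q * (1 / 2) ^ B)
        ≤ X ^ 2 * ((X ^ (r + 1)) ^ q * (1 / X) ^ ((r + 1) * q + 19)) := by
          rw [h4]
          gcongr
          linarith
      _ = (1 / X) ^ 16 * (1 / X) := by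
          rw [← pow_mul, pow_add (1 / X), one_div_pow X ((r + 1) * q)]
          field_simp
      _ ≤ (1 / X) ^ 16 * (1 / 2) := by
          gcongr
          linarith
      _ = _ := by ring
  have h1 := prob_or_le (fun ω : Coins n L l × AllLabels n L l B => ¬ GoodSamples ε k H ω.1)
    (fun ω => ∃ c ∈ range (L + 1) ×ˢ range (l + 2), Ambiguous r k H ω.1 ω.2 c.1 c.2)
  have h2 := prob_prod_le (p := fun ω : Coins n L l × AllLabels n L l B =>
    ∃ c ∈ range (L + 1) ×ˢ range (l + 2), Ambiguous r k H ω.1 ω.2 c.1 c.2) hamb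
  have h3 := prob_fst (Ω' := AllLabels n L l B)
    (fun u : Coins n L l => ¬ GoodSamples ε k H u)
  have h4 : Real.exp (-((16 * l : ℕ) : ℝ)) ≤ (1 / X) ^ 16 :=
    (exp_neg_natCast_le _).trans_eq (hZ 16)
  have h5 : ((L : ℝ) + 1) * (l + 2) ≤ X * X := by gcongr
  have h6 : ((L : ℝ) + 1) * (2 * n * Real.exp (-((16 * l : ℕ) : ℝ))) ≤
      X * (2 * X * (1 / X) ^ 16) := by
    gcongr
    linarith
  -- The constant is 32 from concentration, 2 from ambiguity and 2 from cut errors.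
  have h7 : 36 * (X * X * (1 / X) ^ 16) ≤ 1 / (8 * X ^ 6) := by
    have h8 : X * X * (1 / X) ^ 16 = 1 / (X ^ 6 * X ^ 8) := by
      field_simp
    have h9 : (288 : ℝ) ≤ X ^ 8 := le_trans (by norm_num) (pow_le_pow_left₀ (by norm_num) hX4 8)
    rw [h8, mul_one_div, div_le_div_iff₀ (by positivity) (by positivity)]
    nlinarith [pow_pos hX0 6]
  have h10 : 1 / (8 * X ^ 6) ≤ 1 / (8 * (n : ℝ) ^ 6) := by
    gcongr
    linarith
  have h11 : ((L : ℝ) + 1) * (l + 2) * (34 * (1 / X) ^ 16) ≤ X * X * (34 * (1 / X) ^ 16) := by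
    gcongr
  linarith

/-- The allowed number `t` of bad seeds is about 8 times the expected one and at least `2 ^ (4 *
n)`, which beats the `2 ^ n` bits describing a hypergraph. -/
theorem card_mul_pow_lt (hn : 1 ≤ n) :
    (Fintype.card (FinHypergraph n) : ℝ) * (1 + 1 / (8 * (n : ℝ) ^ 6)) ^ (2 ^ (10 * n)) <
      2 ^ (2 ^ (10 * n) / n ^ 6) := by
  obtain ⟨t, ht⟩ : ∃ t, t = 2 ^ (10 * n) / n ^ 6 := ⟨_, rfl⟩
  have hn6 : 0 < n ^ 6 := pow_pos hn 6
  have hbig : 2 * 2 ^ n < t := by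
    have h1 : n ^ 6 ≤ 2 ^ (6 * n) := by
      rw [mul_comm, pow_mul]
      exact Nat.pow_le_pow_left n.lt_two_pow_self.le 6
    have h2 : 2 ^ (4 * n) ≤ t := by
      rw [ht, Nat.le_div_iff_mul_le hn6]
      calc 2 ^ (4 * n) * n ^ 6 ≤ 2 ^ (4 * n) * 2 ^ (6 * n) := Nat.mul_le_mul_left _ h1
        _ = 2 ^ (10 * n) := by rw [← pow_add]; congr 1; ring
    refine lt_of_lt_of_le ?_ h2
    rw [← pow_succ']
    exact Nat.pow_lt_pow_right (by norm_num) (by omega)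
  have ht1 : (1 : ℝ) ≤ t := by exact_mod_cast (show 1 ≤ t by omega)
  have hN : ((2 ^ (10 * n) : ℕ) : ℝ) * (1 / (8 * (n : ℝ) ^ 6)) ≤ t / 4 := by
    have h1 : 2 ^ (10 * n) < (t + 1) * n ^ 6 := by
      rw [ht, mul_comm (_ + 1)]
      exact Nat.lt_mul_div_succ _ hn6
    have h2 : ((2 ^ (10 * n) : ℕ) : ℝ) ≤ (t + 1) * (n : ℝ) ^ 6 := by exact_mod_cast h1.le
    have h3 : (0 : ℝ) < (n : ℝ) ^ 6 := by exact_mod_cast hn6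
    rw [mul_one_div, div_le_iff₀ (by positivity)]
    nlinarith
  have hE : (1 + 1 / (8 * (n : ℝ) ^ 6)) ^ (2 ^ (10 * n)) ≤ Real.exp (t / 4) := by
    calc (1 + 1 / (8 * (n : ℝ) ^ 6)) ^ (2 ^ (10 * n))
        ≤ Real.exp (1 / (8 * (n : ℝ) ^ 6)) ^ (2 ^ (10 * n)) := by
          refine pow_le_pow_left₀ (by positivity) ?_ _
          linarith [Real.add_one_le_exp (1 / (8 * (n : ℝ) ^ 6))]
      _ ≤ Real.exp (t / 4) := by
          rw [← Real.exp_nat_mul]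
          exact Real.exp_le_exp.2 hN
  have hE2 : Real.exp (t / 4) ^ 2 ≤ 2 ^ t := by
    have h1 : Real.exp (1 / 2) ≤ 2 := by
      refine le_of_sq_le_sq ?_ (by norm_num)
      rw [← Real.exp_nat_mul]
      norm_num
      linarith [Real.exp_one_lt_d9]
    calc Real.exp (t / 4) ^ 2 = Real.exp (1 / 2) ^ t := by
          rw [← Real.exp_nat_mul, ← Real.exp_nat_mul]
          congr 1
          push_cast
          ring
      _ ≤ 2 ^ t := pow_le_pow_left₀ (Real.exp_pos _).le h1 t
  have hcard : (Fintype.card (FinHypergraph n) : ℝ) = 2 ^ 2 ^ n := by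
    simp
  rw [← ht, hcard]
  -- After squaring, each of the two factors is separately at most `2 ^ t`, the first one strictly.
  refine lt_of_pow_lt_pow_left₀ 2 (by positivity) ?_
  have h4 : ((2 : ℝ) ^ 2 ^ n) ^ 2 < 2 ^ t := by
    rw [← pow_mul, mul_comm]
    exact pow_lt_pow_right₀ (by norm_num) hbig
  calc ((2 : ℝ) ^ 2 ^ n * (1 + 1 / (8 * (n : ℝ) ^ 6)) ^ (2 ^ (10 * n))) ^ 2
      ≤ (2 ^ 2 ^ n * Real.exp (t / 4)) ^ 2 := by gcongr
    _ = (2 ^ 2 ^ n) ^ 2 * Real.exp (t / 4) ^ 2 := mul_pow _ _ _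
    _ ≤ (2 ^ 2 ^ n) ^ 2 * 2 ^ t := by gcongr
    _ < 2 ^ t * 2 ^ t := by gcongr
    _ = (2 ^ t) ^ 2 := (sq _).symm

theorem space_hypergraphSketch {T : ℕ} (r : ℕ) (k : ℝ) {t : ℕ}
    (ω : Fin (2 ^ t) → Coins n L T × AllLabels n L T B)
    (A : Finset (hypergraphSketch r k ω).Seed) (hA : A.card = 2 ^ t) :
    (dynamicHypergraphSparsification (hypergraphSketch r k ω) A).space =
      t + (L + 1) * (T + 2) * (n * B) := by
  unfold StreamingAlgorithm.space
  change Nat.clog 2 (Nat.card (A × (Fin (Fintype.card (Row n L T B)) → ZMod 2))) = _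
  rw [Nat.card_prod, Nat.card_fun, Nat.card_zmod, Nat.card_eq_fintype_card, Fintype.card_coe, hA,
    Nat.card_eq_fintype_card, Fintype.card_fin, ← pow_add, Nat.clog_pow 2 _ (by norm_num)]
  simp only [Fintype.card_prod, Fintype.card_fin]

theorem natLog_add_two_le {m : ℕ} (hm : 2 ≤ m) : (Nat.log 2 m : ℝ) + 2 ≤ 5 * Real.log m := by
  have h1 : (Nat.log 2 m : ℝ) * Real.log 2 ≤ Real.log m := by
    rw [← Real.log_pow]
    refine Real.log_le_log (by positivity) ?_
    exact_mod_cast Nat.pow_log_le_self 2 (by omega : m ≠ 0)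
  have h2 : Real.log 2 ≤ Real.log m := Real.log_le_log (by norm_num) (by exact_mod_cast hm)
  have h3 := Real.log_two_gt_d9
  have h4 : (0 : ℝ) ≤ Nat.log 2 m := Nat.cast_nonneg _
  nlinarith

/-- The five powers of `l` come from the rounds, the label length and the cube in `k`. The constant
is `5 * 2 * 37 * 64000`, plus 20 for the seed index, and `10 ^ 5` comes from `l ≤ 10 * log (2 + X)`.
-/
theorem space_bound {r m l q : ℕ} {ε k : ℝ} (hn : 1 ≤ n) (hr : 1 ≤ r) (hm : 2 ≤ m) (hε : 0 < ε)
    (hε1 : ε < 1) (hL : L = Nat.log 2 m + 1) (hl : l = Nat.log 2 (n * (L + 1)) + 1) (hl2 : 2 ≤ l)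
    (hk : k = 64000 * (l : ℝ) ^ 3 / ε ^ 2) (hq : q = ⌈8 * k⌉₊)
    (hB : B = l * (r + 1) * q + 19 * l) :
    ((10 * n + (L + 1) * (l + 2) * (n * B) : ℕ) : ℝ) ≤
      23680020 * 10 ^ 5 * polylogTimes 5 ((n : ℝ) * r * Real.log m / ε ^ 2) := by
  obtain ⟨X, hX⟩ : ∃ X : ℝ, X = (n : ℝ) * r * Real.log m / ε ^ 2 := ⟨_, rfl⟩
  have hn' : (1 : ℝ) ≤ n := by exact_mod_cast hn
  have hr' : (1 : ℝ) ≤ r := by exact_mod_cast hr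
  have hl' : (2 : ℝ) ≤ l := by exact_mod_cast hl2
  have hl1 : (1 : ℝ) ≤ (l : ℝ) ^ 5 := one_le_pow₀ (by linarith)
  have hε2 : ε ^ 2 ≤ 1 := pow_le_one₀ hε.le hε1.le
  have hε0 : 0 < ε ^ 2 := by positivity
  have hlog2 := Real.log_two_gt_d9
  have hlogm : Real.log 2 ≤ Real.log m := Real.log_le_log (by norm_num) (by exact_mod_cast hm)
  have hlogm0 : 0 < Real.log m := by linarith
  have hL5 : (L : ℝ) + 1 ≤ 5 * Real.log m := by
    rw [hL]
    push_cast
    linarith [natLog_add_two_le hm]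
  have hnX : (n : ℝ) * Real.log m ≤ X := by
    rw [hX, le_div_iff₀ hε0]
    calc (n : ℝ) * Real.log m * ε ^ 2 ≤ n * Real.log m * 1 := by gcongr
      _ = n * 1 * Real.log m := by ring
      _ ≤ _ := by gcongr
  have hX0 : 0 < X := lt_of_lt_of_le (by positivity) hnX
  have hnX' : (n : ℝ) ≤ 2 * X := by nlinarith
  have hk1 : 1 ≤ k := by
    rw [hk, le_div_iff₀ hε0]
    have : (1 : ℝ) ≤ (l : ℝ) ^ 3 := one_le_pow₀ (by linarith)
    linarith
  have hq9 : (q : ℝ) ≤ 9 * k := by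
    rw [hq]
    linarith [(Nat.ceil_lt_add_one (by linarith : 0 ≤ 8 * k))]
  have hBk : (B : ℝ) ≤ 37 * (l * r * k) := by
    rw [hB]
    push_cast
    have h1 : (l : ℝ) * (r + 1) * q ≤ l * (2 * r) * (9 * k) := by
      gcongr
      linarith
    have h2 : (l : ℝ) * 1 * 1 ≤ l * r * k := by gcongr
    linarith
  have hsize : ((L : ℝ) + 1) * (l + 2) * (n * B) ≤ 23680000 * (X * (l : ℝ) ^ 5) := by
    calc ((L : ℝ) + 1) * (l + 2) * (n * B)
        ≤ (5 * Real.log m) * (2 * l) * (n * (37 * (l * r * k))) := by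
          gcongr
          linarith
      _ = 23680000 * (X * (l : ℝ) ^ 5) := by
          rw [hX, hk]
          ring
  have hlX : (l : ℝ) ≤ 10 * Real.log (2 + X) := by
    have h1 : ((l : ℝ) - 1) * Real.log 2 ≤ Real.log (2 ^ 3 * (2 + X)) := by
      have h2 : (l : ℝ) - 1 = Nat.log 2 (n * (L + 1)) := by
        rw [hl]
        push_cast
        ring
      rw [h2, ← Real.log_pow]
      refine Real.log_le_log (by positivity) ?_
      have h3 : (2 : ℝ) ^ Nat.log 2 (n * (L + 1)) ≤ n * (L + 1) := by
        exact_mod_cast Nat.pow_log_le_self 2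
          (Nat.mul_ne_zero (by omega) (Nat.succ_ne_zero L))
      have h4 : (n : ℝ) * (L + 1) ≤ n * (5 * Real.log m) := by gcongr
      linarith
    rw [Real.log_mul (by norm_num) (by linarith), Real.log_pow] at h1
    have h5 : Real.log 2 ≤ Real.log (2 + X) := Real.log_le_log (by norm_num) (by linarith)
    push_cast at h1
    nlinarith
  have hpow : (l : ℝ) ^ 5 ≤ 10 ^ 5 * Real.log (2 + X) ^ 5 := by
    rw [← mul_pow]
    gcongr
  rw [polylogTimes, ← hX]
  push_cast
  calc (10 : ℝ) * n + ((L : ℝ) + 1) * (l + 2) * (n * B)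
      ≤ 20 * (X * (l : ℝ) ^ 5) + 23680000 * (X * (l : ℝ) ^ 5) := by
        have : X * 1 ≤ X * (l : ℝ) ^ 5 := by gcongr
        linarith
    _ = 23680020 * (X * (l : ℝ) ^ 5) := by ring
    _ ≤ 23680020 * (X * (10 ^ 5 * Real.log (2 + X) ^ 5)) := by gcongr
    _ = _ := by ring

/-- With sufficiently many samples and measurements there are `2 ^ (10 * n)` seeds which work for
every hypergraph. -/
theorem exists_hypergraphSketch {l r m q : ℕ} {ε k : ℝ} (hn : 1 ≤ n) (hl : 2 ≤ l)
    (hnl : n * (L + 1) < 2 ^ l) (hmL : m ≤ 2 ^ L) (hε : 0 < ε) (hε1 : ε ≤ 1)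
    (hk : k = 64000 * (l : ℝ) ^ 3 / ε ^ 2) (hq : 8 * k ≤ q)
    (hB : B = l * (r + 1) * q + 19 * l) :
    ∃ ω : Fin (2 ^ (10 * n)) → Coins n L l × AllLabels n L l B, ∀ (H : FinHypergraph n)
      (σ : List (StreamUpdate n)), H.card ≤ m → (∀ e ∈ H, e.card ≤ r) → ResultsIn σ H →
        1 - 1 / (n : ℝ) ^ 6 ≤
          (dynamicHypergraphSparsification (hypergraphSketch r k ω)
            (univ : Finset (Fin (2 ^ (10 * n))))).successProb ε σ H := by
  obtain ⟨ω, hω⟩ := exists_seeds _ (prob_failure_le (r := r) hn hl hnl hε hε1 hk hq hB)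
    (card_mul_pow_lt hn)
  refine ⟨ω, fun H σ hHm hHr hσ => ?_⟩
  have hε2 : ε ^ 2 ≤ 1 := pow_le_one₀ hε.le hε1
  have hk1 : 1 ≤ k := by
    have hl' : (2 : ℝ) ≤ l := by exact_mod_cast hl
    have : (1 : ℝ) ≤ (l : ℝ) ^ 3 := one_le_pow₀ (by linarith)
    rw [hk, le_div_iff₀ (by positivity)]
    linarith
  have hnl' : n < 2 ^ l := (Nat.le_mul_of_pos_right n (Nat.succ_pos L)).trans_lt hnl
  let : Fintype (hypergraphSketch r k ω).Seed := Fin.fintype (2 ^ (10 * n))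
  have : Nonempty (hypergraphSketch r k ω).Seed := ⟨(0 : Fin (2 ^ (10 * n)))⟩
  refine successProb_ge (hypergraphSketch r k ω) hσ ?_
  have hcard : Fintype.card (hypergraphSketch r k ω).Seed = 2 ^ (10 * n) :=
    Fintype.card_fin (2 ^ (10 * n))
  rw [hcard]
  have hbad : ∀ R : Fin (2 ^ (10 * n)), ¬ IsSparsifier ε H ((hypergraphSketch r k ω).recover R
      ((hypergraphSketch r k ω).sketch R fun e => if e ∈ H then 1 else 0)) →
      ¬ GoodSamples ε k H (ω R).1 ∨
        ∃ c ∈ range (L + 1) ×ˢ range (l + 2), Ambiguous r k H (ω R).1 (ω R).2 c.1 c.2 := by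
    intro R hR
    by_contra! hcon
    obtain ⟨hgood, hamb⟩ := hcon
    refine hR ?_
    have h := recoverWeight_eq hgood (by omega) hnl' hk1 (hHm.trans hmL) hHr
      (fun d hd τ hτ => hamb (d, τ) (by simp; omega)) (isMeasurement_sketch r k ω R H)
    change IsSparsifier ε H (recoverWeight r k (ω R).2 _)
    rw [h]
    exact hgood.isSparsifier (by omega) (by linarith) hε.le
  have hle : (univ.filter fun R : Fin (2 ^ (10 * n)) => ¬ IsSparsifier ε H
      ((hypergraphSketch r k ω).recover R ((hypergraphSketch r k ω).sketch R
        fun e => if e ∈ H then 1 else 0))).card ≤ 2 ^ (10 * n) / n ^ 6 := by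
    refine (card_le_card fun R hR => ?_).trans (hω H).le
    exact (@mem_filter _ _ (_) univ R).2 ⟨mem_univ R, hbad R (mem_filter.1 hR).2⟩
  have h1 : (2 ^ (10 * n) / n ^ 6 : ℕ) ≤ ((2 ^ (10 * n) : ℕ) : ℝ) / ((n ^ 6 : ℕ) : ℝ) :=
    Nat.cast_div_le
  rw [one_div_mul_eq_div]
  refine le_trans (Nat.cast_le.2 hle) (h1.trans_eq ?_)
  push_cast
  rfl

end Parameters

end HypergraphSketch

theorem mainTheorem4 :
    ∃ (C : ℝ) (c : ℕ), ∀ (n r m : ℕ) (ε : ℝ), 1 ≤ n → 1 ≤ r → 2 ≤ m → 0 < ε → ε < 1 →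
      ∃ (L : LinearSketch n) (S : Finset L.Seed),
        S.card = 2 ^ (10 * n) ∧
        ((dynamicHypergraphSparsification L S).space : ℝ) ≤
          C * polylogTimes c ((n : ℝ) * (r : ℝ) * Real.log (m : ℝ) / ε ^ 2) ∧
        ∀ (H : FinHypergraph n) (σ : List (StreamUpdate n)),
          H.card ≤ m → (∀ e ∈ H, e.card ≤ r) → ResultsIn σ H →
            1 - 1 / (n : ℝ) ^ 6 ≤
              (dynamicHypergraphSparsification L S).successProb ε σ H := by
  refine ⟨23680020 * 10 ^ 5, 5, fun n r m ε hn hr hm hε hε1 => ?_⟩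
  obtain ⟨L, hL⟩ : ∃ L, L = Nat.log 2 m + 1 := ⟨_, rfl⟩
  -- `l` serves both as the number of rounds and as the scale of all failure exponents, hence it
  -- must dominate the logarithms of `n` and of the number of rates.
  obtain ⟨l, hl⟩ : ∃ l, l = Nat.log 2 (n * (L + 1)) + 1 := ⟨_, rfl⟩
  obtain ⟨k, hk⟩ : ∃ k : ℝ, k = 64000 * (l : ℝ) ^ 3 / ε ^ 2 := ⟨_, rfl⟩
  obtain ⟨q, hq⟩ : ∃ q, q = ⌈8 * k⌉₊ := ⟨_, rfl⟩
  obtain ⟨B, hB⟩ : ∃ B, B = l * (r + 1) * q + 19 * l := ⟨_, rfl⟩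
  have hnl : n * (L + 1) < 2 ^ l := hl ▸ Nat.lt_pow_succ_log_self (by norm_num) _
  have hl2 : 2 ≤ l := by
    have h1 : 0 < Nat.log 2 (n * (L + 1)) :=
      Nat.log_pos (by norm_num) (by
        have : L + 1 ≤ n * (L + 1) := Nat.le_mul_of_pos_left (L + 1) hn
        omega)
    omega
  have hmL : m ≤ 2 ^ L := hL ▸ (Nat.lt_pow_succ_log_self (by norm_num) m).le
  obtain ⟨ω, hω⟩ := HypergraphSketch.exists_hypergraphSketch hn hl2 hnl hmL hε hε1.le hk
    (hq ▸ Nat.le_ceil _) hB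
  have hcard : (Finset.univ : Finset (Fin (2 ^ (10 * n)))).card = 2 ^ (10 * n) := by
    rw [Finset.card_univ, Fintype.card_fin]
  refine ⟨HypergraphSketch.hypergraphSketch r k ω,
    (Finset.univ : Finset (Fin (2 ^ (10 * n)))), hcard, ?_, hω⟩
  rw [HypergraphSketch.space_hypergraphSketch r k ω _ hcard]
  exact HypergraphSketch.space_bound hn hr hm hε hε1 hL hl hl2 hk hq hB
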